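/- **Setting.** Let $\Bbbk$ be a field of characteristic $0$. For $n\ge 0$ let $TL_n(0)$ be the Temperley–Lieb algebra over $\Bbbk$ with loop parameter $0$: it has as basis the crossingless matchings (diagrams) of $n$ bottom and $n$ top points of a planar strip, and the product $XY$ stacks $X$ on top of $Y$, a diagram with a closed loop being $0$. Let $U_i\in TL_n(0)$, $1\le i<n$, be the diagram with a cap joining the bottom points $i,i+1$, a cup joining the top points $i,i+1$, and vertical strands elsewhere. A Jones–Wenzl projector $JW_n\in TL_n(0)$ is an element in which the identity diagram has coefficient $1$ and which satisfies $U_iJW_n=0=JW_nU_i$ for all $i$. When $JW_n$ exists and is unique, let $p_1^{(n)}$ (for $n\ge1$) and $p_2^{(n)}$ (for $n\ge 2$) be the coefficients of the identity diagram in the partial traces of $JW_n$ obtained by closing the rightmost strand, respectively the two rightmost strands. Let $E_0^{(n)}\in TL_{n+2}(0)$ be $JW_n$ with two vertical strands added on the right, and put $$E_1^{(n)}=E_0^{(n)}U_nU_{n+1}E_0^{(n)},\qquad E_2^{(n)}=E_0^{(n)}U_{n+1}U_nE_0^{(n)}\qquad(n\ge1),$$ $$E_3^{(n)}=E_0^{(n)}U_nU_{n-1}U_{n+1}U_nE_0^{(n)}\qquad(n\ge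 3).$$ **Theorem.** Let $n\ge1$ be odd. Then $JW_n$ exists and is unique, and $p_1^{(n)}=0$. If $n\ge3$, then $p_2^{(n)}$ is invertible, and $$p_2^{(3)}=-2,\qquad p_2^{(n+2)}=-2-\frac1{p_2^{(n)}},\qquad p_2^{(2k+1)}=\frac{-(k+1)}{k}\quad(k\ge1).$$ Moreover $$JW_3=E_0^{(1)}-E_1^{(1)}-E_2^{(1)},\qquad JW_{n+2}=E_0^{(n)}-E_1^{(n)}-E_2^{(n)}-\frac1{p_2^{(n)}}E_3^{(n)}\quad(n\ge3).$$ For $n\ge 3$ the elements $JW_{n+2}$, $E_1^{(n)}$, $E_2^{(n)}$ and $\frac1{p_2^{(n)}}E_3^{(n)}$ are pairwise orthogonal idempotents of $TL_{n+2}(0)$ whose sum is the idempotent $E_0^{(n)}$; for $n=1$ the same holds for $JW_3$, $E_1^{(1)}$, $E_2^{(1)}$ and their sum $E_0^{(1)}$. **Corollary.** For every odd $n$, $JW_n$ is homogeneous of degree $0$. Here a cap (cup) of a diagram is a strand joining two bottom (top) points, it is even or odd according to the number of its left endpoint (counted from $1$ at the left), and for any elements $f_s,g_s,f_t,g_t$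 of an abelian group the degree of a diagram is the sum of $g_s-f_t$ for each even cap, $g_t-f_s$ for each odd cap, $f_s-g_t$ for each even cup and $f_t-g_s$ for each odd cup. Equivalently, in every diagram with nonzero coefficient in $JW_n$ the number of even caps equals the number of odd cups. -/

import Mathlib

noncomputable section

namespace TemperleyLieb

/-- The `2n` boundary points of a planar strip with `n` points on the bottom and `n` on the top:
`inl i` is the bottom point and `inr i` the top point number `i`, numbered from the left
(counting from `0`). -/
abbrev Pt (n : ℕ) : Type := Fin n ⊕ Fin n

/-- The place of a boundary point when one walks around the strip: along the bottom from left to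
right, then along the top from right to left. -/
def pos {n : ℕ} : Pt n → ℕ
  | Sum.inl i => i.val
  | Sum.inr i => 2 * n - 1 - i.val

/-- A Temperley-Lieb diagram on `n` strands: a crossingless perfect matching of the `2n` boundary
points. The strand at `x` joins `x` to `partner x`. -/
@[ext]
structure Diagram (n : ℕ) where
  partner : Pt n → Pt n
  partner_partner : ∀ x, partner (partner x) = x
  partner_ne : ∀ x, partner x ≠ x
  crossingless : ∀ x y,
    ¬ (pos x < pos y ∧ pos y < pos (partner x) ∧ pos (partner x) < pos (partner y))

/-- The identity diagram: `n` vertical strands. -/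
def Diagram.identity (n : ℕ) : Diagram n where
  partner := Sum.swap
  partner_partner := Sum.swap_swap
  partner_ne := by rintro (i | i) <;> simp
  crossingless := by
    rintro (⟨i, hi⟩ | ⟨i, hi⟩) (⟨j, hj⟩ | ⟨j, hj⟩) <;> simp only [pos, Sum.swap_inl, Sum.swap_inr] <;> omega

/-- The involution of `Fin n` that exchanges `i` and `i + 1` (counting from `0`). -/
def swapNext {n : ℕ} (i : ℕ) (h : i + 1 < n) (j : Fin n) : Fin n :=
  if j.val = i then ⟨i + 1, h⟩ else if j.val = i + 1 then ⟨i, by omega⟩ else j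

/-- The diagram with a cap joining the bottom points `i, i + 1`, a cup joining the top points
`i, i + 1` (counting from `0`), and vertical strands elsewhere. -/
def Diagram.cupCap {n : ℕ} (i : ℕ) (h : i + 1 < n) : Diagram n where
  partner
    | Sum.inl j => if j.val = i ∨ j.val = i + 1 then Sum.inl (swapNext i h j) else Sum.inr j
    | Sum.inr j => if j.val = i ∨ j.val = i + 1 then Sum.inr (swapNext i h j) else Sum.inl j
  partner_partner := by
    rintro (⟨j, hj⟩ | ⟨j, hj⟩) <;> by_cases h1 : j = i <;> by_cases h2 : j = i + 1 <;>
      simp_all [swapNext]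
  partner_ne := by
    rintro (⟨j, hj⟩ | ⟨j, hj⟩) <;> by_cases h1 : j = i <;> by_cases h2 : j = i + 1 <;>
      simp_all [swapNext]
  crossingless := by
    rintro (⟨j, hj⟩ | ⟨j, hj⟩) (⟨l, hl⟩ | ⟨l, hl⟩) <;>
      simp only [swapNext] <;> split_ifs <;> simp only [pos] <;> omega

/-- The boundary points of `n` strands as those of `n + 1` strands, leaving out the last one. -/
abbrev Pt.castSucc {n : ℕ} : Pt n → Pt (n + 1) := Sum.map Fin.castSucc Fin.castSucc

/-- The matching of `addStrand`, below. -/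
def addStrandPartner {n : ℕ} (f : Pt n → Pt n) : Pt (n + 1) → Pt (n + 1)
  | Sum.inl j =>
      if h : j.val < n then Pt.castSucc (f (Sum.inl ⟨j.val, h⟩)) else Sum.inr (Fin.last n)
  | Sum.inr j =>
      if h : j.val < n then Pt.castSucc (f (Sum.inr ⟨j.val, h⟩)) else Sum.inl (Fin.last n)

theorem addStrandPartner_castSucc {n : ℕ} (f : Pt n → Pt n) (x : Pt n) :
    addStrandPartner f (Pt.castSucc x) = Pt.castSucc (f x) := by
  rcases x with j | j <;> simp [addStrandPartner, Pt.castSucc]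

theorem addStrandPartner_inl {n : ℕ} (f : Pt n → Pt n) :
    addStrandPartner f (Sum.inl (Fin.last n)) = Sum.inr (Fin.last n) := by
  simp [addStrandPartner]

theorem addStrandPartner_inr {n : ℕ} (f : Pt n → Pt n) :
    addStrandPartner f (Sum.inr (Fin.last n)) = Sum.inl (Fin.last n) := by
  simp [addStrandPartner]

theorem Pt.cases_castSucc {n : ℕ} (y : Pt (n + 1)) :
    (∃ x : Pt n, y = Pt.castSucc x) ∨ y = Sum.inl (Fin.last n) ∨ y = Sum.inr (Fin.last n) := by
  rcases y with j | j
  · rcases Fin.eq_castSucc_or_eq_last j with ⟨i, rfl⟩ | rfl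
    · exact Or.inl ⟨Sum.inl i, rfl⟩
    · exact Or.inr (Or.inl rfl)
  · rcases Fin.eq_castSucc_or_eq_last j with ⟨i, rfl⟩ | rfl
    · exact Or.inl ⟨Sum.inr i, rfl⟩
    · exact Or.inr (Or.inr rfl)

theorem pos_castSucc {n : ℕ} (x : Pt n) :
    (pos x < n ∧ pos (Pt.castSucc x) = pos x) ∨
      (n ≤ pos x ∧ pos (Pt.castSucc x) = pos x + 2) := by
  rcases x with ⟨j, hj⟩ | ⟨j, hj⟩ <;> simp only [Sum.map, pos] <;>
    simp <;> omega

/-- A diagram on `n` strands with one more vertical strand added on the right. -/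
def Diagram.addStrand {n : ℕ} (D : Diagram n) : Diagram (n + 1) where
  partner := addStrandPartner D.partner
  partner_partner y := by
    rcases Pt.cases_castSucc y with ⟨x, rfl⟩ | rfl | rfl <;>
      simp only [addStrandPartner_castSucc, addStrandPartner_inl, addStrandPartner_inr,
        D.partner_partner]
  partner_ne y := by
    rcases Pt.cases_castSucc y with ⟨x, rfl⟩ | rfl | rfl
    · rw [addStrandPartner_castSucc]
      intro h
      exact D.partner_ne x
        (Sum.map_injective.2 ⟨Fin.castSucc_injective n, Fin.castSucc_injective n⟩ h)
    · simp [addStrandPartner_inl]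
    · simp [addStrandPartner_inr]
  crossingless y z := by
    have hl : pos (Sum.inl (Fin.last n) : Pt (n + 1)) = n := rfl
    have hr : pos (Sum.inr (Fin.last n) : Pt (n + 1)) = n + 1 := by
      simp only [pos, Fin.val_last]; omega
    rcases Pt.cases_castSucc y with ⟨x, rfl⟩ | rfl | rfl <;>
      rcases Pt.cases_castSucc z with ⟨w, rfl⟩ | rfl | rfl <;>
      simp only [addStrandPartner_castSucc, addStrandPartner_inl, addStrandPartner_inr, hl, hr]
    · have h := D.crossingless x w
      have h1 := pos_castSucc x
      have h2 := pos_castSucc w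
      have h3 := pos_castSucc (D.partner x)
      have h4 := pos_castSucc (D.partner w)
      omega
    · have h3 := pos_castSucc (D.partner x)
      omega
    · omega
    · have h2 := pos_castSucc w
      omega
    · omega
    · omega
    · omega
    · omega
    · omega

/-- The diagram `F` is what one sees of the graph `G` through the boundary points `b x`: two
boundary points are joined by a strand of `F` exactly if they are connected in `G`. -/
def Realizes {V : Type} {n : ℕ} (G : SimpleGraph V) (b : Pt n → V) (F : Diagram n) : Prop :=
  ∀ x y, x ≠ y → (F.partner x = y ↔ G.Reachable (b x) (b y))

/-- The number of closed loops: connected components of `G` without boundary points. -/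
def loops {V : Type} {n : ℕ} (G : SimpleGraph V) (b : Pt n → V) : ℕ :=
  Nat.card {c : G.ConnectedComponent // ∀ x, G.connectedComponentMk (b x) ≠ c}

/-- The Temperley-Lieb algebra `TL_n(δ)` over `R`, as a module: it is free on the diagrams. -/
def TL (R : Type*) [CommRing R] (_δ : R) (n : ℕ) : Type _ := Diagram n →₀ R

section Algebra

variable {R : Type*} [CommRing R] {δ : R} {n : ℕ}

instance : AddCommGroup (TL R δ n) := inferInstanceAs (AddCommGroup (Diagram n →₀ R))

instance : Module R (TL R δ n) := inferInstanceAs (Module R (Diagram n →₀ R))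

/-- The coefficient of a diagram in an element of `TL_n(δ)`. -/
def coeff (X : TL R δ n) (D : Diagram n) : R := DFunLike.coe (F := Diagram n →₀ R) X D

/-- A diagram as a basis element of `TL_n(δ)`. -/
def ofDiagram (D : Diagram n) : TL R δ n := Finsupp.single D (1 : R)

open Classical in
/-- The element of `TL_n(δ)` given by a planar picture with underlying graph `G` and boundary
points `b x`: the diagram that remains when the closed loops are removed, times one factor `δ` for
each loop. (That diagram is unique. It exists for the planar pictures used below.) -/
def evalGraph {V : Type} (δ : R) (G : SimpleGraph V) (b : Pt n → V) : TL R δ n :=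
  if h : ∃ F : Diagram n, Realizes G b F then (δ ^ loops G b) • ofDiagram h.choose else 0

/-- The picture of `D` stacked on top of `E`, on three levels of `n` points (`0` bottom,
`1` middle, `2` top): `E` joins points of levels `0` and `1`, and `D` those of levels `1`, `2`. -/
def stackGraph (D E : Diagram n) : SimpleGraph (Fin 3 × Fin n) :=
  SimpleGraph.fromRel fun v w =>
    (∃ x : Pt n, v = Sum.elim (fun i => (0, i)) (fun i => (1, i)) x ∧
      w = Sum.elim (fun i => (0, i)) (fun i => (1, i)) (E.partner x)) ∨
    (∃ x : Pt n, v = Sum.elim (fun i => (1, i)) (fun i => (2, i)) x ∧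
      w = Sum.elim (fun i => (1, i)) (fun i => (2, i)) (D.partner x))

/-- The product of two diagrams: `D` stacked on top of `E`. -/
def stack (δ : R) (D E : Diagram n) : TL R δ n :=
  evalGraph δ (stackGraph D E) (Sum.elim (fun i => (0, i)) (fun i => (2, i)))

/-- The product of `TL_n(δ)`, extended bilinearly from diagrams. -/
instance : Mul (TL R δ n) where
  mul X Y := Finsupp.linearCombination R
    (fun D : Diagram n => Finsupp.linearCombination R (fun E : Diagram n => stack δ D E) Y) X

/-- The picture of `D` with the last top point joined to the last bottom point by an arc on the
right of the strip. -/
def closeGraph (D : Diagram (n + 1)) : SimpleGraph (Pt (n + 1)) :=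
  SimpleGraph.fromRel fun v w =>
    w = D.partner v ∨ (v = Sum.inl (Fin.last n) ∧ w = Sum.inr (Fin.last n))

/-- The partial trace `TL_{n+1}(δ) → TL_n(δ)`, which closes the rightmost strand. -/
def partialTrace : TL R δ (n + 1) →ₗ[R] TL R δ n :=
  Finsupp.linearCombination R fun D : Diagram (n + 1) =>
    evalGraph δ (closeGraph D) Pt.castSucc

/-- The map `TL_n(δ) → TL_{n+1}(δ)` that adds a vertical strand on the right. -/
def strand : TL R δ n →ₗ[R] TL R δ (n + 1) := Finsupp.lmapDomain R R Diagram.addStrand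

variable (R δ n)

/-- The generator `U_i` of `TL_n(δ)`, for `1 ≤ i < n`: cap and cup at the points `i, i + 1`,
counting from `1`. (It is set to `0` for other `i`.) -/
def U (i : ℕ) : TL R δ n :=
  if h : 1 ≤ i ∧ i < n then ofDiagram (Diagram.cupCap (i - 1) (by omega)) else 0

variable {R δ n}

/-- `X` is a Jones-Wenzl projector: the coefficient of the identity diagram is `1`, and `X` is
killed by all caps and cups. -/
def IsJonesWenzl (X : TL R δ n) : Prop :=
  coeff X (Diagram.identity n) = 1 ∧
    ∀ i, 1 ≤ i → i < n → U R δ n i * X = 0 ∧ X * U R δ n i = 0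

variable (R δ n)

open Classical in
/-- The Jones-Wenzl projector `JW_n` in `TL_n(δ)` (set to `0` if there is none). -/
def JW : TL R δ n := if h : ∃ X : TL R δ n, IsJonesWenzl X then h.choose else 0

/-- `p_1^{(n)}`, for `n ≥ 1`: the coefficient of the identity in the one-step partial trace of
`JW_n`. -/
def p₁ : ℕ → R
  | 0 => 0
  | m + 1 => coeff (partialTrace (JW R δ (m + 1))) (Diagram.identity m)

/-- `p_2^{(n)}`, for `n ≥ 2`: the coefficient of the identity in the two-step partial trace of
`JW_n`. -/
def p₂ : ℕ → R
  | 0 => 0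
  | 1 => 0
  | m + 2 => coeff (partialTrace (partialTrace (JW R δ (m + 2)))) (Diagram.identity m)

/-- `E_0^{(n)}`: the projector `JW_n` with two vertical strands on its right. -/
def E₀ : TL R δ (n + 2) := strand (strand (JW R δ n))

/-- `E_1^{(n)}`, for `n ≥ 1`: two copies of `JW_n`, between them the diagram with a cap at the
bottom points `n + 1, n + 2`, a cup at the top points `n, n + 1`, and the bottom point `n` joined
to the top point `n + 2`. -/
def E₁ : TL R δ (n + 2) :=
  E₀ R δ n * (U R δ (n + 2) n * U R δ (n + 2) (n + 1)) * E₀ R δ n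

/-- `E_2^{(n)}`, for `n ≥ 1`: the upside-down picture of `E_1^{(n)}`. -/
def E₂ : TL R δ (n + 2) :=
  E₀ R δ n * (U R δ (n + 2) (n + 1) * U R δ (n + 2) n) * E₀ R δ n

/-- `E_3^{(n)}`, for `n ≥ 2`: two copies of `JW_n`, between them the diagram with two nested caps
at the bottom points `n - 1, n, n + 1, n + 2`, two nested cups at the same top points, and vertical
strands elsewhere. -/
def E₃ : TL R δ (n + 2) :=
  E₀ R δ n *
    (U R δ (n + 2) n * (U R δ (n + 2) (n - 1) * U R δ (n + 2) (n + 1)) * U R δ (n + 2) n) *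
    E₀ R δ n

end Algebra

/-- The number of caps (strands joining two bottom points) whose left endpoint, counted from `1`,
has a number in `S`. -/
def numCaps {n : ℕ} (S : Set ℕ) (D : Diagram n) : ℕ :=
  Set.ncard {i : Fin n | i.val + 1 ∈ S ∧ ∃ j, i < j ∧ D.partner (Sum.inl i) = Sum.inl j}

/-- The number of cups (strands joining two top points) whose left endpoint, counted from `1`,
has a number in `S`. -/
def numCups {n : ℕ} (S : Set ℕ) (D : Diagram n) : ℕ :=
  Set.ncard {i : Fin n | i.val + 1 ∈ S ∧ ∃ j, i < j ∧ D.partner (Sum.inr i) = Sum.inr j}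

/-- The degree of a diagram, in an abelian group with elements `f_s, g_s, f_t, g_t`: an even cap
has degree `g_s - f_t`, an odd cap `g_t - f_s`, an even cup `f_s - g_t`, an odd cup `f_t - g_s`. -/
def degree {A : Type*} [AddCommGroup A] (fs gs ft gt : A) {n : ℕ} (D : Diagram n) : A :=
  numCaps {i | Even i} D • (gs - ft) + numCaps {i | Odd i} D • (gt - fs) +
    numCups {i | Even i} D • (fs - gt) + numCups {i | Odd i} D • (ft - gs)

/-- `X` is homogeneous of degree `d`: all diagrams that occur in `X` have degree `d`. -/
def IsHomogeneous {R : Type*} [CommRing R] {δ : R} {n : ℕ} {A : Type*} [AddCommGroup A]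
    (fs gs ft gt : A) (X : TL R δ n) (d : A) : Prop :=
  ∀ D : Diagram n, coeff X D ≠ 0 → degree fs gs ft gt D = d

end TemperleyLieb

end

open TemperleyLieb

/-! Write n = 2j+1. The projectors are built from the relations of the generators alone and only
afterwards compared with the definitions by diagrams. `jw` is the recursion of the theorem in any
algebra whose generators satisfy `Relations`, with the explicit number `ptr k j` in the place of
p_2.

Suppose that e = JW_n is an idempotent killed by U_1, …, U_{n-1}. As e commutes with U_{n+1}, the
products of E_1, E_2, E_3 are controlled by U_n e U_n. For n ≥ 3, expanding e by the recursion gives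
U_n e U_n = P U_n with P = c Q U_{n-2} Q, where Q = JW_{n-2} and c = -2 - 1/p_2^{(n-2)} (c = -2 if n
= 3). Thus eP = Pe = 0, which gives the orthogonality relations that involve U_n e U_n, and U_{n-1}
P U_{n-1} = c Q U_{n-1}, which gives E_3² = c E_3. The same expansion shows that U_n kills the next
element from the left; annihilation from the right is the same statement in the opposite ring. This
is `exists_partial`, `step_left` and `isProj`.

Uniqueness: a diagram other than the identity has an innermost cup, and if n ≥ 3 such a diagram is
U_i X for some i. Hence two projectors satisfy X = XY = Y, and `JW_eq` identifies the projector with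
the word `jw`. The numbers p_1 and p_2 are computed modulo diagrams with a cup or a cap among
strands that stay open: modulo these e is 1, and p_2 reduces to the traces of three short words
(`p₂_eq`).

Homogeneity: U_i shifts the degree by an amount that depends on the parity of i only, with opposite
signs for even and odd i, and every word in the recursion has as many even as odd generators
(`jw_mul_mem_homSpan`).

All this takes place in an associative ring. Associativity (`ofDiagram_mul_assoc`) holds because a
part of a picture may be replaced by the matching seen of it (`Sees.glue`). It also needs that a
loop-free stack of two diagrams is crossingless (`exists_sees_stack`), which is shown by linking the
points one pair at a time. -/

noncomputable section

namespace TemperleyLieb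

open Relation

/-! ### Pictures as graphs: connectivity, closed loops, replacing a part -/

section Pictures

/-- Seen through the boundary points `b x`, the graph with edges `r` has no closed loops. -/
def LoopFree {V β : Type*} (r : V → V → Prop) (b : β → V) : Prop :=
  ∀ v, ∃ x, EqvGen r v (b x)

/-- Seen through the boundary points `b x`, the graph with edges `r` is the matching `f`, without
closed loops. -/
structure Sees {V β : Type*} (r : V → V → Prop) (b : β → V) (f : β → β) : Prop where
  loopFree : LoopFree r b
  edge : ∀ x, EqvGen r (b x) (b (f x))
  sep : ∀ x y, EqvGen r (b x) (b y) → y = x ∨ y = f x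

/-- Minimality of the generated equivalence. The invariants that separate components below all enter
as `s`. -/
theorem eqvGen_le {V : Type*} {r s : V → V → Prop} (hs : Equivalence s)
    (h : ∀ v w, r v w → s v w) {v w : V} (hr : EqvGen r v w) : s v w := by
  induction hr with
  | rel x y h' => exact h x y h'
  | refl x => exact hs.refl x
  | symm x y _ ih => exact hs.symm ih
  | trans x y z _ _ ih1 ih2 => exact hs.trans ih1 ih2

theorem eqvGen_comap {V W : Type*} {r : V → V → Prop} {s : W → W → Prop} (g : V → W)
    (h : ∀ v w, r v w → EqvGen s (g v) (g w)) {v w : V} (hr : EqvGen r v w) :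
    EqvGen s (g v) (g w) :=
  eqvGen_le (s := fun v w => EqvGen s (g v) (g w))
    ⟨fun _ => EqvGen.refl _, fun h => EqvGen.symm _ _ h, fun h h' => EqvGen.trans _ _ _ h h'⟩ h hr

/-- `fromRel` symmetrises the relation and drops edges from a vertex to itself, and neither changes
the components. Pictures can thus be treated through the bare edge relation. -/
theorem reachable_fromRel_iff {V : Type*} (r : V → V → Prop) (v w : V) :
    (SimpleGraph.fromRel r).Reachable v w ↔ EqvGen r v w := by
  constructor
  · rintro ⟨p⟩
    induction p with
    | nil => exact EqvGen.refl _
    | cons h _ ih =>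
      refine EqvGen.trans _ _ _ ?_ ih
      rw [SimpleGraph.fromRel_adj] at h
      rcases h.2 with h | h
      · exact EqvGen.rel _ _ h
      · exact EqvGen.symm _ _ (EqvGen.rel _ _ h)
  · intro h
    refine eqvGen_le (SimpleGraph.reachable_is_equivalence _) ?_ h
    intro v w h
    by_cases hvw : v = w
    · rw [hvw]
    · exact SimpleGraph.Adj.reachable ((SimpleGraph.fromRel_adj _ _ _).2 ⟨hvw, Or.inl h⟩)

theorem loops_eq_zero_iff {V : Type} [Finite V] {n : ℕ} (r : V → V → Prop) (b : Pt n → V) :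
    loops (SimpleGraph.fromRel r) b = 0 ↔ LoopFree r b := by
  have : Finite (SimpleGraph.fromRel r).ConnectedComponent :=
    inferInstanceAs (Finite (Quot _))
  rw [loops, Finite.card_eq_zero_iff, LoopFree]
  constructor
  · intro h v
    by_contra hv
    push Not at hv
    refine h.elim ⟨(SimpleGraph.fromRel r).connectedComponentMk v, fun x hx => hv x ?_⟩
    rw [SimpleGraph.ConnectedComponent.eq, reachable_fromRel_iff] at hx
    exact EqvGen.symm _ _ hx
  · intro h
    refine ⟨?_⟩
    rintro ⟨c, hc⟩
    induction c using SimpleGraph.ConnectedComponent.ind with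
    | h v =>
      obtain ⟨x, hx⟩ := h v
      refine hc x ?_
      rw [SimpleGraph.ConnectedComponent.eq, reachable_fromRel_iff]
      exact EqvGen.symm _ _ hx

/-- At loop parameter 0 only loop-free pictures contribute, so realizing a diagram and having no
loop are bundled into one condition. -/
theorem sees_iff {V : Type} [Finite V] {n : ℕ} (r : V → V → Prop) (b : Pt n → V)
    (F : Diagram n) : Sees r b F.partner ↔
      Realizes (SimpleGraph.fromRel r) b F ∧ loops (SimpleGraph.fromRel r) b = 0 := by
  rw [loops_eq_zero_iff]
  simp only [Realizes, reachable_fromRel_iff]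
  constructor
  · intro h
    refine ⟨fun x y hxy => ⟨?_, fun h' => ?_⟩, h.loopFree⟩
    · rintro rfl
      exact h.edge x
    · rcases h.sep x y h' with h' | h'
      · exact absurd h'.symm hxy
      · exact h'.symm
  · rintro ⟨h, hl⟩
    refine ⟨hl, fun x => (h _ _ (F.partner_ne x).symm).1 rfl, fun x y h' => ?_⟩
    by_cases hxy : x = y
    · exact Or.inl hxy.symm
    · exact Or.inr ((h x y hxy).2 h').symm

theorem Realizes.unique {V : Type} {n : ℕ} {G : SimpleGraph V} {b : Pt n → V} {F F' : Diagram n}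
    (h : Realizes G b F) (h' : Realizes G b F') : F = F' := by
  ext x : 2
  exact ((h' x _ (F.partner_ne x).symm).2 ((h x _ (F.partner_ne x).symm).1 rfl)).symm

variable {R : Type*} [CommRing R] {n : ℕ}

theorem evalGraph_of_sees {V : Type} [Finite V] {r : V → V → Prop} {b : Pt n → V}
    {F : Diagram n} (h : Sees r b F.partner) :
    evalGraph (0 : R) (SimpleGraph.fromRel r) b = ofDiagram F := by
  rw [sees_iff] at h
  have hex : ∃ F : Diagram n, Realizes (SimpleGraph.fromRel r) b F := ⟨F, h.1⟩
  rw [evalGraph, dif_pos hex, h.2, pow_zero, one_smul, hex.choose_spec.unique h.1]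

/-- Either no diagram is realized and the default value applies, or one is realized together with a
loop and the power of 0 vanishes. -/
theorem evalGraph_eq_zero {V : Type} [Finite V] {r : V → V → Prop} {b : Pt n → V}
    (h : ∀ F : Diagram n, ¬ Sees r b F.partner) :
    evalGraph (0 : R) (SimpleGraph.fromRel r) b = 0 := by
  rw [evalGraph]
  split_ifs with hex
  · have := h hex.choose
    rw [sees_iff, not_and] at this
    rw [zero_pow (this hex.choose_spec), zero_smul]
  · rfl

theorem evalGraph_eq_zero_of_not_loopFree {V : Type} [Finite V] {r : V → V → Prop} {b : Pt n → V}
    (h : ¬ LoopFree r b) :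
    evalGraph (0 : R) (SimpleGraph.fromRel r) b = 0 :=
  evalGraph_eq_zero fun _ hF => h hF.loopFree

/-- Two pictures with the same connected components look the same. -/
theorem sees_congr {V W β : Type*} {r : V → V → Prop} {s : W → W → Prop} (i : W → V) (p : V → W)
    (hi : ∀ w w', s w w' → EqvGen r (i w) (i w')) (hp : ∀ v v', r v v' → EqvGen s (p v) (p v'))
    (hip : ∀ v, EqvGen r v (i (p v))) (hpi : ∀ w, EqvGen s w (p (i w))) (b : β → W) (f : β → β) :
    Sees r (i ∘ b) f ↔ Sees s b f := by
  have key : ∀ w w', EqvGen r (i w) (i w') ↔ EqvGen s w w' := fun w w' =>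
    ⟨fun h => EqvGen.trans _ _ _ (hpi w)
      (EqvGen.trans _ _ _ (eqvGen_comap p hp h) (EqvGen.symm _ _ (hpi w'))), eqvGen_comap i hi⟩
  constructor
  · rintro ⟨h1, h2, h3⟩
    refine ⟨fun w => ?_, fun x => (key _ _).1 (h2 x), fun x y h => h3 x y ((key _ _).2 h)⟩
    obtain ⟨x, hx⟩ := h1 (i w)
    exact ⟨x, (key _ _).1 hx⟩
  · rintro ⟨h1, h2, h3⟩
    refine ⟨fun v => ?_, fun x => (key _ _).2 (h2 x), fun x y h => h3 x y ((key _ _).1 h)⟩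
    obtain ⟨x, hx⟩ := h1 (p v)
    exact ⟨x, EqvGen.trans _ _ _ (hip v) ((key _ _).2 hx)⟩

/-- The edges of a matching `f` whose points are placed at `q x`. -/
def edgeRel {V β : Type*} (q : β → V) (f : β → β) (v w : V) : Prop :=
  ∃ x, v = q x ∧ w = q (f x)

/-- A part of a picture may be replaced by the matching that one sees of it. -/
theorem Sees.glue {V₁ β₁ V W β : Type*} {r₁ : V₁ → V₁ → Prop} {b₁ : β₁ → V₁} {f₁ : β₁ → β₁}
    (h : Sees r₁ b₁ f₁) {k : V₁ → V} {q : β₁ → W} {i : W → V} {r₂ : V → V → Prop}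
    {s₂ : W → W → Prop} (hk : Function.Injective k) (hi : Function.Injective i)
    (hq : ∀ x, i (q x) = k (b₁ x)) (hcover : ∀ v, (∃ w, i w = v) ∨ ∃ u, k u = v)
    (hs : ∀ w w', s₂ w w' → r₂ (i w) (i w'))
    (hr : ∀ v v', r₂ v v' → ∃ w w', v = i w ∧ v' = i w' ∧ s₂ w w')
    (hov : ∀ u w, k u = i w → ∃ x, u = b₁ x ∧ w = q x) (b : β → W) (f : β → β) :
    Sees (fun v v' => Relation.Map r₁ k k v v' ∨ r₂ v v') (i ∘ b) f ↔
      Sees (fun w w' => edgeRel q f₁ w w' ∨ s₂ w w') b f := by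
  classical
  -- `σ` picks a boundary point in the component of each point of the part. A point shared with the
  -- rest of the picture must pick itself, so that the retraction `p` below is well defined.
  have hsig : ∀ u, ∃ x, EqvGen r₁ u (b₁ x) ∧ ∀ w, k u = i w → w = q x := by
    intro u
    by_cases hu : ∃ w, k u = i w
    · obtain ⟨w, hw⟩ := hu
      obtain ⟨x, rfl, rfl⟩ := hov u w hw
      exact ⟨x, EqvGen.refl _, fun w' hw' => hi (hw'.symm.trans hw)⟩
    · obtain ⟨x, hx⟩ := h.loopFree u
      exact ⟨x, hx, fun w hw => absurd ⟨w, hw⟩ hu⟩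
  choose σ hσ hσ' using hsig
  have hpex : ∀ v, ∃ w, (∀ w', v = i w' → w = w') ∧ (∀ u, v = k u → w = q (σ u)) := by
    intro v
    by_cases hv : ∃ w, i w = v
    · obtain ⟨w, rfl⟩ := hv
      exact ⟨w, fun w' hw' => hi hw', fun u hu => hσ' u w hu.symm⟩
    · obtain ⟨u, rfl⟩ := (hcover v).resolve_left hv
      refine ⟨q (σ u), fun w' hw' => absurd ⟨w', hw'.symm⟩ hv, fun u' hu' => ?_⟩
      rw [hk hu']
  choose p hp hp' using hpex
  have hk1 : ∀ u u', EqvGen r₁ u u' →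
      EqvGen (fun v v' => Relation.Map r₁ k k v v' ∨ r₂ v v') (k u) (k u') := by
    intro u u'
    refine eqvGen_comap k fun u u' h => EqvGen.rel _ _ (Or.inl ⟨u, u', h, rfl, rfl⟩)
  refine sees_congr i p ?_ ?_ ?_ ?_ b f
  · rintro w w' (⟨x, rfl, rfl⟩ | h')
    · rw [hq, hq]
      exact hk1 _ _ (h.edge x)
    · exact EqvGen.rel _ _ (Or.inr (hs _ _ h'))
  · rintro v v' (⟨u, u', h', rfl, rfl⟩ | h')
    · rw [hp' _ u rfl, hp' _ u' rfl]
      have := h.sep (σ u) (σ u') (EqvGen.trans _ _ _ (EqvGen.symm _ _ (hσ u))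
        (EqvGen.trans _ _ _ (EqvGen.rel _ _ h') (hσ u')))
      rcases this with h1 | h1
      · rw [h1]
        exact EqvGen.refl _
      · rw [h1]
        exact EqvGen.rel _ _ (Or.inl ⟨_, rfl, rfl⟩)
    · obtain ⟨w, w', rfl, rfl, h''⟩ := hr _ _ h'
      rw [hp _ w rfl, hp _ w' rfl]
      exact EqvGen.rel _ _ (Or.inr h'')
  · intro v
    rcases hcover v with ⟨w, rfl⟩ | ⟨u, rfl⟩
    · rw [hp _ w rfl]
      exact EqvGen.refl _
    · rw [hp' _ u rfl, hq]
      exact hk1 _ _ (hσ u)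
  · intro w
    rw [hp _ w rfl]
    exact EqvGen.refl _

/-- A closed loop in a part of a picture is a closed loop in the picture. -/
theorem LoopFree.of_glue {V₁ β₁ V W β : Type*} {r₁ : V₁ → V₁ → Prop} {b₁ : β₁ → V₁}
    {k : V₁ → V} {i : W → V} {r₂ : V → V → Prop}
    (hk : Function.Injective k) (hr : ∀ v v', r₂ v v' → ∃ w w', v = i w ∧ v' = i w')
    (hov : ∀ u w, k u = i w → ∃ x, u = b₁ x) (b : β → W)
    (h : LoopFree (fun v v' => Relation.Map r₁ k k v v' ∨ r₂ v v') (i ∘ b)) :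
    LoopFree r₁ b₁ := by
  intro u
  by_contra hu
  -- A component of the part without boundary points is closed under all edges of the picture,
  -- because edges of `r₂` meet the part in boundary points only.
  have key : ∀ v v', EqvGen (fun v v' => Relation.Map r₁ k k v v' ∨ r₂ v v') v v' →
      ((∃ u', v = k u' ∧ EqvGen r₁ u u') ↔ (∃ u', v' = k u' ∧ EqvGen r₁ u u')) := by
    intro v v'
    refine eqvGen_le (s := fun v v' =>
      ((∃ u', v = k u' ∧ EqvGen r₁ u u') ↔ (∃ u', v' = k u' ∧ EqvGen r₁ u u')))
      ⟨fun _ => Iff.rfl, Iff.symm, Iff.trans⟩ ?_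
    rintro v v' (⟨u1, u2, h1, rfl, rfl⟩ | h')
    · constructor
      · rintro ⟨u', h2, h3⟩
        rw [← hk h2] at h3
        exact ⟨u2, rfl, EqvGen.trans _ _ _ h3 (EqvGen.rel _ _ h1)⟩
      · rintro ⟨u', h2, h3⟩
        rw [← hk h2] at h3
        exact ⟨u1, rfl, EqvGen.trans _ _ _ h3 (EqvGen.symm _ _ (EqvGen.rel _ _ h1))⟩
    · obtain ⟨w, w', rfl, rfl⟩ := hr _ _ h'
      constructor
      · rintro ⟨u', h2, h3⟩
        obtain ⟨x, rfl⟩ := hov _ _ h2.symm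
        exact absurd ⟨x, h3⟩ hu
      · rintro ⟨u', h2, h3⟩
        obtain ⟨x, rfl⟩ := hov _ _ h2.symm
        exact absurd ⟨x, h3⟩ hu
  obtain ⟨x, hx⟩ := h (k u)
  obtain ⟨u', h1, h2⟩ := (key _ _ hx).1 ⟨u, rfl, EqvGen.refl _⟩
  obtain ⟨y, rfl⟩ := hov _ _ h1.symm
  exact hu ⟨y, h2⟩

end Pictures

/-! ### Joining neighbouring points of a crossingless matching -/

section Matchings

/-- `f` is a crossingless perfect matching of the points of `S`, whose places on a line are given
by `P`. -/
structure IsMatching {V : Type*} (P : V → ℕ) (S : Set V) (f : V → V) : Prop where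
  mem : ∀ x ∈ S, f x ∈ S
  invol : ∀ x ∈ S, f (f x) = x
  ne : ∀ x ∈ S, f x ≠ x
  cross : ∀ x ∈ S, ∀ y ∈ S, ¬ (P x < P y ∧ P y < P (f x) ∧ P (f x) < P (f y))

/-- The graph `r` connects the points of `S` as the crossingless matching `f` does. -/
structure Shows {V : Type*} (P : V → ℕ) (r : V → V → Prop) (S : Set V) (f : V → V) : Prop
    extends IsMatching P S f where
  edge : ∀ x ∈ S, EqvGen r x (f x)
  sep : ∀ x ∈ S, ∀ y ∈ S, EqvGen r x y → y = x ∨ y = f x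

/-- The graph `r` with one more edge joining `p` and `q`. -/
def addEdge {V : Type*} (r : V → V → Prop) (p q v w : V) : Prop := r v w ∨ (v = p ∧ w = q)

theorem eqvGen_addEdge {V : Type*} {r : V → V → Prop} {p q v w : V}
    (h : EqvGen (addEdge r p q) v w) :
    EqvGen r v w ∨ ((EqvGen r v p ∨ EqvGen r v q) ∧ (EqvGen r w p ∨ EqvGen r w q)) := by
  refine eqvGen_le (s := fun v w => EqvGen r v w ∨
    ((EqvGen r v p ∨ EqvGen r v q) ∧ (EqvGen r w p ∨ EqvGen r w q))) ⟨?_, ?_, ?_⟩ ?_ h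
  · exact fun x => Or.inl (EqvGen.refl x)
  · rintro x y (h | ⟨h1, h2⟩)
    · exact Or.inl (EqvGen.symm _ _ h)
    · exact Or.inr ⟨h2, h1⟩
  · rintro x y z (h | ⟨h1, h2⟩) (h' | ⟨h1', h2'⟩)
    · exact Or.inl (EqvGen.trans _ _ _ h h')
    · exact Or.inr ⟨h1'.imp (EqvGen.trans _ _ _ h) (EqvGen.trans _ _ _ h), h2'⟩
    · have h'' := EqvGen.symm _ _ h'
      exact Or.inr ⟨h1, h2.imp (EqvGen.trans _ _ _ h'') (EqvGen.trans _ _ _ h'')⟩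
    · exact Or.inr ⟨h1, h2'⟩
  · rintro x y (h | ⟨rfl, rfl⟩)
    · exact Or.inl (EqvGen.rel _ _ h)
    · exact Or.inr ⟨Or.inl (EqvGen.refl _), Or.inr (EqvGen.refl _)⟩

/-- Lets absence of loops descend when an edge is removed, as the induction over links requires. -/
theorem exists_mem_of_addEdge {V : Type*} {r : V → V → Prop} {S : Set V} {p q : V} (hp : p ∈ S)
    (hq : q ∈ S) (h : ∀ v, ∃ x ∈ {x | x ∈ S ∧ x ≠ p ∧ x ≠ q}, EqvGen (addEdge r p q) v x) (v : V) :
    ∃ x ∈ S, EqvGen r v x := by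
  obtain ⟨x, hxS, hx⟩ := h v
  rcases eqvGen_addEdge hx with h1 | ⟨h1 | h1, -⟩
  · exact ⟨x, hxS.1, h1⟩
  · exact ⟨p, hp, h1⟩
  · exact ⟨q, hq, h1⟩

open Classical in
/-- Joining two neighbouring points of a crossingless matching by an edge, one sees a crossingless
matching of the other points, if there is no loop. -/
theorem Shows.exists_addEdge {V : Type*} {P : V → ℕ} (hP : Function.Injective P)
    {r : V → V → Prop} {S : Set V} {f : V → V} (h : Shows P r S f) {p q : V} (hp : p ∈ S)
    (hq : q ∈ S) (hpq : P p < P q) (hadj : ∀ x ∈ S, ¬ (P p < P x ∧ P x < P q))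
    (hl : ∀ v, ∃ x ∈ {x | x ∈ S ∧ x ≠ p ∧ x ≠ q}, EqvGen (addEdge r p q) v x) :
    ∃ f', Shows P (addEdge r p q) {x | x ∈ S ∧ x ≠ p ∧ x ≠ q} f' := by
  -- If `p` and `q` were partners, the new edge would close a loop: no other point of `S` would lie
  -- in their component, against `hl`.
  have hne : f p ≠ q := by
    intro hf
    have hfq : f q = p := by rw [← hf, h.invol p hp]
    obtain ⟨x, ⟨hx, hxp, hxq⟩, hxx⟩ := hl p
    rcases eqvGen_addEdge hxx with h1 | ⟨-, h1 | h1⟩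
    · rcases h.sep p hp x hx h1 with h2 | h2
      · exact hxp h2
      · exact hxq (h2.trans hf)
    · rcases h.sep p hp x hx (EqvGen.symm _ _ h1) with h2 | h2
      · exact hxp h2
      · exact hxq (h2.trans hf)
    · rcases h.sep q hq x hx (EqvGen.symm _ _ h1) with h2 | h2
      · exact hxq h2
      · exact hxp (h2.trans hfq)
  have hmono : ∀ v w, EqvGen r v w → EqvGen (addEdge r p q) v w :=
    fun v w h => h.mono fun _ _ h => Or.inl h
  have hne' : f q ≠ p := fun hf => hne (by rw [← hf, h.invol q hq])
  have hinj : ∀ x ∈ S, ∀ y ∈ S, f x = f y → x = y := fun x hx y hy hxy => by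
    rw [← h.invol x hx, hxy, h.invol y hy]
  have hpq' : p ≠ q := fun h => by simp [h] at hpq
  have hab : f p ≠ f q := fun hf => hpq' (hinj p hp q hq hf)
  have hedge : EqvGen (addEdge r p q) (f p) (f q) :=
    EqvGen.trans _ _ _ (EqvGen.symm _ _ (hmono _ _ (h.edge p hp)))
      (EqvGen.trans _ _ _ (EqvGen.rel _ _ (Or.inr ⟨rfl, rfl⟩)) (hmono _ _ (h.edge q hq)))
  -- The strands at `p` and `q` are fused into one, so their far ends become partners.
  let f' : V → V := fun x => if x = f p then f q else if x = f q then f p else f x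
  have fa : f' (f p) = f q := by simp [f']
  have fb : f' (f q) = f p := by simp [f', hab.symm]
  have fo : ∀ x, x ≠ f p → x ≠ f q → f' x = f x := fun x h1 h2 => by simp [f', h1, h2]
  have ha := h.mem p hp
  have hb := h.mem q hq
  have key : ∀ x, x ∈ S → x ≠ p → x ≠ q → (x = f p ∧ f' x = f q) ∨ (x = f q ∧ f' x = f p) ∨
      (x ≠ f p ∧ x ≠ f q ∧ f' x = f x ∧ f x ≠ p ∧ f x ≠ q ∧ f x ≠ f p ∧ f x ≠ f q) := by
    intro x hx hxp hxq
    by_cases h1 : x = f p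
    · exact Or.inl ⟨h1, h1 ▸ fa⟩
    by_cases h2 : x = f q
    · exact Or.inr (Or.inl ⟨h2, h2 ▸ fb⟩)
    refine Or.inr (Or.inr ⟨h1, h2, fo x h1 h2, ?_, ?_, ?_, ?_⟩)
    · intro h3; exact h1 (by rw [← h3, h.invol x hx])
    · intro h3; exact h2 (by rw [← h3, h.invol x hx])
    · intro h3; exact hxp (hinj _ hx _ hp h3)
    · intro h3; exact hxq (hinj _ hx _ hq h3)
  refine ⟨f', ⟨⟨?_, ?_, ?_, ?_⟩, ?_, ?_⟩⟩
  · rintro x ⟨hx, hxp, hxq⟩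
    rcases key x hx hxp hxq with ⟨h1, h2⟩ | ⟨h1, h2⟩ | ⟨h1, h2, h3, h4, h5, h6⟩
    · rw [h2]; exact ⟨hb, hne', h.ne q hq⟩
    · rw [h2]; exact ⟨ha, h.ne p hp, hne⟩
    · rw [h3]; exact ⟨h.mem x hx, h4, h5⟩
  · rintro x ⟨hx, hxp, hxq⟩
    rcases key x hx hxp hxq with ⟨h1, h2⟩ | ⟨h1, h2⟩ | ⟨h1, h2, h3, h4, h5, h6, h7⟩
    · rw [h2, fb, h1]
    · rw [h2, fa, h1]
    · rw [h3, fo _ h6 h7, h.invol x hx]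
  · rintro x ⟨hx, hxp, hxq⟩
    rcases key x hx hxp hxq with ⟨h1, h2⟩ | ⟨h1, h2⟩ | ⟨h1, h2, h3, h4, h5, h6, h7⟩
    · rw [h2, h1]; exact hab.symm
    · rw [h2, h1]; exact hab
    · rw [h3]; exact h.ne x hx
  · rintro x ⟨hx, hxp, hxq⟩ y ⟨hy, hyp, hyq⟩
    -- Only the order of places matters now. Non-crossing with the strands at `p` and `q`, read in
    -- both directions, together with the absence of points of `S` between `p` and `q`, leaves
    -- linear arithmetic.
    have nP : ∀ x y, x ≠ y → P x ≠ P y := fun x y h h' => h (hP h')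
    have iap := h.invol p hp
    have ibq := h.invol q hq
    have npa := nP _ _ (h.ne p hp)
    have nqb := nP _ _ (h.ne q hq)
    have nqa := nP _ _ hne
    have npb := nP _ _ hne'
    have nab := nP _ _ hab
    have hadjx := hadj x hx
    have hadjy := hadj y hy
    have hadja := hadj _ ha
    have hadjb := hadj _ hb
    have c1 := h.cross p hp q hq
    have c2 := h.cross q hq p hp
    have c3 := h.cross p hp _ hb
    have c4 := h.cross _ hb p hp
    have c5 := h.cross q hq _ ha
    have c6 := h.cross _ ha q hq
    have c7 := h.cross _ ha _ hb
    have c8 := h.cross _ hb _ ha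
    rw [ibq] at c3 c4 c7 c8
    rw [iap] at c5 c6 c7 c8
    have nxp := nP _ _ hxp
    have nxq := nP _ _ hxq
    have nyp := nP _ _ hyp
    have nyq := nP _ _ hyq
    rcases key x hx hxp hxq with ⟨h1, h2⟩ | ⟨h1, h2⟩ | ⟨h1, h2, h3, h4, h5, h6, h7⟩ <;>
      rcases key y hy hyp hyq with ⟨k1, k2⟩ | ⟨k1, k2⟩ | ⟨k1, k2, k3, k4, k5, k6, k7⟩
    · rw [h2, k2, h1, k1]; omega
    · rw [h2, k2, h1, k1]; omega
    · rw [h2, k3, h1]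
      have d1 := h.cross p hp y hy
      have d2 := h.cross y hy p hp
      have d3 := h.cross q hq y hy
      have d4 := h.cross y hy q hq
      have d5 := h.cross _ ha y hy
      have d6 := h.cross y hy _ ha
      have d7 := h.cross _ hb y hy
      have d8 := h.cross y hy _ hb
      have e1 := hadj _ (h.mem y hy)
      rw [ibq] at d7 d8
      rw [iap] at d5 d6
      have m1 := nP _ _ k4
      have m2 := nP _ _ k5
      omega
    · rw [h2, k2, h1, k1]; omega
    · rw [h2, k2, h1, k1]; omega
    · rw [h2, k3, h1]
      have d1 := h.cross p hp y hy
      have d2 := h.cross y hy p hp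
      have d3 := h.cross q hq y hy
      have d4 := h.cross y hy q hq
      have d5 := h.cross _ ha y hy
      have d6 := h.cross y hy _ ha
      have d7 := h.cross _ hb y hy
      have d8 := h.cross y hy _ hb
      have e1 := hadj _ (h.mem y hy)
      rw [ibq] at d7 d8
      rw [iap] at d5 d6
      have m1 := nP _ _ k4
      have m2 := nP _ _ k5
      omega
    · rw [h3, k2, k1]
      have d1 := h.cross p hp x hx
      have d2 := h.cross x hx p hp
      have d3 := h.cross q hq x hx
      have d4 := h.cross x hx q hq
      have d5 := h.cross _ ha x hx
      have d6 := h.cross x hx _ ha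
      have d7 := h.cross _ hb x hx
      have d8 := h.cross x hx _ hb
      have e1 := hadj _ (h.mem x hx)
      rw [ibq] at d7 d8
      rw [iap] at d5 d6
      have m1 := nP _ _ h4
      have m2 := nP _ _ h5
      omega
    · rw [h3, k2, k1]
      have d1 := h.cross p hp x hx
      have d2 := h.cross x hx p hp
      have d3 := h.cross q hq x hx
      have d4 := h.cross x hx q hq
      have d5 := h.cross _ ha x hx
      have d6 := h.cross x hx _ ha
      have d7 := h.cross _ hb x hx
      have d8 := h.cross x hx _ hb
      have e1 := hadj _ (h.mem x hx)
      rw [ibq] at d7 d8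
      rw [iap] at d5 d6
      have m1 := nP _ _ h4
      have m2 := nP _ _ h5
      omega
    · rw [h3, k3]; exact h.cross x hx y hy
  · rintro x ⟨hx, hxp, hxq⟩
    rcases key x hx hxp hxq with ⟨h1, h2⟩ | ⟨h1, h2⟩ | ⟨h1, h2, h3, h4, h5, h6, h7⟩
    · rw [h2, h1]; exact hedge
    · rw [h2, h1]; exact EqvGen.symm _ _ hedge
    · rw [h3]; exact hmono _ _ (h.edge x hx)
  · rintro x ⟨hx, hxp, hxq⟩ y ⟨hy, hyp, hyq⟩ hxy
    have hA : ∀ z, z ∈ S → z ≠ p → z ≠ q → (EqvGen r z p ∨ EqvGen r z q) →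
        z = f p ∨ z = f q := by
      rintro z hz hzp hzq (hz' | hz')
      · exact Or.inl ((h.sep p hp z hz (EqvGen.symm _ _ hz')).resolve_left hzp)
      · exact Or.inr ((h.sep q hq z hz (EqvGen.symm _ _ hz')).resolve_left hzq)
    rcases eqvGen_addEdge hxy with h1 | ⟨h1, h2⟩
    · rcases h.sep x hx y hy h1 with h1 | h1
      · exact Or.inl h1
      · rcases key x hx hxp hxq with ⟨h2, h3⟩ | ⟨h2, h3⟩ | ⟨-, -, h2, -⟩
        · exact absurd (by rw [h1, h2, h.invol p hp]) hyp
        · exact absurd (by rw [h1, h2, h.invol q hq]) hyq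
        · exact Or.inr (h1.trans h2.symm)
    · rcases hA x hx hxp hxq h1 with rfl | rfl <;> rcases hA y hy hyp hyq h2 with rfl | rfl
      · exact Or.inl rfl
      · exact Or.inr fa.symm
      · exact Or.inr fb.symm
      · exact Or.inl rfl

end Matchings

/-! ### Planarity of the stack of two diagrams -/

section Stacking

variable {n : ℕ}

/-- A boundary point of a layer with bottom level `a` and top level `b`. -/
def lev {L : Type*} (a b : L) : Pt n → L × Fin n := Sum.elim (fun i => (a, i)) (fun i => (b, i))

/-- The edges of the picture of `D` stacked on top of `E`. -/
def stackRel (D E : Diagram n) (v w : Fin 3 × Fin n) : Prop :=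
  edgeRel (lev 0 1) E.partner v w ∨ edgeRel (lev 1 2) D.partner v w

theorem pos_injective : Function.Injective (pos : Pt n → ℕ) := by
  rintro (⟨i, hi⟩ | ⟨i, hi⟩) (⟨j, hj⟩ | ⟨j, hj⟩) h <;> simp only [pos] at h <;> simp <;> omega

theorem pos_lt (x : Pt n) : pos x < 2 * n := by
  rcases x with ⟨i, hi⟩ | ⟨i, hi⟩ <;> simp only [pos] <;> omega

/-- The place of a point of two diagrams drawn next to each other. -/
def pos₂ : Pt n ⊕ Pt n → ℕ := Sum.elim pos (fun x => 2 * n + pos x)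

theorem pos₂_injective : Function.Injective (pos₂ : Pt n ⊕ Pt n → ℕ) := by
  rintro (x | x) (y | y) h <;> simp only [pos₂, Sum.elim_inl, Sum.elim_inr] at h
  · rw [pos_injective h]
  · have := pos_lt x; omega
  · have := pos_lt y; omega
  · rw [pos_injective (Nat.add_left_cancel h)]

/-- The diagrams `E` and `D` next to each other, with the first `m` top points of `E` linked to
those at the bottom of `D`. -/
def linkRel (D E : Diagram n) (m : ℕ) (v w : Pt n ⊕ Pt n) : Prop :=
  edgeRel Sum.inl E.partner v w ∨ edgeRel Sum.inr D.partner v w ∨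
    ∃ i : Fin n, i.val < m ∧ v = Sum.inl (Sum.inr i) ∧ w = Sum.inr (Sum.inl i)

/-- The points that are not linked in `linkRel`. -/
def unlinked (n m : ℕ) : Set (Pt n ⊕ Pt n) :=
  {v | ∀ i : Fin n, i.val < m → v ≠ Sum.inl (Sum.inr i) ∧ v ≠ Sum.inr (Sum.inl i)}

theorem linkRel_succ (D E : Diagram n) (m : Fin n) :
    linkRel D E (m + 1) =
      addEdge (linkRel D E m) (Sum.inl (Sum.inr m)) (Sum.inr (Sum.inl m)) := by
  ext v w
  simp only [linkRel, addEdge, or_assoc]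
  refine or_congr Iff.rfl (or_congr Iff.rfl ?_)
  constructor
  · rintro ⟨i, hi, h⟩
    rcases Nat.lt_succ_iff_lt_or_eq.1 hi with hi | hi
    · exact Or.inl ⟨i, hi, h⟩
    · exact Or.inr (Fin.ext hi ▸ h)
  · rintro (⟨i, hi, h⟩ | h)
    · exact ⟨i, by omega, h⟩
    · exact ⟨m, by omega, h⟩

theorem unlinked_succ (m : Fin n) : unlinked n (m + 1) =
    {x | x ∈ unlinked n m ∧ x ≠ Sum.inl (Sum.inr m) ∧ x ≠ Sum.inr (Sum.inl m)} := by
  ext v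
  constructor
  · exact fun h => ⟨fun i hi => h i (by omega), h m (by omega)⟩
  · rintro ⟨h1, h2⟩ i hi
    rcases Nat.lt_succ_iff_lt_or_eq.1 hi with hi | hi
    · exact h1 i hi
    · exact Fin.ext hi ▸ h2

theorem mem_unlinked (m : Fin n) :
    Sum.inl (Sum.inr m) ∈ unlinked n m ∧ Sum.inr (Sum.inl m) ∈ unlinked n m := by
  constructor <;> intro i hi <;> simp <;> rintro rfl <;> omega

/-- On the line of `pos₂` the top of `E`, read from right to left, is followed by the bottom of `D`,
read from left to right. After the first `m` links only linked points lie between the next two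
points to be joined, so `Shows.exists_addEdge` applies at each step. -/
theorem exists_shows (D E : Diagram n) (m : ℕ) (hm : m ≤ n)
    (h : ∀ v, ∃ x ∈ unlinked n m, EqvGen (linkRel D E m) v x) :
    ∃ f, Shows pos₂ (linkRel D E m) (unlinked n m) f := by
  induction m with
  | zero =>
    refine ⟨Sum.map E.partner D.partner, ⟨⟨?_, ?_, ?_, ?_⟩, ?_, ?_⟩⟩
    · intro x _ i hi; omega
    · rintro (x | x) _ <;> simp
      exacts [E.partner_partner x, D.partner_partner x]
    · rintro (x | x) _ <;> simp
      exacts [E.partner_ne x, D.partner_ne x]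
    · rintro (x | x) _ (y | y) _ <;> simp only [pos₂, Sum.map_inl, Sum.map_inr, Sum.elim_inl,
        Sum.elim_inr]
      · exact E.crossingless x y
      · have := pos_lt (E.partner x); omega
      · have := pos_lt y; omega
      · have := D.crossingless x y; omega
    · rintro (x | x) _
      · exact EqvGen.rel _ _ (Or.inl ⟨x, rfl, rfl⟩)
      · exact EqvGen.rel _ _ (Or.inr (Or.inl ⟨x, rfl, rfl⟩))
    · intro x _ y _ hxy
      refine eqvGen_le (s := fun x y => y = x ∨ y = Sum.map E.partner D.partner x)
        ⟨?_, ?_, ?_⟩ ?_ hxy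
      · exact fun x => Or.inl rfl
      · rintro (x | x) y (rfl | rfl) <;> simp [E.partner_partner, D.partner_partner]
      · rintro (x | x) y z (rfl | rfl) (rfl | rfl) <;> simp [E.partner_partner, D.partner_partner]
      · rintro v w (⟨x, rfl, rfl⟩ | ⟨x, rfl, rfl⟩ | ⟨i, hi, -⟩)
        · simp
        · simp
        · omega
  | succ m ih =>
    obtain ⟨hp, hq⟩ := mem_unlinked ⟨m, hm⟩
    have e1 := linkRel_succ D E ⟨m, hm⟩
    have e2 := unlinked_succ (⟨m, hm⟩ : Fin n)
    simp only at e1 e2 hp hq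
    rw [e1, e2] at h ⊢
    obtain ⟨f, hf⟩ := ih (by omega) (exists_mem_of_addEdge hp hq h)
    refine hf.exists_addEdge pos₂_injective hp hq ?_ ?_ h
    · simp [pos₂, pos]; omega
    · rintro ((⟨i, hi⟩ | ⟨i, hi⟩) | (⟨i, hi⟩ | ⟨i, hi⟩)) hx
      · simp [pos₂, pos]; omega
      · have : ¬ i < m := fun h => (hx ⟨i, hi⟩ h).1 rfl
        simp [pos₂, pos]; omega
      · have : ¬ i < m := fun h => (hx ⟨i, hi⟩ h).2 rfl
        simp [pos₂, pos]; omega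
      · simp [pos₂, pos]; omega

/-- The boundary points of the stacked diagrams. -/
def outer : Pt n → Pt n ⊕ Pt n := Sum.elim (fun i => Sum.inl (Sum.inl i)) (fun i => Sum.inr (Sum.inr i))

theorem mem_unlinked_iff (v : Pt n ⊕ Pt n) : v ∈ unlinked n n ↔ ∃ x, v = outer x := by
  constructor
  · intro h
    rcases v with (i | i) | (i | i)
    · exact ⟨Sum.inl i, rfl⟩
    · exact absurd rfl (h i i.2).1
    · exact absurd rfl (h i i.2).2
    · exact ⟨Sum.inr i, rfl⟩
  · rintro ⟨x | x, rfl⟩ i _ <;> simp [outer]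

theorem outer_injective : Function.Injective (outer : Pt n → Pt n ⊕ Pt n) := by
  rintro (x | x) (y | y) h <;> simp [outer] at h <;> rw [h]

theorem pos₂_outer (x : Pt n) : (pos x < n ∧ pos₂ (outer x) = pos x) ∨
    (n ≤ pos x ∧ pos₂ (outer x) = pos x + 2 * n) := by
  rcases x with ⟨i, hi⟩ | ⟨i, hi⟩ <;> simp [outer, pos₂, pos] <;> omega

/-- The outer points have the same order in `pos₂` as in `pos`; the top ones are merely shifted by
`2 * n`. Hence non-crossing is inherited. -/
theorem exists_sees_outer (D E : Diagram n) (h : LoopFree (linkRel D E n) outer) :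
    ∃ F : Diagram n, Sees (linkRel D E n) outer F.partner := by
  obtain ⟨f, hf⟩ := exists_shows D E n le_rfl fun v => by
    obtain ⟨x, hx⟩ := h v
    exact ⟨_, (mem_unlinked_iff _).2 ⟨x, rfl⟩, hx⟩
  have hmem : ∀ x : Pt n, outer x ∈ unlinked n n := fun x => (mem_unlinked_iff _).2 ⟨x, rfl⟩
  have hg : ∀ x : Pt n, ∃ y, f (outer x) = outer y := fun x =>
    (mem_unlinked_iff _).1 (hf.mem _ (hmem x))
  choose g hg using hg
  refine ⟨⟨g, ?_, ?_, ?_⟩, ⟨h, ?_, ?_⟩⟩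
  · intro x
    apply outer_injective
    rw [← hg, ← hg, hf.invol _ (hmem x)]
  · intro x hx
    exact hf.ne _ (hmem x) (by rw [hg, hx])
  · intro x y
    have := hf.cross _ (hmem x) _ (hmem y)
    rw [hg, hg] at this
    have h1 := pos₂_outer x
    have h2 := pos₂_outer y
    have h3 := pos₂_outer (g x)
    have h4 := pos₂_outer (g y)
    omega
  · intro x
    change EqvGen _ _ (outer (g x))
    rw [← hg]
    exact hf.edge _ (hmem x)
  · intro x y hxy
    refine (hf.sep _ (hmem x) _ (hmem y) hxy).imp (fun h => outer_injective h) fun h => ?_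
    rw [hg] at h
    exact outer_injective h

theorem eqvGen_linkRel (D E : Diagram n) (i : Fin n) :
    EqvGen (linkRel D E n) (Sum.inl (Sum.inr i)) (Sum.inr (Sum.inl i)) :=
  EqvGen.rel _ _ (Or.inr (Or.inr ⟨i, i.2, rfl, rfl⟩))

/-- The level of a point of two diagrams stacked on top of each other. -/
def toLevel : Pt n ⊕ Pt n → Fin 3 × Fin n := Sum.elim (lev 0 1) (lev 1 2)

/-- One of the points of two diagrams at a given level. -/
def ofLevel (v : Fin 3 × Fin n) : Pt n ⊕ Pt n :=
  if v.1 = 0 then Sum.inl (Sum.inl v.2) else if v.1 = 1 then Sum.inl (Sum.inr v.2) else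
    Sum.inr (Sum.inr v.2)

theorem ofLevel_toLevel (D E : Diagram n) (v : Pt n ⊕ Pt n) :
    EqvGen (linkRel D E n) v (ofLevel (toLevel v)) := by
  rcases v with (i | i) | (i | i)
  · exact EqvGen.refl _
  · exact EqvGen.refl _
  · exact EqvGen.symm _ _ (eqvGen_linkRel D E i)
  · exact EqvGen.refl _

theorem toLevel_ofLevel (v : Fin 3 × Fin n) : toLevel (ofLevel v) = v := by
  rcases v with ⟨l, i⟩
  fin_cases l <;> rfl

/-- Contracting every link to one point of the middle level does not change the components. -/
theorem sees_linkRel_iff (D E : Diagram n) (f : Pt n → Pt n) :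
    Sees (linkRel D E n) outer f ↔ Sees (stackRel D E) (lev 0 2) f := by
  have h : (outer : Pt n → _) = ofLevel ∘ (lev 0 2) := by
    ext (x | x) <;> rfl
  rw [h]
  refine sees_congr ofLevel toLevel ?_ ?_ (ofLevel_toLevel D E) ?_ _ _
  · rintro w w' (⟨x, rfl, rfl⟩ | ⟨x, rfl, rfl⟩)
    · exact EqvGen.trans _ _ _ (EqvGen.symm _ _ (ofLevel_toLevel D E (Sum.inl x)))
        (EqvGen.trans _ _ _ (EqvGen.rel _ _ (Or.inl ⟨x, rfl, rfl⟩))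
          (ofLevel_toLevel D E (Sum.inl (E.partner x))))
    · exact EqvGen.trans _ _ _ (EqvGen.symm _ _ (ofLevel_toLevel D E (Sum.inr x)))
        (EqvGen.trans _ _ _ (EqvGen.rel _ _ (Or.inr (Or.inl ⟨x, rfl, rfl⟩)))
          (ofLevel_toLevel D E (Sum.inr (D.partner x))))
  · rintro v v' (⟨x, rfl, rfl⟩ | ⟨x, rfl, rfl⟩ | ⟨i, -, rfl, rfl⟩)
    · exact EqvGen.rel _ _ (Or.inl ⟨x, rfl, rfl⟩)
    · exact EqvGen.rel _ _ (Or.inr ⟨x, rfl, rfl⟩)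
    · exact EqvGen.refl _
  · intro w
    rw [toLevel_ofLevel]
    exact EqvGen.refl _

/-- Rules out that `evalGraph` returns its default value 0 for a loop-free stack. -/
theorem exists_sees_stack (D E : Diagram n) (h : LoopFree (stackRel D E) (lev 0 2)) :
    ∃ F : Diagram n, Sees (stackRel D E) (lev 0 2) F.partner := by
  obtain ⟨F, hF⟩ := exists_sees_outer D E fun v => by
    obtain ⟨x, hx⟩ := h (toLevel v)
    refine ⟨x, EqvGen.trans _ _ _ (ofLevel_toLevel D E v) ?_⟩
    have h2 : outer x = ofLevel (lev 0 2 x) := by rcases x with x | x <;> rfl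
    rw [h2]
    refine eqvGen_comap ofLevel ?_ hx
    rintro w w' (⟨x, rfl, rfl⟩ | ⟨x, rfl, rfl⟩)
    · exact EqvGen.trans _ _ _ (EqvGen.symm _ _ (ofLevel_toLevel D E (Sum.inl x)))
        (EqvGen.trans _ _ _ (EqvGen.rel _ _ (Or.inl ⟨x, rfl, rfl⟩))
          (ofLevel_toLevel D E (Sum.inl (E.partner x))))
    · exact EqvGen.trans _ _ _ (EqvGen.symm _ _ (ofLevel_toLevel D E (Sum.inr x)))
        (EqvGen.trans _ _ _ (EqvGen.rel _ _ (Or.inr (Or.inl ⟨x, rfl, rfl⟩)))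
          (ofLevel_toLevel D E (Sum.inr (D.partner x))))
  exact ⟨F, (sees_linkRel_iff D E _).1 hF⟩

end Stacking

/-! ### Bilinearity, turning upside down, associativity -/

section Product

variable {R : Type*} [CommRing R] {n : ℕ}

/-- The product of `TL_n(δ)` as a bilinear map. -/
def mulHom (R : Type*) [CommRing R] (δ : R) (n : ℕ) : TL R δ n →ₗ[R] TL R δ n →ₗ[R] TL R δ n :=
  Finsupp.linearCombination R fun D : Diagram n =>
    (Finsupp.linearCombination R fun E : Diagram n => stack δ D E : (Diagram n →₀ R) →ₗ[R] _)

theorem mulHom_ofDiagram {δ : R} (D : Diagram n) (Y : TL R δ n) : mulHom R δ n (ofDiagram D) Y =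
    Finsupp.linearCombination R (fun E : Diagram n => stack δ D E) Y := by
  have h : mulHom R δ n (ofDiagram D) = (1 : R) •
    (Finsupp.linearCombination R fun E : Diagram n => stack δ D E : (Diagram n →₀ R) →ₗ[R] _) :=
    Finsupp.linearCombination_single R (1 : R) D
  rw [h, one_smul]
  rfl

theorem mul_eq_mulHom {δ : R} (X Y : TL R δ n) : X * Y = mulHom R δ n X Y := by
  have : Finsupp.linearCombination R (fun D : Diagram n =>
      Finsupp.linearCombination R (fun E : Diagram n => stack δ D E) Y) =
      (mulHom R δ n).flip Y := by
    refine Finsupp.lhom_ext' fun D => LinearMap.ext_ring ?_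
    refine (Finsupp.linearCombination_single R (1 : R) D).trans ?_
    rw [one_smul]
    exact (mulHom_ofDiagram D Y).symm
  exact LinearMap.congr_fun this X

theorem ofDiagram_mul_ofDiagram {δ : R} (D E : Diagram n) :
    (ofDiagram D * ofDiagram E : TL R δ n) = stack δ D E := by
  rw [mul_eq_mulHom, mulHom_ofDiagram]
  exact (Finsupp.linearCombination_single R (1 : R) E).trans (one_smul _ _)

theorem TL.induction {δ : R} {p : TL R δ n → Prop} (X : TL R δ n) (h0 : p 0)
    (hadd : ∀ X Y, p X → p Y → p (X + Y)) (h : ∀ (c : R) D, p (c • ofDiagram D)) : p X := by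
  refine Finsupp.induction_linear (motive := p) X h0 hadd fun D c => ?_
  have := h c D
  rw [ofDiagram] at this
  erw [Finsupp.smul_single] at this
  simpa using this

theorem TL.linearMap_ext {δ : R} {M : Type*} [AddCommGroup M] [Module R M]
    {f g : TL R δ n →ₗ[R] M} (h : ∀ D, f (ofDiagram D) = g (ofDiagram D)) : f = g :=
  Finsupp.lhom_ext' fun D => LinearMap.ext_ring (h D)

/-- A criterion for reading off a picture: `σ` labels each vertex by a boundary point of its
component, and along edges the label changes at most to its partner, so different strands stay
separate. -/
theorem Sees.of_retract {V β : Type*} {r : V → V → Prop} {b : β → V} {f : β → β} (σ : V → β)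
    (hf : ∀ x, f (f x) = x) (h1 : ∀ v, EqvGen r v (b (σ v)))
    (h2 : ∀ v w, r v w → σ w = σ v ∨ σ w = f (σ v)) (h3 : ∀ x, σ (b x) = x)
    (h4 : ∀ x, EqvGen r (b x) (b (f x))) : Sees r b f := by
  refine ⟨fun v => ⟨σ v, h1 v⟩, h4, fun x y h => ?_⟩
  have := eqvGen_le (s := fun v w => σ w = σ v ∨ σ w = f (σ v)) ⟨?_, ?_, ?_⟩ h2 h
  · simpa only [h3] using this
  · exact fun _ => Or.inl rfl
  · rintro x y (h | h)
    · exact Or.inl h.symm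
    · exact Or.inr (by rw [h, hf])
  · rintro x y z (h | h) (h' | h')
    · exact Or.inl (h'.trans h)
    · exact Or.inr (by rw [h', h])
    · exact Or.inr (h'.trans h)
    · exact Or.inl (by rw [h', h, hf])

theorem stack_eq_of_sees {D E F : Diagram n} (h : Sees (stackRel D E) (lev 0 2) F.partner) :
    stack (0 : R) D E = ofDiagram F := evalGraph_of_sees h

theorem stack_eq_zero {D E : Diagram n} (h : ¬ LoopFree (stackRel D E) (lev 0 2)) :
    stack (0 : R) D E = 0 := evalGraph_eq_zero_of_not_loopFree h

theorem stack_cases (D E : Diagram n) :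
    (∃ F : Diagram n, Sees (stackRel D E) (lev 0 2) F.partner ∧
      stack (0 : R) D E = ofDiagram F) ∨
    (¬ LoopFree (stackRel D E) (lev 0 2) ∧ stack (0 : R) D E = 0) := by
  by_cases h : LoopFree (stackRel D E) (lev 0 2)
  · obtain ⟨F, hF⟩ := exists_sees_stack D E h
    exact Or.inl ⟨F, hF, stack_eq_of_sees hF⟩
  · exact Or.inr ⟨h, stack_eq_zero h⟩

theorem sees_identity_stack (D : Diagram n) :
    Sees (stackRel (Diagram.identity n) D) (lev 0 2) D.partner := by
  have h2 : ∀ i : Fin n,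
      EqvGen (stackRel (Diagram.identity n) D) (1, i) (2, i) := fun i =>
    EqvGen.rel _ _ (Or.inr ⟨Sum.inl i, rfl, rfl⟩)
  have h1 : ∀ x : Pt n, EqvGen (stackRel (Diagram.identity n) D) (lev 0 1 x) (lev 0 2 x) := by
    rintro (i | i)
    · exact EqvGen.refl _
    · exact h2 i
  refine Sees.of_retract (fun v => if v.1 = 0 then Sum.inl v.2 else Sum.inr v.2)
    D.partner_partner ?_ ?_ ?_ ?_
  · rintro ⟨l, i⟩
    fin_cases l
    · exact EqvGen.refl _
    · exact h2 i
    · exact EqvGen.refl _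
  · rintro v w (⟨x, rfl, rfl⟩ | ⟨x, rfl, rfl⟩)
    · have : ∀ x : Pt n, (if (lev (0 : Fin 3) 1 x).1 = 0 then Sum.inl (lev (0 : Fin 3) 1 x).2
        else Sum.inr (lev (0 : Fin 3) 1 x).2) = x := by rintro (i | i) <;> rfl
      simp only [this]
      exact Or.inr trivial
    · rcases x with i | i <;> exact Or.inl rfl
  · rintro (i | i) <;> rfl
  · intro x
    exact EqvGen.trans _ _ _ (EqvGen.symm _ _ (h1 x)) (EqvGen.trans _ _ _
      (EqvGen.rel _ _ (Or.inl ⟨x, rfl, rfl⟩)) (h1 _))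

/-- A diagram upside down. -/
def Diagram.flip (D : Diagram n) : Diagram n where
  partner x := (D.partner x.swap).swap
  partner_partner x := by simp [D.partner_partner]
  partner_ne x h := D.partner_ne x.swap (by rw [← Sum.swap_swap (D.partner x.swap), h])
  crossingless x y h := by
    have key : ∀ x : Pt n, pos x.swap + pos x + 1 = 2 * n := by
      rintro (⟨i, hi⟩ | ⟨i, hi⟩) <;> simp only [pos, Sum.swap_inl, Sum.swap_inr] <;> omega
    have h1 := key x
    have h2 := key y
    have h3 := key (D.partner x.swap)
    have h4 := key (D.partner y.swap)
    have h5 := D.crossingless (D.partner y.swap) (D.partner x.swap)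
    rw [D.partner_partner, D.partner_partner] at h5
    omega

@[simp] theorem Diagram.flip_flip (D : Diagram n) : D.flip.flip = D := by
  ext x : 2
  simp [Diagram.flip]

@[simp] theorem Diagram.flip_identity : (Diagram.identity n).flip = Diagram.identity n := by
  ext x : 2
  simp [Diagram.flip, Diagram.identity]

theorem Diagram.flip_cupCap (i : ℕ) (h : i + 1 < n) :
    (Diagram.cupCap i h).flip = Diagram.cupCap i h := by
  ext x : 2
  rcases x with j | j <;> simp only [Diagram.flip, Diagram.cupCap, Sum.swap_inl, Sum.swap_inr] <;>
    split_ifs <;> rfl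

/-- Reversing the three levels exchanges the two stacked diagrams and turns each of them over. -/
theorem sees_flip_iff (D E F : Diagram n) :
    Sees (stackRel E.flip D.flip) (lev 0 2) F.flip.partner ↔
      Sees (stackRel D E) (lev 0 2) F.partner := by
  have key : ∀ D E : Diagram n, ∀ v w, stackRel D E v w →
      EqvGen (stackRel E.flip D.flip) (Prod.map Fin.rev id v) (Prod.map Fin.rev id w) := by
    have e1 : ∀ x : Pt n, Prod.map Fin.rev id (lev (0 : Fin 3) 1 x) = lev 1 2 x.swap := by
      rintro (x | x) <;> rfl
    have e2 : ∀ x : Pt n, Prod.map Fin.rev id (lev (1 : Fin 3) 2 x) = lev 0 1 x.swap := by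
      rintro (x | x) <;> rfl
    rintro D E v w (⟨x, rfl, rfl⟩ | ⟨x, rfl, rfl⟩)
    · exact EqvGen.rel _ _ (Or.inr ⟨x.swap, e1 x, by rw [e1]; simp [Diagram.flip]⟩)
    · exact EqvGen.rel _ _ (Or.inl ⟨x.swap, e2 x, by rw [e2]; simp [Diagram.flip]⟩)
  have hb : ∀ x : Pt n, Prod.map Fin.rev id (lev (0 : Fin 3) 2 x) = lev 0 2 x.swap := by
    rintro (x | x) <;> rfl
  have hrev : ∀ v : Fin 3 × Fin n, Prod.map Fin.rev id (Prod.map Fin.rev id v) = v := fun v => by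
    simp [Prod.map]
  have h1 : ∀ D E F : Diagram n, Sees (stackRel D E) (lev 0 2) F.partner →
      Sees (stackRel E.flip D.flip) (lev 0 2) F.flip.partner := by
    intro D E F h
    have := (sees_congr (Prod.map Fin.rev id) (Prod.map Fin.rev id) (r := stackRel E.flip D.flip)
      (s := stackRel D E) (key D E) (by simpa using key E.flip D.flip) ?_ ?_ (lev 0 2) F.partner).2 h
    · refine ⟨fun v => ?_, fun x => ?_, fun x y hxy => ?_⟩
      · obtain ⟨x, hx⟩ := this.loopFree v
        exact ⟨x.swap, by rw [← hb]; exact hx⟩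
      · have := this.edge x.swap
        simpa [hb, Diagram.flip] using this
      · have := this.sep x.swap y.swap (by simpa [hb] using hxy)
        refine this.imp (fun h => Sum.swap_leftInverse.injective h) fun h => ?_
        change y = (F.partner x.swap).swap
        rw [← h, Sum.swap_swap]
    · intro v; rw [hrev]; exact EqvGen.refl v
    · intro v; rw [hrev]; exact EqvGen.refl v
  exact ⟨fun h => by simpa using h1 _ _ _ h, h1 D E F⟩

/-- Turning diagrams upside down, as a linear map. -/
def flipHom (R : Type*) [CommRing R] (n : ℕ) : TL R (0 : R) n →ₗ[R] TL R (0 : R) n :=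
  Finsupp.lmapDomain R R Diagram.flip

theorem flipHom_ofDiagram (D : Diagram n) :
    flipHom R n (ofDiagram D) = ofDiagram D.flip := by
  rw [flipHom, ofDiagram, ofDiagram]
  exact Finsupp.mapDomain_single

theorem flipHom_flipHom (X : TL R (0 : R) n) : flipHom R n (flipHom R n X) = X := by
  have : (flipHom R n ∘ₗ flipHom R n) = LinearMap.id := TL.linearMap_ext fun D => by
    simp [flipHom_ofDiagram]
  exact LinearMap.congr_fun this X

theorem stack_flip (D E : Diagram n) :
    stack (0 : R) E.flip D.flip = flipHom R n (stack (0 : R) D E) := by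
  rcases stack_cases (R := R) D E with ⟨F, hF, hDE⟩ | ⟨hl, hDE⟩
  · rw [hDE, flipHom_ofDiagram]
    exact stack_eq_of_sees ((sees_flip_iff D E F).2 hF)
  · rw [hDE, map_zero]
    rcases stack_cases (R := R) E.flip D.flip with ⟨F, hF, -⟩ | ⟨-, h⟩
    · refine absurd ((sees_flip_iff D E F.flip).1 ?_).loopFree hl
      rwa [Diagram.flip_flip]
    · exact h

/-- As an antiautomorphism that fixes the generators (`flipHom_U`), the flip turns statements on
cups and left factors into statements on caps and right factors. -/
theorem flipHom_mul (X Y : TL R (0 : R) n) :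
    flipHom R n (X * Y) = flipHom R n Y * flipHom R n X := by
  rw [mul_eq_mulHom, mul_eq_mulHom]
  have : (mulHom R (0 : R) n).compr₂ (flipHom R n) =
      ((mulHom R (0 : R) n).compl₁₂ (flipHom R n) (flipHom R n)).flip := by
    refine TL.linearMap_ext fun D => TL.linearMap_ext fun E => ?_
    simp only [LinearMap.compr₂_apply, LinearMap.flip_apply, LinearMap.compl₁₂_apply,
      flipHom_ofDiagram, ← mul_eq_mulHom, ofDiagram_mul_ofDiagram, stack_flip]
  exact LinearMap.congr_fun (LinearMap.congr_fun this X) Y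

/-- The picture of `D` stacked on top of `E` stacked on top of `F`. -/
def stackRel₃ (D E F : Diagram n) (v w : Fin 4 × Fin n) : Prop :=
  edgeRel (lev 0 1) F.partner v w ∨ edgeRel (lev 1 2) E.partner v w ∨
    edgeRel (lev 2 3) D.partner v w

theorem stackRel₃_eq_left (D E F : Diagram n) : stackRel₃ D E F = fun v w =>
    Relation.Map (stackRel D E) (Prod.map Fin.succ id) (Prod.map Fin.succ id) v w ∨
      edgeRel (lev 0 1) F.partner v w := by
  have e1 : ∀ x : Pt n, Prod.map Fin.succ id (lev (0 : Fin 3) 1 x) = lev 1 2 x := by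
    rintro (x | x) <;> rfl
  have e2 : ∀ x : Pt n, Prod.map Fin.succ id (lev (1 : Fin 3) 2 x) = lev 2 3 x := by
    rintro (x | x) <;> rfl
  ext v w
  constructor
  · rintro (h | ⟨x, rfl, rfl⟩ | ⟨x, rfl, rfl⟩)
    · exact Or.inr h
    · exact Or.inl ⟨_, _, Or.inl ⟨x, rfl, rfl⟩, e1 _, e1 _⟩
    · exact Or.inl ⟨_, _, Or.inr ⟨x, rfl, rfl⟩, e2 _, e2 _⟩
  · rintro (⟨_, _, ⟨x, rfl, rfl⟩ | ⟨x, rfl, rfl⟩, rfl, rfl⟩ | h)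
    · exact Or.inr (Or.inl ⟨x, e1 _, e1 _⟩)
    · exact Or.inr (Or.inr ⟨x, e2 _, e2 _⟩)
    · exact Or.inl h

theorem stackRel₃_eq_right (D E F : Diagram n) : stackRel₃ D E F = fun v w =>
    Relation.Map (stackRel E F) (Prod.map Fin.castSucc id) (Prod.map Fin.castSucc id) v w ∨
      edgeRel (lev 2 3) D.partner v w := by
  have e1 : ∀ x : Pt n, Prod.map Fin.castSucc id (lev (0 : Fin 3) 1 x) = lev 0 1 x := by
    rintro (x | x) <;> rfl
  have e2 : ∀ x : Pt n, Prod.map Fin.castSucc id (lev (1 : Fin 3) 2 x) = lev 1 2 x := by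
    rintro (x | x) <;> rfl
  ext v w
  constructor
  · rintro (⟨x, rfl, rfl⟩ | ⟨x, rfl, rfl⟩ | h)
    · exact Or.inl ⟨_, _, Or.inl ⟨x, rfl, rfl⟩, e1 _, e1 _⟩
    · exact Or.inl ⟨_, _, Or.inr ⟨x, rfl, rfl⟩, e2 _, e2 _⟩
    · exact Or.inr h
  · rintro (⟨_, _, ⟨x, rfl, rfl⟩ | ⟨x, rfl, rfl⟩, rfl, rfl⟩ | h)
    · exact Or.inl ⟨x, e1 _, e1 _⟩
    · exact Or.inr (Or.inl ⟨x, e2 _, e2 _⟩)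
    · exact Or.inr (Or.inr h)

theorem glue_left_overlap (u w : Fin 3 × Fin n)
    (h : Prod.map Fin.succ id u = Prod.map ![(0 : Fin 4), 1, 3] id w) :
    ∃ x, u = lev 0 2 x ∧ w = lev 1 2 x := by
  rcases u with ⟨a, i⟩
  rcases w with ⟨b, j⟩
  simp only [Prod.map, Prod.mk.injEq, id] at h
  obtain ⟨h, rfl⟩ := h
  fin_cases a <;> fin_cases b <;> simp at h
  · exact ⟨Sum.inl i, rfl, rfl⟩
  · exact ⟨Sum.inr i, rfl, rfl⟩

theorem glue_right_overlap (u w : Fin 3 × Fin n)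
    (h : Prod.map Fin.castSucc id u = Prod.map ![(0 : Fin 4), 2, 3] id w) :
    ∃ x, u = lev 0 2 x ∧ w = lev 0 1 x := by
  rcases u with ⟨a, i⟩
  rcases w with ⟨b, j⟩
  simp only [Prod.map, Prod.mk.injEq, id] at h
  obtain ⟨h, rfl⟩ := h
  fin_cases a <;> fin_cases b <;> simp at h
  · exact ⟨Sum.inl i, rfl, rfl⟩
  · exact ⟨Sum.inr i, rfl, rfl⟩

/-- The upper two diagrams occupy levels 1 to 3. Gluing absorbs level 2, which is why `![0, 1, 3]`
lists the levels that remain. -/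
theorem sees_stackRel₃_left {D E G : Diagram n} (h : Sees (stackRel D E) (lev 0 2) G.partner)
    (F : Diagram n) (f : Pt n → Pt n) :
    Sees (stackRel₃ D E F) (lev 0 3) f ↔ Sees (stackRel G F) (lev 0 2) f := by
  have hb : (lev 0 3 : Pt n → Fin 4 × Fin n) = Prod.map ![0, 1, 3] id ∘ lev (0 : Fin 3) 2 := by
    ext (x | x) <;> rfl
  have hs : stackRel G F = fun w w' =>
      edgeRel (lev 1 2) G.partner w w' ∨ edgeRel (lev 0 1) F.partner w w' := by
    ext w w'; exact or_comm
  have e1 : ∀ x : Pt n, Prod.map ![(0 : Fin 4), 1, 3] id (lev (0 : Fin 3) 1 x) = lev 0 1 x := by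
    rintro (x | x) <;> rfl
  rw [stackRel₃_eq_left, hb, hs]
  refine h.glue ((Fin.succ_injective _).prodMap Function.injective_id)
    (Function.Injective.prodMap (by decide) Function.injective_id) ?_ ?_ ?_ ?_
    glue_left_overlap _ _
  · rintro (x | x) <;> rfl
  · rintro ⟨a, j⟩
    fin_cases a
    · exact Or.inl ⟨(0, j), rfl⟩
    · exact Or.inl ⟨(1, j), rfl⟩
    · exact Or.inr ⟨(1, j), rfl⟩
    · exact Or.inl ⟨(2, j), rfl⟩
  · rintro w w' ⟨x, rfl, rfl⟩
    exact ⟨x, e1 _, e1 _⟩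
  · rintro w w' ⟨x, rfl, rfl⟩
    exact ⟨_, _, (e1 _).symm, (e1 _).symm, x, rfl, rfl⟩

theorem sees_stackRel₃_right {E F G : Diagram n} (h : Sees (stackRel E F) (lev 0 2) G.partner)
    (D : Diagram n) (f : Pt n → Pt n) :
    Sees (stackRel₃ D E F) (lev 0 3) f ↔ Sees (stackRel D G) (lev 0 2) f := by
  have hb : (lev 0 3 : Pt n → Fin 4 × Fin n) = Prod.map ![0, 2, 3] id ∘ lev (0 : Fin 3) 2 := by
    ext (x | x) <;> rfl
  have e1 : ∀ x : Pt n, Prod.map ![(0 : Fin 4), 2, 3] id (lev (1 : Fin 3) 2 x) = lev 2 3 x := by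
    rintro (x | x) <;> rfl
  rw [stackRel₃_eq_right, hb]
  refine h.glue ((Fin.castSucc_injective _).prodMap Function.injective_id)
    (Function.Injective.prodMap (by decide) Function.injective_id) ?_ ?_ ?_ ?_
    glue_right_overlap _ _
  · rintro (x | x) <;> rfl
  · rintro ⟨a, j⟩
    fin_cases a
    · exact Or.inl ⟨(0, j), rfl⟩
    · exact Or.inr ⟨(1, j), rfl⟩
    · exact Or.inl ⟨(1, j), rfl⟩
    · exact Or.inl ⟨(2, j), rfl⟩
  · rintro w w' ⟨x, rfl, rfl⟩
    exact ⟨x, e1 _, e1 _⟩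
  · rintro w w' ⟨x, rfl, rfl⟩
    exact ⟨_, _, (e1 _).symm, (e1 _).symm, x, rfl, rfl⟩

theorem LoopFree.left_of_stackRel₃ {D E F : Diagram n}
    (h : LoopFree (stackRel₃ D E F) (lev 0 3)) : LoopFree (stackRel D E) (lev 0 2) := by
  have hb : (lev 0 3 : Pt n → Fin 4 × Fin n) = Prod.map ![0, 1, 3] id ∘ lev (0 : Fin 3) 2 := by
    ext (x | x) <;> rfl
  have e1 : ∀ x : Pt n, Prod.map ![(0 : Fin 4), 1, 3] id (lev (0 : Fin 3) 1 x) = lev 0 1 x := by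
    rintro (x | x) <;> rfl
  rw [stackRel₃_eq_left, hb] at h
  refine LoopFree.of_glue ((Fin.succ_injective _).prodMap Function.injective_id) ?_ ?_ _ h
  · rintro w w' ⟨x, rfl, rfl⟩
    exact ⟨_, _, (e1 _).symm, (e1 _).symm⟩
  · intro u w huw
    obtain ⟨x, hx, -⟩ := glue_left_overlap u w huw
    exact ⟨x, hx⟩

theorem LoopFree.right_of_stackRel₃ {D E F : Diagram n}
    (h : LoopFree (stackRel₃ D E F) (lev 0 3)) : LoopFree (stackRel E F) (lev 0 2) := by
  have hb : (lev 0 3 : Pt n → Fin 4 × Fin n) = Prod.map ![0, 2, 3] id ∘ lev (0 : Fin 3) 2 := by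
    ext (x | x) <;> rfl
  have e1 : ∀ x : Pt n, Prod.map ![(0 : Fin 4), 2, 3] id (lev (1 : Fin 3) 2 x) = lev 2 3 x := by
    rintro (x | x) <;> rfl
  rw [stackRel₃_eq_right, hb] at h
  refine LoopFree.of_glue ((Fin.castSucc_injective _).prodMap Function.injective_id) ?_ ?_ _ h
  · rintro w w' ⟨x, rfl, rfl⟩
    exact ⟨_, _, (e1 _).symm, (e1 _).symm⟩
  · intro u w huw
    obtain ⟨x, hx, -⟩ := glue_right_overlap u w huw
    exact ⟨x, hx⟩

/-- Both bracketings evaluate the same picture on four levels. A loop in a partial product is a loop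
of the whole picture, so then the other bracketing vanishes as well. -/
theorem ofDiagram_mul_assoc (D E F : Diagram n) :
    (ofDiagram D * ofDiagram E * ofDiagram F : TL R (0 : R) n) =
      ofDiagram D * (ofDiagram E * ofDiagram F) := by
  have hz : ∀ X : TL R (0 : R) n, 0 * X = 0 ∧ X * 0 = 0 := fun X => by
    simp [mul_eq_mulHom]
  have hzero : ∀ G H : Diagram n, (∀ K : Diagram n, ¬ Sees (stackRel G H) (lev 0 2) K.partner) →
      stack (0 : R) G H = 0 := fun G H h => by
    rcases stack_cases (R := R) G H with ⟨K, hK, -⟩ | ⟨-, h'⟩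
    · exact absurd hK (h K)
    · exact h'
  rw [ofDiagram_mul_ofDiagram, ofDiagram_mul_ofDiagram]
  rcases stack_cases (R := R) D E with ⟨G, hG, h1⟩ | ⟨hl, h1⟩ <;>
    rcases stack_cases (R := R) E F with ⟨H, hH, h2⟩ | ⟨hl', h2⟩ <;> rw [h1, h2]
  · rw [ofDiagram_mul_ofDiagram, ofDiagram_mul_ofDiagram]
    rcases stack_cases (R := R) G F with ⟨K, hK, h3⟩ | ⟨hl, h3⟩ <;> rw [h3]
    · rw [← sees_stackRel₃_left hG, sees_stackRel₃_right hH] at hK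
      rw [stack_eq_of_sees hK]
    · refine (hzero _ _ fun K hK => ?_).symm
      rw [← sees_stackRel₃_right hH, sees_stackRel₃_left hG] at hK
      exact hl hK.loopFree
  · rw [(hz _).2, ofDiagram_mul_ofDiagram]
    refine hzero _ _ fun K hK => ?_
    rw [← sees_stackRel₃_left hG] at hK
    exact hl' hK.loopFree.right_of_stackRel₃
  · rw [(hz _).1, ofDiagram_mul_ofDiagram]
    refine (hzero _ _ fun K hK => ?_).symm
    rw [← sees_stackRel₃_right hH] at hK
    exact hl hK.loopFree.left_of_stackRel₃
  · rw [(hz _).1, (hz _).2]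

theorem identity_mul (X : TL R (0 : R) n) : ofDiagram (Diagram.identity n) * X = X := by
  rw [mul_eq_mulHom]
  have : mulHom R (0 : R) n (ofDiagram (Diagram.identity n)) = LinearMap.id :=
    TL.linearMap_ext fun D => by
      rw [← mul_eq_mulHom, ofDiagram_mul_ofDiagram, stack_eq_of_sees (sees_identity_stack D)]
      rfl
  rw [this]
  rfl

theorem mul_identity (X : TL R (0 : R) n) : X * ofDiagram (Diagram.identity n) = X := by
  rw [← flipHom_flipHom (X * _), flipHom_mul, flipHom_ofDiagram, Diagram.flip_identity,
    identity_mul, flipHom_flipHom]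

theorem TL.mul_assoc (X Y Z : TL R (0 : R) n) : X * Y * Z = X * (Y * Z) := by
  induction X using TL.induction with
  | h0 => simp [mul_eq_mulHom]
  | hadd X X' h h' => simp only [mul_eq_mulHom, map_add, LinearMap.add_apply] at h h' ⊢; rw [h, h']
  | h c D =>
    induction Y using TL.induction with
    | h0 => simp [mul_eq_mulHom]
    | hadd Y Y' h h' =>
      simp only [mul_eq_mulHom, map_add, LinearMap.add_apply] at h h' ⊢; rw [h, h']
    | h d E =>
      induction Z using TL.induction with
      | h0 => simp [mul_eq_mulHom]
      | hadd Y Y' h h' =>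
        simp only [mul_eq_mulHom, map_add] at h h' ⊢; rw [h, h']
      | h e F =>
        have := ofDiagram_mul_assoc (R := R) D E F
        simp only [mul_eq_mulHom, map_smul, LinearMap.smul_apply] at this ⊢
        rw [this]

end Product

/-- The identity diagram as the unit of `TL_n(0)`. -/
abbrev TL.instOne {R : Type*} [CommRing R] {n : ℕ} : One (TL R (0 : R) n) :=
  ⟨ofDiagram (Diagram.identity n)⟩

attribute [local instance] TL.instOne

theorem one_eq {R : Type*} [CommRing R] {n : ℕ} :
    (1 : TL R (0 : R) n) = ofDiagram (Diagram.identity n) := rfl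

/-- The ring `TL_n(0)`. -/
abbrev TL.instRing {R : Type*} [CommRing R] {n : ℕ} : Ring (TL R (0 : R) n) :=
  { (inferInstance : AddCommGroup (TL R (0 : R) n)), (inferInstance : Mul (TL R (0 : R) n)),
    (inferInstance : One (TL R (0 : R) n)) with
    left_distrib := fun X Y Z => by simp only [mul_eq_mulHom, map_add]
    right_distrib := fun X Y Z => by simp only [mul_eq_mulHom, map_add, LinearMap.add_apply]
    zero_mul := fun X => by simp [mul_eq_mulHom]
    mul_zero := fun X => by simp [mul_eq_mulHom]
    mul_assoc := TL.mul_assoc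
    one_mul := identity_mul
    mul_one := mul_identity }

attribute [local instance] TL.instRing

/-- The algebra `TL_n(0)`. -/
abbrev TL.instAlgebra {R : Type*} [CommRing R] {n : ℕ} : Algebra R (TL R (0 : R) n) :=
  Algebra.ofModule (fun c X Y => by simp [mul_eq_mulHom]) (fun c X Y => by simp [mul_eq_mulHom])

attribute [local instance] TL.instAlgebra

/-! ### Products with generators, their relations, adding a strand -/

section Generators

variable {R : Type*} [CommRing R] {n : ℕ}

section CupCap
variable (i : ℕ) (h : i + 1 < n)

theorem cupCap_inr_left :
    (Diagram.cupCap i h).partner (Sum.inr ⟨i, by omega⟩) = Sum.inr ⟨i + 1, h⟩ := by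
  simp [Diagram.cupCap, swapNext]

theorem cupCap_inr_right :
    (Diagram.cupCap i h).partner (Sum.inr ⟨i + 1, h⟩) = Sum.inr ⟨i, by omega⟩ := by
  simp [Diagram.cupCap, swapNext]

theorem cupCap_inl_left :
    (Diagram.cupCap i h).partner (Sum.inl ⟨i, by omega⟩) = Sum.inl ⟨i + 1, h⟩ := by
  simp [Diagram.cupCap, swapNext]

theorem cupCap_inl_right :
    (Diagram.cupCap i h).partner (Sum.inl ⟨i + 1, h⟩) = Sum.inl ⟨i, by omega⟩ := by
  simp [Diagram.cupCap, swapNext]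

theorem cupCap_inl_of_ne (j : Fin n) (h1 : j.val ≠ i) (h2 : j.val ≠ i + 1) :
    (Diagram.cupCap i h).partner (Sum.inl j) = Sum.inr j := by
  simp [Diagram.cupCap, h1, h2]

theorem cupCap_inr_of_ne (j : Fin n) (h1 : j.val ≠ i) (h2 : j.val ≠ i + 1) :
    (Diagram.cupCap i h).partner (Sum.inr j) = Sum.inl j := by
  simp [Diagram.cupCap, h1, h2]

end CupCap

/-- The diagram `F` is `D` with a cap and a cup at the points `p, q` on top. -/
structure CupStep (p q : Fin n) (D F : Diagram n) : Prop where
  top : F.partner (Sum.inr p) = Sum.inr q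
  join : F.partner (D.partner (Sum.inr p)) = D.partner (Sum.inr q)
  other : ∀ x, x ≠ Sum.inr p → x ≠ Sum.inr q → x ≠ D.partner (Sum.inr p) →
    x ≠ D.partner (Sum.inr q) → F.partner x = D.partner x

theorem CupStep.symm {p q : Fin n} {D F : Diagram n} (h : CupStep p q D F) : CupStep q p D F :=
  ⟨by rw [← h.top, F.partner_partner], by rw [← h.join, F.partner_partner],
    fun x h1 h2 h3 h4 => h.other x h2 h1 h4 h3⟩

theorem CupStep.unique {p q : Fin n} {D F F' : Diagram n} (h : CupStep p q D F)
    (h' : CupStep p q D F') : F = F' := by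
  ext x : 2
  by_cases h1 : x = Sum.inr p
  · rw [h1, h.top, h'.top]
  by_cases h2 : x = Sum.inr q
  · rw [h2, h.symm.top, h'.symm.top]
  by_cases h3 : x = D.partner (Sum.inr p)
  · rw [h3, h.join, h'.join]
  by_cases h4 : x = D.partner (Sum.inr q)
  · rw [h4, h.symm.join, h'.symm.join]
  rw [h.other x h1 h2 h3 h4, h'.other x h1 h2 h3 h4]

theorem Diagram.partner_eq_iff (D : Diagram n) (x y : Pt n) :
    D.partner x = y ↔ D.partner y = x :=
  ⟨fun h => by rw [← h, D.partner_partner], fun h => by rw [← h, D.partner_partner]⟩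

theorem Diagram.partner_injective (D : Diagram n) : Function.Injective D.partner :=
  fun x y h => by rw [← D.partner_partner x, h, D.partner_partner]

theorem Sees.partner_eq {V : Type*} {r : V → V → Prop} {b : Pt n → V} {F : Diagram n}
    (h : Sees r b F.partner) {x y : Pt n} (hxy : x ≠ y) (h' : EqvGen r (b x) (b y)) :
    F.partner x = y := ((h.sep x y h').resolve_left hxy.symm).symm

/-- Cups of `D` are cups of the diagram that one sees when `D` is stacked on top of `E`. -/
theorem Sees.cup {D E F : Diagram n} (h : Sees (stackRel D E) (lev 0 2) F.partner) {i j : Fin n}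
    (hij : D.partner (Sum.inr i) = Sum.inr j) : F.partner (Sum.inr i) = Sum.inr j := by
  refine h.partner_eq (fun h => D.partner_ne (Sum.inr i) (hij.trans h.symm)) ?_
  exact EqvGen.rel _ _ (Or.inr ⟨Sum.inr i, rfl, by rw [hij]; rfl⟩)

section CupCapStack
variable (i : ℕ) (h : i + 1 < n) (D : Diagram n)

theorem eqvGen_cupCap_stack (z : Pt n) (h1 : z ≠ Sum.inr ⟨i, by omega⟩)
    (h2 : z ≠ Sum.inr ⟨i + 1, h⟩) :
    EqvGen (stackRel (Diagram.cupCap i h) D) (lev 0 1 z) (lev 0 2 z) := by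
  rcases z with j | j
  · exact EqvGen.refl _
  · refine EqvGen.rel _ _ (Or.inr ⟨Sum.inl j, rfl, ?_⟩)
    rw [cupCap_inl_of_ne]
    · rfl
    · rintro rfl; exact h1 rfl
    · intro hj
      exact h2 (congrArg Sum.inr (Fin.ext hj))

/-- If `D` has a cup right below the cap, the two middle points form a component without boundary
points. Otherwise each middle point reaches the boundary directly or along one strand of `D`. -/
theorem loopFree_cupCap_stack_iff :
    LoopFree (stackRel (Diagram.cupCap i h) D) (lev 0 2) ↔
      D.partner (Sum.inr ⟨i, by omega⟩) ≠ Sum.inr ⟨i + 1, h⟩ := by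
  constructor
  · intro hl hD
    have hD' := (D.partner_eq_iff _ _).1 hD
    let P : Fin 3 × Fin n → Prop := fun v => v = (1, ⟨i, by omega⟩) ∨ v = (1, ⟨i + 1, h⟩)
    have h1 : ∀ x : Pt n, P (lev 0 1 x) ↔ x = Sum.inr ⟨i, by omega⟩ ∨ x = Sum.inr ⟨i + 1, h⟩ := by
      rintro (x | x) <;> simp [P, lev]
    have h2 : ∀ x : Pt n, P (lev 1 2 x) ↔ x = Sum.inl ⟨i, by omega⟩ ∨ x = Sum.inl ⟨i + 1, h⟩ := by
      rintro (x | x) <;> simp [P, lev]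
    obtain ⟨x, hx⟩ := hl (1, ⟨i, by omega⟩)
    have := eqvGen_le (s := fun v w => (P v ↔ P w)) ⟨fun _ => Iff.rfl, Iff.symm, Iff.trans⟩ ?_ hx
    · have h3 : P (lev 0 2 x) := this.1 (Or.inl rfl)
      rcases x with x | x <;> simp [P, lev] at h3
    · rintro v w (⟨x, rfl, rfl⟩ | ⟨x, rfl, rfl⟩)
      · rw [h1, h1, D.partner_eq_iff x (Sum.inr ⟨i, _⟩), D.partner_eq_iff x (Sum.inr ⟨i + 1, _⟩),
          hD, hD', or_comm, @eq_comm _ _ x, @eq_comm _ _ x]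
      · rw [h2, h2, Diagram.partner_eq_iff _ x (Sum.inl ⟨i, _⟩),
          Diagram.partner_eq_iff _ x (Sum.inl ⟨i + 1, _⟩), cupCap_inl_left, cupCap_inl_right,
          or_comm, @eq_comm _ _ x, @eq_comm _ _ x]
  · intro hD
    have hlow : ∀ z : Pt n, D.partner z ≠ Sum.inr ⟨i, by omega⟩ →
        D.partner z ≠ Sum.inr ⟨i + 1, h⟩ →
        ∃ x, EqvGen (stackRel (Diagram.cupCap i h) D) (lev 0 1 z) (lev 0 2 x) := fun z h1 h2 =>
      ⟨_, EqvGen.trans _ _ _ (EqvGen.rel _ _ (Or.inl ⟨z, rfl, rfl⟩))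
        (eqvGen_cupCap_stack i h D _ h1 h2)⟩
    rintro ⟨l, j⟩
    fin_cases l
    · exact ⟨Sum.inl j, EqvGen.refl _⟩
    · by_cases h1 : j = ⟨i, by omega⟩
      · subst h1
        exact hlow (Sum.inr _) (D.partner_ne _) hD
      by_cases h2 : j = ⟨i + 1, h⟩
      · subst h2
        exact hlow (Sum.inr _) (fun h3 => hD ((D.partner_eq_iff _ _).1 h3)) (D.partner_ne _)
      exact ⟨Sum.inr j, eqvGen_cupCap_stack i h D (Sum.inr j) (by simpa using h1)
        (by simpa using h2)⟩
    · exact ⟨Sum.inr j, EqvGen.refl _⟩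

theorem cupStep_of_sees {F : Diagram n}
    (hF : Sees (stackRel (Diagram.cupCap i h) D) (lev 0 2) F.partner) :
    CupStep ⟨i, by omega⟩ ⟨i + 1, h⟩ D F := by
  have hD := (loopFree_cupCap_stack_iff i h D).1 hF.loopFree
  have hD' : D.partner (Sum.inr ⟨i + 1, h⟩) ≠ Sum.inr ⟨i, by omega⟩ :=
    fun h3 => hD ((D.partner_eq_iff _ _).1 h3)
  have e0 : ∀ z, EqvGen (stackRel (Diagram.cupCap i h) D) (lev 0 1 z) (lev 0 1 (D.partner z)) :=
    fun z => EqvGen.rel _ _ (Or.inl ⟨z, rfl, rfl⟩)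
  have up := eqvGen_cupCap_stack i h D
  refine ⟨hF.cup (cupCap_inr_left i h), hF.partner_eq ?_ ?_, ?_⟩
  · exact fun h3 => by simpa using D.partner_injective h3
  · refine EqvGen.trans _ _ _ (EqvGen.symm _ _ (up _ (D.partner_ne _) hD))
      (EqvGen.trans _ _ _ ?_ (up _ hD' (D.partner_ne _)))
    refine EqvGen.trans _ _ _ (EqvGen.symm _ _ (e0 _)) (EqvGen.trans _ _ _ ?_ (e0 _))
    exact EqvGen.rel _ _ (Or.inr ⟨Sum.inl ⟨i, by omega⟩, rfl, by rw [cupCap_inl_left]; rfl⟩)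
  · intro x h1 h2 h3 h4
    refine hF.partner_eq (D.partner_ne x).symm ?_
    refine EqvGen.trans _ _ _ (EqvGen.symm _ _ (up _ h1 h2))
      (EqvGen.trans _ _ _ (e0 _) (up _ ?_ ?_))
    · exact fun h5 => h3 ((D.partner_eq_iff _ _).1 h5).symm
    · exact fun h5 => h4 ((D.partner_eq_iff _ _).1 h5).symm

variable (R)

theorem cupCap_mul_of_eq (hD : D.partner (Sum.inr ⟨i, by omega⟩) = Sum.inr ⟨i + 1, h⟩) :
    (ofDiagram (Diagram.cupCap i h) * ofDiagram D : TL R (0 : R) n) = 0 := by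
  rw [ofDiagram_mul_ofDiagram]
  refine stack_eq_zero fun hl => ?_
  exact (loopFree_cupCap_stack_iff i h D).1 hl hD

theorem exists_cupCap_mul (hD : D.partner (Sum.inr ⟨i, by omega⟩) ≠ Sum.inr ⟨i + 1, h⟩) :
    ∃ F, CupStep ⟨i, by omega⟩ ⟨i + 1, h⟩ D F ∧
      (ofDiagram (Diagram.cupCap i h) * ofDiagram D : TL R (0 : R) n) = ofDiagram F := by
  obtain ⟨F, hF⟩ := exists_sees_stack _ _ ((loopFree_cupCap_stack_iff i h D).2 hD)
  exact ⟨F, cupStep_of_sees i h D hF, by rw [ofDiagram_mul_ofDiagram, stack_eq_of_sees hF]⟩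

theorem cupCap_mul_of_cupStep {F : Diagram n} (hF : CupStep ⟨i, by omega⟩ ⟨i + 1, h⟩ D F)
    (hD : D.partner (Sum.inr ⟨i, by omega⟩) ≠ Sum.inr ⟨i + 1, h⟩) :
    (ofDiagram (Diagram.cupCap i h) * ofDiagram D : TL R (0 : R) n) = ofDiagram F := by
  obtain ⟨F', hF', h1⟩ := exists_cupCap_mul R i h D hD
  rw [h1, hF.unique hF']

end CupCapStack

theorem U_succ {δ : R} {i : ℕ} (h : i + 1 < n) :
    U R δ n (i + 1) = ofDiagram (Diagram.cupCap i h) := by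
  rw [U, dif_pos ⟨by omega, h⟩]
  rfl

theorem U_zero {δ : R} : U R δ n 0 = 0 := by simp [U]

theorem U_eq_zero {δ : R} {i : ℕ} (h : n ≤ i) : U R δ n i = 0 := by
  rw [U, dif_neg]; omega

theorem flipHom_U (i : ℕ) : flipHom R n (U R 0 n i) = U R 0 n i := by
  rw [U]
  split_ifs with h
  · rw [flipHom_ofDiagram, Diagram.flip_cupCap]
  · simp

theorem U_mul_self (i : ℕ) : U R 0 n i * U R 0 n i = 0 := by
  rw [U]
  split_ifs with h
  · exact cupCap_mul_of_eq R _ _ _ (cupCap_inr_left _ _)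
  · simp

/-- Moving a cup one place along and back. -/
theorem CupStep.comp {p q s : Fin n} {D G : Diagram n}
    (hD : D.partner (Sum.inr p) = Sum.inr q) (hG : CupStep q s D G) : CupStep p q G D := by
  have hq : D.partner (Sum.inr q) = Sum.inr p := (D.partner_eq_iff _ _).1 hD
  have h1 : G.partner (Sum.inr p) = D.partner (Sum.inr s) := by rw [← hG.join, hq]
  refine ⟨hD, ?_, ?_⟩
  · rw [h1, D.partner_partner, hG.top]
  · intro x h2 h3 h4 h5
    rw [h1] at h4
    rw [hG.top] at h5
    exact (hG.other x h3 h5 (by rwa [hq]) h4).symm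

/-- The inner generator moves the cup one place to the right and the outer one moves it back. For
`D` a generator this is a defining relation; for general `D` it factors a diagram with a cup through
a generator. -/
theorem cup_absorb_right {i : ℕ} (h : i + 2 < n) (D : Diagram n)
    (hD : D.partner (Sum.inr ⟨i, by omega⟩) = Sum.inr ⟨i + 1, by omega⟩) :
    U R 0 n (i + 1) * (U R 0 n (i + 2) * ofDiagram D) = ofDiagram D := by
  rw [U_succ (show i + 1 < n by omega), U_succ (show i + 1 + 1 < n by omega)]
  have hD' := (D.partner_eq_iff _ _).1 hD
  obtain ⟨G, hG, h1⟩ := exists_cupCap_mul R (i + 1) h D (by rw [hD']; simp; omega)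
  rw [h1]
  refine cupCap_mul_of_cupStep R _ _ _ (hG.comp hD) ?_
  rw [Ne, Diagram.partner_eq_iff, hG.top]
  simp; omega

theorem cup_absorb_left {i : ℕ} (h : i + 2 < n) (D : Diagram n)
    (hD : D.partner (Sum.inr ⟨i + 1, by omega⟩) = Sum.inr ⟨i + 2, by omega⟩) :
    U R 0 n (i + 2) * (U R 0 n (i + 1) * ofDiagram D) = ofDiagram D := by
  rw [U_succ (show i + 1 < n by omega), U_succ (show i + 1 + 1 < n by omega)]
  have hD' := (D.partner_eq_iff _ _).1 hD
  obtain ⟨G, hG, h1⟩ := exists_cupCap_mul R i (by omega) D (by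
    rw [Ne, Diagram.partner_eq_iff, hD]; simp)
  rw [h1]
  refine cupCap_mul_of_cupStep R _ _ _ (hG.symm.comp hD').symm ?_
  rw [hG.symm.top]
  simp; omega

theorem U_mul_U_mul_U {i : ℕ} (hi : 1 ≤ i) (h : i + 1 < n) :
    U R 0 n i * (U R 0 n (i + 1) * U R 0 n i) = U R 0 n i := by
  obtain ⟨i, rfl⟩ := Nat.exists_eq_add_of_le' hi
  nth_rewrite 2 3 [U_succ (by omega : i + 1 < n)]
  exact cup_absorb_right h _ (cupCap_inr_left _ _)

theorem U_mul_U_mul_U' {i : ℕ} (hi : 1 ≤ i) (h : i + 1 < n) :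
    U R 0 n (i + 1) * (U R 0 n i * U R 0 n (i + 1)) = U R 0 n (i + 1) := by
  obtain ⟨i, rfl⟩ := Nat.exists_eq_add_of_le' hi
  nth_rewrite 2 3 [U_succ (by omega : i + 1 + 1 < n)]
  exact cup_absorb_left h _ (cupCap_inr_left _ _)

/-- The diagram of one product is shown to arise by the rewiring that defines the other. The
distance of the indices keeps the eight endpoints involved distinct. -/
theorem U_comm {i j : ℕ} (hij : i + 2 ≤ j) : U R 0 n i * U R 0 n j = U R 0 n j * U R 0 n i := by
  rcases i with _ | i
  · simp [U_zero]
  by_cases hj : n ≤ j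
  · simp [U_eq_zero hj]
  obtain ⟨j, rfl⟩ := Nat.exists_eq_add_of_le' (show 1 ≤ j by omega)
  have hi : i + 1 < n := by omega
  have hj : j + 1 < n := by omega
  rw [U_succ hi, U_succ hj]
  obtain ⟨F, hF, h1⟩ := exists_cupCap_mul R i hi (Diagram.cupCap j hj) (by
    rw [cupCap_inr_of_ne _ _ _ (by simp; omega) (by simp; omega)]; simp)
  rw [h1]
  refine (cupCap_mul_of_cupStep R _ _ _ ?_ (by
    rw [cupCap_inr_of_ne _ _ _ (by simp; omega) (by simp; omega)]; simp)).symm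
  have e1 := cupCap_inr_of_ne j hj ⟨i, by omega⟩ (by simp; omega) (by simp; omega)
  have e2 := cupCap_inr_of_ne j hj ⟨i + 1, hi⟩ (by simp; omega) (by simp; omega)
  have e3 := cupCap_inr_of_ne i hi ⟨j, by omega⟩ (by simp; omega) (by simp; omega)
  have e4 := cupCap_inr_of_ne i hi ⟨j + 1, hj⟩ (by simp; omega) (by simp; omega)
  have hj1 := hF.join
  have ho := hF.other
  rw [e1, e2] at hj1 ho
  refine ⟨?_, ?_, ?_⟩
  · rw [ho, cupCap_inr_left] <;> simp <;> omega
  · rw [e3, e4, ho, cupCap_inl_left] <;> simp <;> omega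
  · rw [e3, e4]
    intro x h2 h3 h4 h5
    by_cases k1 : x = Sum.inr ⟨i, by omega⟩
    · rw [k1, hF.top, cupCap_inr_left]
    by_cases k2 : x = Sum.inr ⟨i + 1, hi⟩
    · rw [k2, hF.symm.top, cupCap_inr_right]
    by_cases k3 : x = Sum.inl ⟨i, by omega⟩
    · rw [k3, hj1, cupCap_inl_left]
    by_cases k4 : x = Sum.inl ⟨i + 1, hi⟩
    · rw [k4, (F.partner_eq_iff _ _).1 hj1, cupCap_inl_right]
    rw [ho x k1 k2 k3 k4]
    rcases x with x | x
    · simp only [ne_eq, Sum.inl.injEq, Fin.ext_iff] at h4 h5 k3 k4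
      rw [cupCap_inl_of_ne _ _ _ h4 h5, cupCap_inl_of_ne _ _ _ k3 k4]
    · simp only [ne_eq, Sum.inr.injEq, Fin.ext_iff] at h2 h3 k1 k2
      rw [cupCap_inr_of_ne _ _ _ h2 h3, cupCap_inr_of_ne _ _ _ k1 k2]

theorem CupStep.addStrand {p q : Fin n} {D F : Diagram n} (h : CupStep p q D F) :
    CupStep p.castSucc q.castSucc D.addStrand F.addStrand := by
  have e : ∀ (D : Diagram n) x, D.addStrand.partner (Pt.castSucc x) =
      Pt.castSucc (D.partner x) := fun D => addStrandPartner_castSucc _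
  have e1 : ∀ (D : Diagram n) j, D.addStrand.partner (Sum.inr (Fin.castSucc j)) =
      Pt.castSucc (D.partner (Sum.inr j)) := fun D j => e D (Sum.inr j)
  refine ⟨?_, ?_, ?_⟩
  · rw [e1, h.top]; rfl
  · rw [e1, e1, e, h.join]
  · intro x
    rw [e1, e1]
    intro h1 h2 h3 h4
    rcases Pt.cases_castSucc x with ⟨x, rfl⟩ | rfl | rfl
    · rw [e, e, h.other x]
      · rintro rfl; exact h1 rfl
      · rintro rfl; exact h2 rfl
      · rintro rfl; exact h3 rfl
      · rintro rfl; exact h4 rfl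
    · exact (addStrandPartner_inl _).trans (addStrandPartner_inl _).symm
    · exact (addStrandPartner_inr _).trans (addStrandPartner_inr _).symm

theorem strand_ofDiagram {δ : R} (D : Diagram n) :
    strand (ofDiagram D : TL R δ n) = ofDiagram D.addStrand := by
  rw [strand, ofDiagram, ofDiagram]
  exact Finsupp.mapDomain_single

theorem addStrand_identity : (Diagram.identity n).addStrand = Diagram.identity (n + 1) := by
  ext x : 2
  rcases Pt.cases_castSucc x with ⟨x, rfl⟩ | rfl | rfl
  · refine (addStrandPartner_castSucc _ _).trans ?_
    rcases x with x | x <;> rfl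
  · exact addStrandPartner_inl _
  · exact addStrandPartner_inr _

theorem strand_one : strand (1 : TL R 0 n) = 1 := by
  rw [one_eq, one_eq, strand_ofDiagram, addStrand_identity]

theorem addStrand_cupCap (i : ℕ) (h : i + 1 < n) :
    (Diagram.cupCap i h).addStrand = Diagram.cupCap i (by omega) := by
  ext x : 2
  rcases Pt.cases_castSucc x with ⟨x, rfl⟩ | rfl | rfl
  · refine (addStrandPartner_castSucc _ _).trans ?_
    rcases x with x | x <;> simp only [Diagram.cupCap, Sum.map_inl, Sum.map_inr, Fin.val_castSucc,
      swapNext] <;> split_ifs <;> rfl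
  · refine (addStrandPartner_inl _).trans (cupCap_inl_of_ne _ _ _ ?_ ?_).symm <;> simp <;> omega
  · refine (addStrandPartner_inr _).trans (cupCap_inr_of_ne _ _ _ ?_ ?_).symm <;> simp <;> omega

theorem strand_U {i : ℕ} (h : i < n) : strand (U R 0 n i) = U R 0 (n + 1) i := by
  rcases i with _ | i
  · simp [U_zero]
  · rw [U_succ h, U_succ (by omega), strand_ofDiagram, addStrand_cupCap]

theorem strand_U_mul {i : ℕ} (h : i < n) (X : TL R 0 n) :
    strand (U R 0 n i * X) = U R 0 (n + 1) i * strand X := by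
  rcases i with _ | i
  · simp [U_zero]
  induction X using TL.induction with
  | h0 => simp
  | hadd X Y hX hY => rw [mul_add, map_add, hX, hY, map_add, mul_add]
  | h c D =>
    rw [mul_smul_comm, map_smul, map_smul, mul_smul_comm]
    congr 1
    rw [U_succ h, U_succ (by omega), strand_ofDiagram]
    have e1 : ∀ j (hj : j < n), D.addStrand.partner (Sum.inr ⟨j, by omega⟩) =
        Pt.castSucc (D.partner (Sum.inr ⟨j, hj⟩)) := fun j hj =>
      addStrandPartner_castSucc _ (Sum.inr ⟨j, hj⟩)
    by_cases hD : D.partner (Sum.inr ⟨i, by omega⟩) = Sum.inr ⟨i + 1, h⟩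
    · rw [cupCap_mul_of_eq R _ _ _ hD, map_zero, cupCap_mul_of_eq]
      rw [e1 i (by omega), hD]; rfl
    · obtain ⟨F, hF, h1⟩ := exists_cupCap_mul R _ _ _ hD
      rw [h1, strand_ofDiagram]
      refine (cupCap_mul_of_cupStep R _ _ _ hF.addStrand ?_).symm
      rw [e1 i (by omega)]
      intro h2
      apply hD
      have : Pt.castSucc (D.partner (Sum.inr ⟨i, by omega⟩)) = Pt.castSucc (Sum.inr ⟨i + 1, h⟩) := h2
      exact Sum.map_injective.2 ⟨Fin.castSucc_injective n, Fin.castSucc_injective n⟩ this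

/-- The subalgebra of `TL_n(0)` generated by the `U_i`. -/
def genAlg (R : Type*) [CommRing R] (n : ℕ) : Subalgebra R (TL R (0 : R) n) :=
  Algebra.adjoin R (Set.range fun i : Fin n => U R 0 n i)

theorem U_mem_genAlg (i : ℕ) : U R 0 n i ∈ genAlg R n := by
  by_cases h : i < n
  · exact Algebra.subset_adjoin ⟨⟨i, h⟩, rfl⟩
  · rw [U_eq_zero (by omega)]
    exact zero_mem _

/-- The projectors are words in the generators, so it is enough to let the left factor range over
the algebra they generate; arbitrary stacks need not be compared. -/
theorem strand_mul {X : TL R 0 n} (hX : X ∈ genAlg R n) (Y : TL R 0 n) :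
    strand (X * Y) = strand X * strand Y := by
  induction hX using Algebra.adjoin_induction generalizing Y with
  | mem X hX =>
    obtain ⟨i, rfl⟩ := hX
    simp only
    rw [strand_U_mul i.2, strand_U i.2]
  | algebraMap c =>
    rw [Algebra.algebraMap_eq_smul_one, smul_mul_assoc, one_mul, map_smul, map_smul, strand_one,
      smul_mul_assoc, one_mul]
  | add X X' _ _ h h' => rw [add_mul, map_add, h, h', map_add, add_mul]
  | mul X X' _ _ h h' => rw [mul_assoc, h, h', h, mul_assoc]

end Generators

/-! ### The recursion for the projectors in an abstract algebra -/

section Recursion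

/-- The relations of the generators `u 1, …, u (N - 1)` of the Temperley-Lieb algebra with loop
parameter `0`. -/
structure Relations {A : Type*} [Ring A] (u : ℕ → A) (N : ℕ) : Prop where
  zero : u 0 = 0
  sq : ∀ i, u i * u i = 0
  up : ∀ i, 1 ≤ i → i + 1 < N → u i * (u (i + 1) * u i) = u i
  down : ∀ i, 1 ≤ i → i + 1 < N → u (i + 1) * (u i * u (i + 1)) = u (i + 1)
  comm : ∀ i j, i + 2 ≤ j → u i * u j = u j * u i

theorem relations_U (R : Type*) [CommRing R] (N : ℕ) : Relations (U R 0 N) N where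
  zero := U_zero
  sq := U_mul_self
  up _ := U_mul_U_mul_U
  down _ := U_mul_U_mul_U'
  comm _ _ := U_comm

theorem Relations.op {A : Type*} [Ring A] {u : ℕ → A} {N : ℕ} (h : Relations u N) :
    Relations (fun i => MulOpposite.op (u i)) N where
  zero := by rw [h.zero]; rfl
  sq i := by rw [← MulOpposite.op_mul, h.sq]; rfl
  up i h1 h2 := by
    rw [← MulOpposite.op_mul, ← MulOpposite.op_mul, mul_assoc, h.up i h1 h2]
  down i h1 h2 := by
    rw [← MulOpposite.op_mul, ← MulOpposite.op_mul, mul_assoc, h.down i h1 h2]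
  comm i j hij := by rw [← MulOpposite.op_mul, ← MulOpposite.op_mul, h.comm i j hij]

variable {k : Type*} [Field k] {A : Type*} [Ring A] [Algebra k A]

/-- The value of `p_2^{(2j+1)}`, for `j ≥ 1`. -/
def ptr (k : Type*) [Field k] (j : ℕ) : k := -((j : k) + 1) / j

/-- Division by zero is used on purpose: the inverse of this value is 0 as well, so the term with
E_3 drops out of `jw` at `j = 0` and one recursion covers the step from JW_1 to JW_3. -/
theorem ptr_zero : ptr k 0 = 0 := by simp [ptr]

theorem ptr_ne_zero [CharZero k] {j : ℕ} (hj : 1 ≤ j) : ptr k j ≠ 0 := by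
  have h1 : (j : k) ≠ 0 := by simp; omega
  have h2 : (j : k) + 1 ≠ 0 := Nat.cast_add_one_ne_zero j
  exact div_ne_zero (neg_ne_zero.2 h2) h1

theorem ptr_succ [CharZero k] (j : ℕ) : ptr k (j + 1) = -2 - (ptr k j)⁻¹ := by
  have h2 : (j : k) + 1 ≠ 0 := Nat.cast_add_one_ne_zero j
  simp only [ptr, Nat.cast_add, Nat.cast_one, inv_div]
  rw [div_neg]
  field_simp
  ring

/-- The element `E_1` for the projector `e`. -/
def e₁ (u : ℕ → A) (n : ℕ) (e : A) : A := e * (u n * u (n + 1)) * e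

/-- The element `E_2` for the projector `e`. -/
def e₂ (u : ℕ → A) (n : ℕ) (e : A) : A := e * (u (n + 1) * u n) * e

/-- The element `E_3` for the projector `e`. -/
def e₃ (u : ℕ → A) (n : ℕ) (e : A) : A := e * (u n * (u (n - 1) * u (n + 1)) * u n) * e

/-- The recursion for the projectors, in terms of generators. -/
def jw (k : Type*) [Field k] [Algebra k A] (u : ℕ → A) : ℕ → A
  | 0 => 1
  | j + 1 => jw k u j - e₁ u (2 * j + 1) (jw k u j) - e₂ u (2 * j + 1) (jw k u j) -
      (ptr k j)⁻¹ • e₃ u (2 * j + 1) (jw k u j)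

/-- Only generators with index at most `2 * j` occur in the projector, and `u i` commutes with
these. -/
theorem jw_commute {u : ℕ → A} {N : ℕ} (h : Relations u N) (j i : ℕ) (hi : 2 * j + 2 ≤ i) :
    Commute (u i) (jw k u j) := by
  induction j with
  | zero => exact Commute.one_right _
  | succ j ih =>
    have hc : ∀ l, l + 2 ≤ i → Commute (u i) (u l) := fun l hl => (h.comm l i hl).symm
    have h0 := ih (by omega)
    have h1 := hc (2 * j + 1) (by omega)
    have h2 := hc (2 * j + 1 + 1) (by omega)
    have h3 := hc (2 * j + 1 - 1) (by omega)
    exact ((h0.sub_right ((h0.mul_right (h1.mul_right h2)).mul_right h0)).sub_right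
      ((h0.mul_right (h2.mul_right h1)).mul_right h0)).sub_right
      (((h0.mul_right ((h1.mul_right (h3.mul_right h2)).mul_right h1)).mul_right h0).smul_right _)

/-- Reversing words exchanges E_1 with E_2 and fixes E_3, whose two middle generators commute. -/
theorem jw_op {u : ℕ → A} {N : ℕ} (h : Relations u N) (j : ℕ) :
    jw k (fun i => MulOpposite.op (u i)) j = MulOpposite.op (jw k u j) := by
  induction j with
  | zero => rfl
  | succ j ih =>
    have hc := h.comm (2 * j) (2 * j + 1 + 1) (by omega)
    simp only [jw, ih, e₁, e₂, e₃, ← MulOpposite.op_mul, ← MulOpposite.op_sub,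
      ← MulOpposite.op_smul, Nat.add_sub_cancel, mul_assoc]
    rw [← mul_assoc (u (2 * j + 1 + 1)) (u (2 * j)), ← hc, mul_assoc]
    congr 2
    abel

/-- The properties of the projectors that make up the induction. -/
structure IsProj (k : Type*) [Field k] [Algebra k A] (u : ℕ → A) (j : ℕ) : Prop where
  idem : jw k u j * jw k u j = jw k u j
  left : ∀ i, i ≤ 2 * j → u i * jw k u j = 0
  right : ∀ i, i ≤ 2 * j → jw k u j * u i = 0

theorem IsProj.op {u : ℕ → A} {N j : ℕ} (h : Relations u N) (hj : IsProj k u j) :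
    IsProj k (fun i => MulOpposite.op (u i)) j where
  idem := by rw [jw_op h, ← MulOpposite.op_mul, hj.idem]
  left i hi := by rw [jw_op h, ← MulOpposite.op_mul, hj.right i hi]; rfl
  right i hi := by rw [jw_op h, ← MulOpposite.op_mul, hj.left i hi]; rfl

/-- The right-associated form of a relation. -/
theorem mul_assoc_of_eq {A : Type*} [Semigroup A] {x y z : A} (h : x * y = z) (w : A) :
    x * (y * w) = z * w := by rw [← mul_assoc, h]

theorem jw_mul_jw_succ {u : ℕ → A} {j : ℕ} (hj : IsProj k u j) :
    jw k u j * jw k u (j + 1) = jw k u (j + 1) := by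
  have h := mul_assoc_of_eq hj.idem
  simp only [jw, e₁, e₂, e₃, mul_sub, mul_smul_comm, mul_assoc, h, hj.idem]

theorem jw_succ_mul_jw {u : ℕ → A} {j : ℕ} (hj : IsProj k u j) :
    jw k u (j + 1) * jw k u j = jw k u (j + 1) := by
  simp only [jw, e₁, e₂, e₃, sub_mul, smul_mul_assoc, mul_assoc, hj.idem]

/-- What remains of the partial trace of the projector. -/
theorem exists_partial {u : ℕ → A} [CharZero k] {N : ℕ} (h : Relations u N) (j : ℕ)
    (hN : 2 * j + 2 < N) (hj : IsProj k u j) (hj' : ∀ i, i < j → IsProj k u i) :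
    ∃ P Q : A, u (2 * j + 1) * jw k u j * u (2 * j + 1) = P * u (2 * j + 1) ∧
      Commute P (u (2 * j + 1)) ∧ Commute P (u (2 * j + 2)) ∧ jw k u j * P = 0 ∧
      P * jw k u j = 0 ∧ u (2 * j) * P * u (2 * j) = ptr k j • (Q * u (2 * j)) ∧
      jw k u j * Q = jw k u j ∧ Commute Q (u (2 * j + 1)) ∧
      u (2 * j + 1) * jw k u j * (u (2 * j + 2) * u (2 * j + 1)) * jw k u j +
        (ptr k j)⁻¹ • (P * u (2 * j + 1) * (u (2 * j) * u (2 * j + 2)) * u (2 * j + 1) *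
          jw k u j) = u (2 * j + 1) * jw k u j := by
  -- For JW_1 = 1 the relation `u 1 * u 1 = 0` allows P = 0, and the last identity is the relation
  -- `h.up 1`.
  rcases j with _ | j
  · refine ⟨0, 1, ?_, Commute.zero_left _, Commute.zero_left _, by simp, by simp, ?_, by simp,
      Commute.one_left _, ?_⟩
    · simpa [jw] using h.sq 1
    · simp [h.zero]
    · simpa [jw] using h.up 1 (by omega) (by omega)
  have hQ := hj' j (by omega)
  have hQE := jw_mul_jw_succ hQ
  have hEQ := jw_succ_mul_jw hQ
  set E := jw k u (j + 1) with hE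
  set Q := jw k u j with hQdef
  have cQ := fun i (hi : 2 * j + 2 ≤ i) => (jw_commute (k := k) h j i hi).eq
  have exp : E = Q - Q * (u (2 * j + 1) * u (2 * j + 2)) * Q
      - Q * (u (2 * j + 2) * u (2 * j + 1)) * Q - (ptr k j)⁻¹ •
      (Q * (u (2 * j + 1) * (u (2 * j) * u (2 * j + 2)) * u (2 * j + 1)) * Q) := rfl
  rw [show 2 * (j + 1) + 1 = 2 * j + 3 by ring, show 2 * (j + 1) + 2 = 2 * j + 4 by ring,
    show 2 * (j + 1) = 2 * j + 2 by ring]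
  -- The scalar is needed: at `j = 0` the left word is 0 because `u 0 = 0`, and the identity holds
  -- since `(ptr k 0)⁻¹ = 0`.
  have hwvw : (ptr k j)⁻¹ • (u (2 * j + 1) * (u (2 * j) * u (2 * j + 1))) =
      (ptr k j)⁻¹ • u (2 * j + 1) := by
    rcases j with _ | j
    · simp [ptr_zero]
    · rw [h.down (2 * (j + 1)) (by omega) (by omega)]
  have hawa := h.down (2 * j + 1) (by omega) (by omega)
  have hxax := h.down (2 * j + 2) (by omega) (by omega)
  have hxyx := h.up (2 * j + 3) (by omega) (by omega)
  have hxx := h.sq (2 * j + 3)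
  have hvx := h.comm (2 * j) (2 * j + 3) (by omega)
  have hwx := h.comm (2 * j + 1) (2 * j + 3) (by omega)
  have hwy := h.comm (2 * j + 1) (2 * j + 4) (by omega)
  have hc := ptr_ne_zero (k := k) (show 1 ≤ j + 1 by omega)
  have hcs := ptr_succ (k := k) j
  set v := u (2 * j)
  set w := u (2 * j + 1)
  set a := u (2 * j + 2)
  set x := u (2 * j + 3)
  set y := u (2 * j + 4)
  have cQa : a * Q = Q * a := cQ _ le_rfl
  have cQx : x * Q = Q * x := cQ _ (by omega)
  have cQy : y * Q = Q * y := cQ _ (by omega)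
  have hwE : w * E = 0 := hj.left _ (by omega)
  have hEw : E * w = 0 := hj.right _ (by omega)
  set c := ptr k (j + 1)
  set d := (ptr k j)⁻¹
  have hQQ := hQ.idem
  rw [← hQdef] at hQQ
  -- In `x * E * x` the element `x` passes `Q`, `w` and `v`, while `x * a * x = x`. The four terms
  -- of `exp` give 0, -1, -1 and `-d` times `Q * w * Q * x`, and `-2 - d` is the value `c` by
  -- `ptr_succ`.
  refine ⟨c • (Q * (w * Q)), Q, ?_, ?_, ?_, ?_, ?_, ?_, hEQ, cQx.symm, ?_⟩
  · have h1 : x * Q * x = 0 := by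
      rw [cQx, mul_assoc, hxx, mul_zero]
    have h2 : x * (Q * (w * a) * Q) * x = Q * (w * Q) * x := by
      calc x * (Q * (w * a) * Q) * x = (x * Q) * (w * a) * (Q * x) := by simp only [mul_assoc]
        _ = (Q * x) * (w * a) * (x * Q) := congrArg₂ (fun s t => s * (w * a) * t) cQx cQx.symm
        _ = Q * (x * w) * (a * x) * Q := by simp only [mul_assoc]
        _ = Q * w * (x * (a * x)) * Q := by rw [← hwx]; simp only [mul_assoc]
        _ = Q * w * (x * Q) := by rw [hxax]; simp only [mul_assoc]
        _ = _ := by rw [cQx]; simp only [mul_assoc]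
    have h3 : x * (Q * (a * w) * Q) * x = Q * (w * Q) * x := by
      calc x * (Q * (a * w) * Q) * x = (x * Q) * (a * w) * (Q * x) := by simp only [mul_assoc]
        _ = (Q * x) * (a * w) * (x * Q) := congrArg₂ (fun s t => s * (a * w) * t) cQx cQx.symm
        _ = Q * x * a * (w * x) * Q := by simp only [mul_assoc]
        _ = Q * (x * (a * x)) * w * Q := by rw [hwx]; simp only [mul_assoc]
        _ = Q * (x * w) * Q := by rw [hxax]; simp only [mul_assoc]
        _ = Q * w * (x * Q) := by rw [← hwx]; simp only [mul_assoc]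
        _ = _ := by rw [cQx]; simp only [mul_assoc]
    have h4 : d • (x * (Q * (w * (v * a) * w) * Q) * x) = d • (Q * (w * Q) * x) := by
      have : x * (Q * (w * (v * a) * w) * Q) * x = Q * (w * (v * w)) * Q * x := by
        calc x * (Q * (w * (v * a) * w) * Q) * x
            = (x * Q) * (w * v * a * w) * (Q * x) := by simp only [mul_assoc]
          _ = (Q * x) * (w * v * a * w) * (x * Q) :=
              congrArg₂ (fun s t => s * (w * v * a * w) * t) cQx cQx.symm
          _ = Q * (x * w) * v * a * (w * x) * Q := by simp only [mul_assoc]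
          _ = Q * (w * x) * v * a * (x * w) * Q :=
              congrArg₂ (fun s t => Q * s * v * a * t * Q) hwx.symm hwx
          _ = Q * w * (x * v) * a * x * w * Q := by simp only [mul_assoc]
          _ = Q * w * v * (x * (a * x)) * w * Q := by rw [← hvx]; simp only [mul_assoc]
          _ = Q * w * v * (x * w) * Q := by rw [hxax]; simp only [mul_assoc]
          _ = Q * w * v * w * (x * Q) := by rw [← hwx]; simp only [mul_assoc]
          _ = _ := by rw [cQx]; simp only [mul_assoc]
      rw [this, ← smul_mul_assoc, ← smul_mul_assoc, ← mul_smul_comm, hwvw]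
      simp only [mul_smul_comm, smul_mul_assoc, mul_assoc]
    rw [exp, mul_sub, mul_sub, mul_sub, sub_mul, sub_mul, sub_mul, h1, h2, h3, mul_smul_comm,
      smul_mul_assoc, h4, hcs, smul_mul_assoc]
    module
  · have : Commute (Q * (w * Q)) x :=
      Commute.mul_left cQx.symm (Commute.mul_left hwx cQx.symm)
    exact this.smul_left c
  · have : Commute (Q * (w * Q)) y :=
      Commute.mul_left cQy.symm (Commute.mul_left hwy cQy.symm)
    exact this.smul_left c
  · rw [mul_smul_comm, ← mul_assoc, hEQ, ← mul_assoc, hEw, zero_mul, smul_zero]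
  · rw [smul_mul_assoc, mul_assoc, mul_assoc, hQE, hwE, mul_zero, smul_zero]
  · rw [mul_smul_comm, smul_mul_assoc]
    congr 1
    calc a * (Q * (w * Q)) * a = (a * Q) * w * (Q * a) := by simp only [mul_assoc]
      _ = (Q * a) * w * (a * Q) := congrArg₂ (fun s t => s * w * t) cQa cQa.symm
      _ = Q * (a * (w * a)) * Q := by simp only [mul_assoc]
      _ = Q * (a * Q) := by rw [hawa]; simp only [mul_assoc]
      _ = Q * a := by rw [cQa, ← mul_assoc, hQQ]
  -- The first factor `E` is expanded. In the terms ending in `w * Q` the element `w` moves past `y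
  -- * x` and is killed by `E`. The remaining correction, from `w * a`, is cancelled by the summand
  -- with P, whose factor `c` is removed by `c⁻¹`.
  · have key : y * x * E = Q * (y * x * E) := by
      calc y * x * E = y * x * (Q * E) := by rw [hQE]
        _ = y * (x * Q) * E := by simp only [mul_assoc]
        _ = (y * Q) * x * E := by rw [cQx]; simp only [mul_assoc]
        _ = _ := by rw [cQy]; simp only [mul_assoc]
    have key2 : w * (y * x * E) = 0 := by
      calc w * (y * x * E) = (w * y) * x * E := by simp only [mul_assoc]
        _ = y * (w * x) * E := by rw [hwy]; simp only [mul_assoc]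
        _ = y * x * (w * E) := by rw [hwx]; simp only [mul_assoc]
        _ = 0 := by rw [hwE, mul_zero]
    have h1 : x * Q * (y * x) * E = x * E := by
      calc x * Q * (y * x) * E = x * (Q * (y * x * E)) := by simp only [mul_assoc]
        _ = (x * (y * x)) * E := by rw [← key]; simp only [mul_assoc]
        _ = _ := by rw [hxyx]
    have h2 : x * (Q * (w * a) * Q) * (y * x) * E = Q * w * (x * a * (y * x * E)) := by
      calc x * (Q * (w * a) * Q) * (y * x) * E
          = (x * Q) * w * a * (Q * (y * x * E)) := by simp only [mul_assoc]
        _ = Q * (x * w) * a * (y * x * E) := by rw [← key, cQx]; simp only [mul_assoc]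
        _ = _ := by rw [← hwx]; simp only [mul_assoc]
    have h3 : x * (Q * (a * w) * Q) * (y * x) * E = 0 := by
      calc x * (Q * (a * w) * Q) * (y * x) * E
          = x * Q * a * w * (Q * (y * x * E)) := by simp only [mul_assoc]
        _ = x * Q * a * (w * (y * x * E)) := by rw [← key]; simp only [mul_assoc]
        _ = 0 := by rw [key2, mul_zero]
    have h4 : x * (Q * (w * (v * a) * w) * Q) * (y * x) * E = 0 := by
      calc x * (Q * (w * (v * a) * w) * Q) * (y * x) * E
          = x * Q * w * v * a * w * (Q * (y * x * E)) := by simp only [mul_assoc]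
        _ = x * Q * w * v * a * (w * (y * x * E)) := by rw [← key]; simp only [mul_assoc]
        _ = 0 := by rw [key2, mul_zero]
    have hfirst : x * E * (y * x) * E = x * E - Q * w * (x * a * (y * x * E)) := by
      refine (congrArg (fun z => x * z * (y * x) * E) exp).trans ?_
      simp only [mul_sub, sub_mul, mul_smul_comm, smul_mul_assoc, h1, h2, h3, h4, smul_zero,
        sub_zero]
    have hlast : c⁻¹ • (c • (Q * (w * Q)) * x * (a * y) * x * E) =
        Q * w * (x * a * (y * x * E)) := by
      simp only [smul_mul_assoc]
      rw [smul_smul, inv_mul_cancel₀ hc, one_smul]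
      calc Q * (w * Q) * x * (a * y) * x * E = Q * w * (Q * x) * a * (y * x * E) := by
            simp only [mul_assoc]
        _ = Q * w * x * (Q * a) * (y * x * E) := by rw [← cQx]; simp only [mul_assoc]
        _ = Q * w * x * a * (Q * (y * x * E)) := by rw [← cQa]; simp only [mul_assoc]
        _ = _ := by rw [← key]; simp only [mul_assoc]
    rw [hfirst, hlast, sub_add_cancel]

/-- The products of `E_1, E_2, E_3`, and the left half of the recursion step. -/
theorem step_left {u : ℕ → A} [CharZero k] {N : ℕ} (h : Relations u N) (j : ℕ)
    (hN : 2 * j + 2 < N) (hj : IsProj k u j) (hj' : ∀ i, i < j → IsProj k u i) :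
    let e := jw k u j
    let E1 := e₁ u (2 * j + 1) e
    let E2 := e₂ u (2 * j + 1) e
    let E3 := e₃ u (2 * j + 1) e
    E1 * E1 = E1 ∧ E1 * E2 = 0 ∧ E2 * E1 = 0 ∧ E1 * E3 = 0 ∧ E3 * E1 = 0 ∧
      E3 * E3 = ptr k j • E3 ∧ E2 * E2 = E2 ∧ E2 * E3 = 0 ∧ E3 * E2 = 0 ∧
      ∀ i, i ≤ 2 * (j + 1) → u i * jw k u (j + 1) = 0 := by
  obtain ⟨P, Q, hxEx, hPx, hPy, hEP, hPE, haPa, hEQ, hQx, hx⟩ := exists_partial h j hN hj hj'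
  have hsucc : jw k u (j + 1) = jw k u j - e₁ u (2 * j + 1) (jw k u j) -
    e₂ u (2 * j + 1) (jw k u j) - (ptr k j)⁻¹ • e₃ u (2 * j + 1) (jw k u j) := rfl
  have hx0 := hj.left
  have hEE := hj.idem
  have haE := hj.left (2 * j) le_rfl
  have hEa := hj.right (2 * j) le_rfl
  have hEy := (jw_commute (k := k) h j (2 * j + 2) le_rfl).eq
  have hyy := h.sq (2 * j + 2)
  have hyxy := h.down (2 * j + 1) (by omega) hN
  have hay := h.comm (2 * j) (2 * j + 2) le_rfl
  simp only [e₁, e₂, e₃, Nat.add_sub_cancel, show 2 * j + 1 + 1 = 2 * j + 2 by ring] at hsucc ⊢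
  set E := jw k u j
  replace hPx := hPx.eq
  replace hPy := hPy.eq
  replace hQx := hQx.eq
  set x := u (2 * j + 1)
  set a := u (2 * j)
  set y := u (2 * j + 2)
  -- products with a copy of `E` in the middle
  have yExy : y * (E * (x * y)) = y * E := by
    rw [← mul_assoc, hEy, mul_assoc, hyxy, ← hEy]
  have yEy : y * (E * y) = 0 := by rw [← hEy, ← mul_assoc, hyy, zero_mul]
  have yxEy : y * (x * (E * y)) = y * E := by
    rw [← hEy, ← mul_assoc x, ← mul_assoc, hyxy]
  have yxExy : y * (x * (E * (x * y))) = P * y := by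
    rw [← mul_assoc E, ← mul_assoc x, ← mul_assoc x, hxEx, ← mul_assoc, ← mul_assoc, ← hPy,
      mul_assoc, mul_assoc, hyxy]
  have yExay : y * (E * (x * (a * y))) = 0 := by
    rw [hay, ← mul_assoc x, ← mul_assoc E, ← mul_assoc, yExy, mul_assoc, hEa, mul_zero]
  have yxExay : y * (x * (E * (x * (a * y)))) = P * (y * a) := by
    rw [hay, ← mul_assoc x y, ← mul_assoc E, ← mul_assoc x, ← mul_assoc, yxExy, mul_assoc]
  have ayE : a * (y * E) = 0 := by rw [← mul_assoc, hay, mul_assoc, haE, mul_zero]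
  have PyE : P * (y * E) = 0 := by rw [hEy, ← mul_assoc, hPE, zero_mul]
  have ayxExay : a * (y * (x * (E * (x * (a * y))))) = ptr k j • (Q * (a * y)) := by
    rw [yxExay, ← hay, ← mul_assoc P, ← mul_assoc, ← mul_assoc, haPa, smul_mul_assoc, mul_assoc]
  have ExQ : E * (x * Q) = E * x := by rw [← hQx, ← mul_assoc, hEQ]
  have EyE : E * (y * E) = E * y := by rw [hEy, ← mul_assoc, hEE]
  -- All words are kept right-associated; these helpers let a rule for a word act at the start of a
  -- longer one.
  have assoc₃ : ∀ {p q r s : A}, p * (q * r) = s → ∀ Z, p * (q * (r * Z)) = s * Z :=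
    fun h Z => by rw [← h]; simp only [mul_assoc]
  have assoc₄ : ∀ {p q r s t : A}, p * (q * (r * s)) = t → ∀ Z,
      p * (q * (r * (s * Z))) = t * Z := fun h Z => by rw [← h]; simp only [mul_assoc]
  have assoc₅ : ∀ {p q r s t z : A}, p * (q * (r * (s * t))) = z → ∀ Z,
      p * (q * (r * (s * (t * Z)))) = z * Z := fun h Z => by rw [← h]; simp only [mul_assoc]
  have assoc₆ : ∀ {p q r s t z z' : A}, p * (q * (r * (s * (t * z)))) = z' → ∀ Z,
      p * (q * (r * (s * (t * (z * Z))))) = z' * Z := fun h Z => by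
    rw [← h]; simp only [mul_assoc]
  have assoc₇ : ∀ {p q r s t z z' w : A}, p * (q * (r * (s * (t * (z * z'))))) = w → ∀ Z,
      p * (q * (r * (s * (t * (z * (z' * Z)))))) = w * Z := fun h Z => by
    rw [← h]; simp only [mul_assoc]
  have hEE' := mul_assoc_of_eq hEE
  refine ⟨?_, ?_, ?_, ?_, ?_, ?_, ?_, ?_, ?_, ?_⟩
  · simp only [mul_assoc, hEE', assoc₄ yExy, hEE]
  · simp only [mul_assoc, hEE', assoc₃ yEy, zero_mul, mul_zero]
  · simp only [mul_assoc, hEE', assoc₅ yxExy, PyE, mul_zero]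
  · simp only [mul_assoc, hEE', assoc₅ yExay, zero_mul, mul_zero]
  · simp only [mul_assoc, hEE', assoc₅ yxExy, PyE, mul_zero]
  · simp only [mul_assoc, hEE', assoc₇ ayxExay, smul_mul_assoc, mul_smul_comm, assoc₃ ExQ]
  · simp only [mul_assoc, hEE', assoc₄ yxEy, assoc₃ EyE]
  · simp only [mul_assoc, hEE', assoc₆ yxExay, mul_assoc_of_eq hEP, zero_mul]
  · simp only [mul_assoc, hEE', assoc₄ yxEy, assoc₃ ayE, zero_mul, mul_zero]
  -- Small generators are killed by the leading `E`. For `x` one has `x * E1 = 0`, and `hx` says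
  -- that the other terms cancel. For `y` one has `y * E1 = y * E`, while `y` kills E_2 and E_3.
  · intro i hi
    rw [hsucc]
    rcases (by omega : i ≤ 2 * j ∨ i = 2 * j + 1 ∨ i = 2 * j + 2) with hi | rfl | rfl
    · simp only [mul_sub, mul_smul_comm, mul_assoc, mul_assoc_of_eq (hx0 i hi), hx0 i hi, zero_mul,
        smul_zero, sub_zero]
    · have h1 : x * (E * (x * y) * E) = 0 := by
        simp only [mul_assoc]
        rw [assoc₃ ((mul_assoc x E x).symm.trans hxEx), hPx, mul_assoc, PyE, mul_zero]
      have h3 : x * (E * (x * (a * y) * x) * E) = P * x * (a * y) * x * E := by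
        rw [← hxEx]; simp only [mul_assoc]
      change x * (E - E * (x * y) * E - E * (y * x) * E -
        (ptr k j)⁻¹ • (E * (x * (a * y) * x) * E)) = 0
      rw [mul_sub, mul_sub, mul_sub, h1, mul_smul_comm, h3, ← hx]
      simp only [mul_assoc, sub_zero]
      abel
    · change y * (E - E * (x * y) * E - E * (y * x) * E -
        (ptr k j)⁻¹ • (E * (x * (a * y) * x) * E)) = 0
      simp only [mul_sub, mul_smul_comm, mul_assoc, assoc₄ yExy, assoc₃ yEy, assoc₅ yExay, hEE,
        zero_mul, smul_zero, sub_self]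

/-- The complement of orthogonal idempotents below an idempotent. -/
theorem orthogonal_sub {E a b c : A} (hE : E * E = E) (ha : E * a = a ∧ a * E = a)
    (hb : E * b = b ∧ b * E = b) (hc : E * c = c ∧ c * E = c) (haa : a * a = a) (hbb : b * b = b)
    (hcc : c * c = c) (hab : a * b = 0 ∧ b * a = 0) (hac : a * c = 0 ∧ c * a = 0)
    (hbc : b * c = 0 ∧ c * b = 0) :
    (E - a - b - c) * (E - a - b - c) = E - a - b - c ∧
      ((E - a - b - c) * a = 0 ∧ a * (E - a - b - c) = 0) ∧
      ((E - a - b - c) * b = 0 ∧ b * (E - a - b - c) = 0) ∧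
      ((E - a - b - c) * c = 0 ∧ c * (E - a - b - c) = 0) := by
  simp [mul_sub, sub_mul, hE, ha, hb, hc, haa, hbb, hcc, hab, hac, hbc]

/-- The idempotents in the recursion for the projectors. -/
theorem orthogonal_of_step {u : ℕ → A} [CharZero k] {N : ℕ} (h : Relations u N) (j : ℕ)
    (hN : 2 * j + 2 < N) (hj : IsProj k u j) (hj' : ∀ i, i < j → IsProj k u i) :
    let e := jw k u j
    let a := e₁ u (2 * j + 1) e
    let b := e₂ u (2 * j + 1) e
    let c := (ptr k j)⁻¹ • e₃ u (2 * j + 1) e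
    let J := jw k u (j + 1)
    (a * a = a ∧ b * b = b ∧ c * c = c ∧ J * J = J) ∧ (a * b = 0 ∧ b * a = 0) ∧
      (a * c = 0 ∧ c * a = 0) ∧ (b * c = 0 ∧ c * b = 0) ∧
      (J * a = 0 ∧ a * J = 0) ∧ (J * b = 0 ∧ b * J = 0) ∧ (J * c = 0 ∧ c * J = 0) := by
  intro e a b c J
  obtain ⟨h11, h12, h21, h13, h31, h33, h22, h23, h32, -⟩ := step_left h j hN hj hj'
  have hEE := hj.idem
  have hEE' := mul_assoc_of_eq hEE
  have hc : c * c = c := by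
    simp only [c, e, smul_mul_assoc, mul_smul_comm, h33, smul_smul]
    congr 1
    -- This happens at `j = 0`, where both coefficients are 0.
    by_cases h0 : ptr k j = 0
    · simp [h0]
    · field_simp
  have hac : a * c = 0 ∧ c * a = 0 := by
    simp only [a, c, e, smul_mul_assoc, mul_smul_comm, h13, h31, smul_zero, and_self]
  have hbc : b * c = 0 ∧ c * b = 0 := by
    simp only [b, c, e, smul_mul_assoc, mul_smul_comm, h23, h32, smul_zero, and_self]
  have hx : ∀ z : A, e * (e * z * e) = e * z * e ∧ (e * z * e) * e = e * z * e := fun z => by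
    constructor
    · simp only [e, mul_assoc, hEE']
    · simp only [e, mul_assoc, hEE]
  have hxc : e * c = c ∧ c * e = c := by
    rw [mul_smul_comm, smul_mul_assoc]
    exact ⟨congrArg _ (hx _).1, congrArg _ (hx _).2⟩
  obtain ⟨k1, k2, k3, k4⟩ :=
    orthogonal_sub hEE (hx _) (hx _) hxc h11 h22 hc ⟨h12, h21⟩ hac hbc
  exact ⟨⟨h11, h22, hc, k1⟩, ⟨h12, h21⟩, hac, hbc, k2, k3, k4⟩

/-- Strong induction, since a step also uses earlier projectors through `exists_partial`.
Annihilation from the right is `step_left` in the opposite ring. -/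
theorem isProj [CharZero k] {u : ℕ → A} {N : ℕ} (h : Relations u N) (j : ℕ) (hN : 2 * j < N) :
    IsProj k u j := by
  induction j using Nat.strong_induction_on with
  | _ j ih =>
  rcases j with _ | j
  · refine ⟨by simp [jw], ?_, ?_⟩ <;> intro i hi <;> obtain rfl : i = 0 := by omega
    · rw [h.zero, zero_mul]
    · rw [h.zero, mul_zero]
  have hj := ih j (by omega) (by omega)
  have hj' : ∀ i, i < j → IsProj k u i := fun i hi => ih i (by omega) (by omega)
  obtain ⟨-, -, -, -, -, -, -, -, -, hl⟩ := step_left h j (by omega) hj hj'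
  obtain ⟨-, -, -, -, -, -, -, -, -, hr⟩ :=
    step_left h.op j (by omega) (hj.op h) fun i hi => (hj' i hi).op h
  refine ⟨(orthogonal_of_step h j (by omega) hj hj').1.2.2.2, hl, fun i hi => ?_⟩
  have := hr i hi
  rw [jw_op h, ← MulOpposite.op_mul] at this
  exact MulOpposite.op_injective this

theorem orthogonal [CharZero k] {u : ℕ → A} {N : ℕ} (h : Relations u N) (j : ℕ)
    (hN : 2 * j + 2 < N) :
    let e := jw k u j
    let a := e₁ u (2 * j + 1) e
    let b := e₂ u (2 * j + 1) e
    let c := (ptr k j)⁻¹ • e₃ u (2 * j + 1) e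
    let J := jw k u (j + 1)
    (a * a = a ∧ b * b = b ∧ c * c = c ∧ J * J = J) ∧ (a * b = 0 ∧ b * a = 0) ∧
      (a * c = 0 ∧ c * a = 0) ∧ (b * c = 0 ∧ c * b = 0) ∧
      (J * a = 0 ∧ a * J = 0) ∧ (J * b = 0 ∧ b * J = 0) ∧ (J * c = 0 ∧ c * J = 0) :=
  orthogonal_of_step h j hN (isProj h j (by omega)) fun i _ => isProj h i (by omega)

end Recursion

/-! ### Cup and cap ideals, uniqueness of the projector -/

section Projectors

variable {R : Type*} [CommRing R] {n : ℕ}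

/-- The diagram `D` has a cup whose endpoints are among the first `m` top points. -/
def HasCup (m : ℕ) (D : Diagram n) : Prop :=
  ∃ i j : Fin n, i.val < m ∧ j.val < m ∧ D.partner (Sum.inr i) = Sum.inr j

/-- Without cups every strand from the top ends at the bottom; non-crossing makes this map strictly
increasing on `Fin n`, hence the identity. -/
theorem hasCup_of_ne_identity {D : Diagram n} (hD : D ≠ Diagram.identity n) : HasCup n D := by
  by_contra hc
  have h1 : ∀ i, ∃ j, D.partner (Sum.inr i) = Sum.inl j := by
    intro i
    rcases h : D.partner (Sum.inr i) with j | j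
    · exact ⟨j, rfl⟩
    · exact absurd ⟨i, j, i.2, j.2, h⟩ hc
  choose g hg using h1
  have hg' : ∀ i, D.partner (Sum.inl (g i)) = Sum.inr i := fun i => (D.partner_eq_iff _ _).1 (hg i)
  have hinj : Function.Injective g := fun i j hij => by
    have := hg' i
    rw [hij, hg' j] at this
    simpa using this.symm
  have hmono : StrictMono g := by
    intro i j hij
    by_contra hle
    have hlt : g j < g i := lt_of_le_of_ne (not_lt.1 hle) fun h => hij.ne (hinj h).symm
    refine D.crossingless (Sum.inl (g j)) (Sum.inl (g i)) ?_
    rw [hg', hg']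
    simp only [pos]
    have := (g i).2
    have := i.2
    have := j.2
    rw [Fin.lt_def] at hij hlt
    omega
  have hid : g = id := by
    refine (hmono.range_inj strictMono_id).1 ?_
    rw [(Finite.surjective_of_injective hinj).range_eq, Set.range_id]
  subst hid
  apply hD
  ext x : 2
  rcases x with x | x
  · exact hg' x
  · exact hg x

/-- Descent on the width of a cup: the top point next to `i` is enclosed by the cup, so by
non-crossing its strand is a narrower cup. -/
theorem exists_innermost_cup (D : Diagram n) (d : ℕ) : ∀ i j : Fin n, i.val < j.val →
    j.val - i.val ≤ d → D.partner (Sum.inr i) = Sum.inr j →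
    ∃ (l : ℕ) (h : l + 1 < n), D.partner (Sum.inr ⟨l, by omega⟩) = Sum.inr ⟨l + 1, h⟩ := by
  induction d with
  | zero => intro i j h1 h2; omega
  | succ d ih =>
    intro i j h1 h2 h
    have hj := j.2
    by_cases hij : j.val = i.val + 1
    · refine ⟨i, by omega, h.trans ?_⟩
      congr 1
      exact Fin.ext hij
    have h' := (D.partner_eq_iff _ _).1 h
    have c1 := D.crossingless (Sum.inr j) (Sum.inr ⟨i + 1, by omega⟩)
    have c2 := D.crossingless (D.partner (Sum.inr ⟨i + 1, by omega⟩)) (Sum.inr j)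
    rw [h'] at c1 c2
    rw [D.partner_partner] at c2
    have n1 : D.partner (Sum.inr ⟨i + 1, by omega⟩) ≠ Sum.inr i := fun h3 => by
      have := (D.partner_eq_iff _ _).1 h3
      rw [h] at this
      simp only [Sum.inr.injEq, Fin.ext_iff] at this
      omega
    have n2 : D.partner (Sum.inr ⟨i + 1, by omega⟩) ≠ Sum.inr j := fun h3 => by
      have := (D.partner_eq_iff _ _).1 h3
      rw [h'] at this
      simp only [Sum.inr.injEq, Fin.ext_iff] at this
      omega
    have n3 := D.partner_ne (Sum.inr ⟨i + 1, by omega⟩)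
    rcases hp : D.partner (Sum.inr ⟨i + 1, by omega⟩) with l | l
    · rw [hp] at c2
      simp only [pos] at c2
      omega
    · rw [hp] at c1 c2 n1 n2 n3
      simp only [pos] at c1 c2
      simp only [ne_eq, Sum.inr.injEq, Fin.ext_iff] at n1 n2 n3
      have := l.2
      have := i.2
      exact ih ⟨i + 1, by omega⟩ l (by simp only; omega) (by simp only; omega) hp

theorem HasCup.exists_innermost {m : ℕ} {D : Diagram n} (hD : HasCup m D) :
    ∃ (l : ℕ) (h : l + 1 < n), D.partner (Sum.inr ⟨l, by omega⟩) = Sum.inr ⟨l + 1, h⟩ := by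
  obtain ⟨i, j, -, -, h⟩ := hD
  have hne : i ≠ j := fun hij => D.partner_ne _ (hij ▸ h)
  rcases lt_or_gt_of_ne hne with hij | hij
  · exact exists_innermost_cup D _ i j hij le_rfl h
  · exact exists_innermost_cup D _ j i hij le_rfl ((D.partner_eq_iff _ _).1 h)

/-- The span of the diagrams with a cup among the first `m` top points. -/
def cupIdeal (R : Type*) [CommRing R] (n m : ℕ) : Submodule R (TL R (0 : R) n) :=
  Submodule.span R (ofDiagram '' {D | HasCup m D})

/-- The span of the diagrams with a cap among the first `m` bottom points. -/
def capIdeal (R : Type*) [CommRing R] (n m : ℕ) : Submodule R (TL R (0 : R) n) :=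
  (cupIdeal R n m).comap (flipHom R n)

theorem ofDiagram_mem_cupIdeal {m : ℕ} {D : Diagram n} (h : HasCup m D) :
    ofDiagram D ∈ cupIdeal R n m := Submodule.subset_span ⟨D, h, rfl⟩

theorem cupIdeal_mono {m m' : ℕ} (h : m ≤ m') : cupIdeal R n m ≤ cupIdeal R n m' := by
  refine Submodule.span_mono (Set.image_mono ?_)
  rintro D ⟨i, j, hi, hj, hD⟩
  exact ⟨i, j, by omega, by omega, hD⟩

/-- Cups of the upper diagram survive in every stack. -/
theorem mul_mem_cupIdeal {m : ℕ} {X : TL R (0 : R) n} (hX : X ∈ cupIdeal R n m)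
    (Y : TL R (0 : R) n) : X * Y ∈ cupIdeal R n m := by
  induction hX using Submodule.span_induction with
  | zero => rw [zero_mul]; exact zero_mem _
  | add X X' _ _ h h' => rw [add_mul]; exact add_mem h h'
  | smul c X _ h => rw [smul_mul_assoc]; exact Submodule.smul_mem _ _ h
  | mem X hX =>
    obtain ⟨D, hD, rfl⟩ := hX
    induction Y using TL.induction with
    | h0 => rw [mul_zero]; exact zero_mem _
    | hadd Y Y' h h' => rw [mul_add]; exact add_mem h h'
    | h c E =>
      rw [mul_smul_comm, ofDiagram_mul_ofDiagram]
      refine Submodule.smul_mem _ _ ?_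
      rcases stack_cases (R := R) D E with ⟨F, hF, h⟩ | ⟨-, h⟩ <;> rw [h]
      · obtain ⟨i, j, hi, hj, hij⟩ := hD
        exact ofDiagram_mem_cupIdeal ⟨i, j, hi, hj, hF.cup hij⟩
      · exact zero_mem _

theorem mul_mem_capIdeal {m : ℕ} (X : TL R (0 : R) n) {Y : TL R (0 : R) n}
    (hY : Y ∈ capIdeal R n m) : X * Y ∈ capIdeal R n m := by
  rw [capIdeal, Submodule.mem_comap, flipHom_mul]
  exact mul_mem_cupIdeal hY _

theorem U_mem_cupIdeal {m i : ℕ} (h : i < m) : U R 0 n i ∈ cupIdeal R n m := by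
  rcases i with _ | i
  · rw [U_zero]; exact zero_mem _
  by_cases hi : i + 1 < n
  · rw [U_succ hi]
    exact ofDiagram_mem_cupIdeal ⟨_, _, by simp only; omega, h, cupCap_inr_left i hi⟩
  · rw [U_eq_zero (by omega)]; exact zero_mem _

theorem U_mem_capIdeal {m i : ℕ} (h : i < m) : U R 0 n i ∈ capIdeal R n m := by
  rw [capIdeal, Submodule.mem_comap, flipHom_U]
  exact U_mem_cupIdeal h

/-- The coefficient of a diagram, as a linear map. -/
def coeffHom (R : Type*) [CommRing R] {n : ℕ} (D : Diagram n) : TL R (0 : R) n →ₗ[R] R :=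
  Finsupp.lapply D

theorem coeffHom_apply (D : Diagram n) (X : TL R (0 : R) n) : coeffHom R D X = coeff X D := rfl

theorem coeff_ofDiagram_self (D : Diagram n) : coeff (ofDiagram D : TL R (0 : R) n) D = 1 := by
  rw [coeff, ofDiagram]
  exact Finsupp.single_eq_same

theorem coeff_ofDiagram_of_ne {D E : Diagram n} (h : D ≠ E) :
    coeff (ofDiagram D : TL R (0 : R) n) E = 0 := by
  rw [coeff, ofDiagram]
  exact Finsupp.single_eq_of_ne h.symm

theorem coeff_add (X Y : TL R (0 : R) n) (D : Diagram n) :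
    coeff (X + Y) D = coeff X D + coeff Y D := map_add (coeffHom R D) X Y

theorem coeff_smul (c : R) (X : TL R (0 : R) n) (D : Diagram n) :
    coeff (c • X) D = c * coeff X D := map_smul (coeffHom R D) c X

theorem sub_coeff_mem_cupIdeal (X : TL R (0 : R) n) :
    X - coeff X (Diagram.identity n) • 1 ∈ cupIdeal R n n := by
  induction X using TL.induction with
  | h0 =>
    rw [← coeffHom_apply, map_zero, zero_smul, sub_zero]; exact zero_mem _
  | hadd X Y hX hY =>
    rw [coeff_add, add_smul, add_sub_add_comm]
    exact add_mem hX hY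
  | h c D =>
    rw [coeff_smul, mul_smul, ← smul_sub]
    refine Submodule.smul_mem _ _ ?_
    by_cases hD : D = Diagram.identity n
    · subst hD
      rw [coeff_ofDiagram_self, one_smul, one_eq, sub_self]
      exact zero_mem _
    · rw [coeff_ofDiagram_of_ne hD, zero_smul, sub_zero]
      exact ofDiagram_mem_cupIdeal (hasCup_of_ne_identity hD)

theorem sub_coeff_mem_capIdeal (X : TL R (0 : R) n) :
    X - coeff X (Diagram.identity n) • 1 ∈ capIdeal R n n := by
  have h1 : coeff X (Diagram.identity n) = coeff (flipHom R n X) (Diagram.identity n) := by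
    have : coeffHom R (Diagram.identity n) =
        coeffHom R (Diagram.identity n) ∘ₗ flipHom R n := TL.linearMap_ext fun D => by
      rw [LinearMap.comp_apply, flipHom_ofDiagram, coeffHom_apply, coeffHom_apply]
      by_cases hD : D = Diagram.identity n
      · rw [hD, Diagram.flip_identity]
      · rw [coeff_ofDiagram_of_ne hD, coeff_ofDiagram_of_ne]
        intro h
        rw [← Diagram.flip_identity] at h
        exact hD (by rw [← D.flip_flip, h, Diagram.flip_flip])
    exact LinearMap.congr_fun this X
  rw [capIdeal, Submodule.mem_comap, map_sub, map_smul, h1]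
  have : flipHom R n 1 = 1 := by rw [one_eq, flipHom_ofDiagram, Diagram.flip_identity]
  rw [this]
  exact sub_coeff_mem_cupIdeal _

theorem coeff_identity_of_mem_cupIdeal {m : ℕ} {X : TL R (0 : R) n} (hX : X ∈ cupIdeal R n m) :
    coeff X (Diagram.identity n) = 0 := by
  rw [← coeffHom_apply]
  induction hX using Submodule.span_induction with
  | zero => exact map_zero _
  | add X X' _ _ h h' => rw [map_add, h, h', add_zero]
  | smul c X _ h => rw [map_smul, h, smul_zero]
  | mem X hX =>
    obtain ⟨D, ⟨i, j, -, -, hij⟩, rfl⟩ := hX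
    refine coeff_ofDiagram_of_ne ?_
    rintro rfl
    simp [Diagram.identity] at hij

theorem coeff_identity_of_mem_capIdeal {m : ℕ} {X : TL R (0 : R) n} (hX : X ∈ capIdeal R n m) :
    coeff X (Diagram.identity n) = 0 := by
  rw [← coeffHom_apply, ← flipHom_flipHom X]
  rw [capIdeal, Submodule.mem_comap] at hX
  generalize flipHom R n X = X at hX ⊢
  induction hX using Submodule.span_induction with
  | zero => rw [map_zero, map_zero]
  | add X X' _ _ h h' => rw [map_add, map_add, h, h', add_zero]
  | smul c X _ h => rw [map_smul, map_smul, h, smul_zero]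
  | mem X hX =>
    obtain ⟨D, ⟨i, j, -, -, hij⟩, rfl⟩ := hX
    rw [flipHom_ofDiagram]
    refine coeff_ofDiagram_of_ne ?_
    intro h
    rw [← Diagram.flip_identity] at h
    rw [← D.flip_flip, h, Diagram.flip_flip] at hij
    simp [Diagram.identity] at hij

/-- A diagram with a cup factors through some `U_i`. -/
theorem HasCup.exists_eq_U_mul (hn : 3 ≤ n) {m : ℕ} {D : Diagram n} (hD : HasCup m D) :
    ∃ i, 1 ≤ i ∧ i < n ∧ ∃ X, ofDiagram D = U R 0 n i * X := by
  obtain ⟨l, h, hl⟩ := hD.exists_innermost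
  -- The cup is moved to the right and back, or to the left at the end of the strip; this requires a
  -- third strand.
  by_cases h2 : l + 2 < n
  · exact ⟨l + 1, by omega, by omega, _, (cup_absorb_right h2 D hl).symm⟩
  · obtain ⟨l, rfl⟩ := Nat.exists_eq_add_of_le' (show 1 ≤ l by omega)
    exact ⟨l + 2, by omega, by omega, _, (cup_absorb_left (by omega) D hl).symm⟩

theorem mul_eq_zero_of_mem_cupIdeal (hn : 3 ≤ n) {m : ℕ} {X Y : TL R (0 : R) n}
    (hX : X ∈ cupIdeal R n m) (hY : ∀ i, 1 ≤ i → i < n → Y * U R 0 n i = 0) : Y * X = 0 := by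
  induction hX using Submodule.span_induction with
  | zero => rw [mul_zero]
  | add X X' _ _ h h' => rw [mul_add, h, h', add_zero]
  | smul c X _ h => rw [mul_smul_comm, h, smul_zero]
  | mem X hX =>
    obtain ⟨D, hD, rfl⟩ := hX
    obtain ⟨i, h1, h2, Z, hZ⟩ := hD.exists_eq_U_mul (R := R) hn
    rw [hZ, ← mul_assoc, hY i h1 h2, zero_mul]

theorem mul_eq_zero_of_mem_capIdeal (hn : 3 ≤ n) {m : ℕ} {X Y : TL R (0 : R) n}
    (hX : X ∈ capIdeal R n m) (hY : ∀ i, 1 ≤ i → i < n → U R 0 n i * Y = 0) : X * Y = 0 := by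
  rw [← flipHom_flipHom (X * Y), flipHom_mul, mul_eq_zero_of_mem_cupIdeal hn hX, map_zero]
  intro i h1 h2
  rw [← flipHom_U, ← flipHom_mul, hY i h1 h2, map_zero]

/-- A Jones-Wenzl projector is unique. -/
theorem IsJonesWenzl.unique (hn : n = 1 ∨ 3 ≤ n) {X Y : TL R (0 : R) n} (hX : IsJonesWenzl X)
    (hY : IsJonesWenzl Y) : X = Y := by
  rcases hn with rfl | hn
  · have : ∀ X : TL R (0 : R) 1, IsJonesWenzl X → X = 1 := by
      intro X hX
      have hc := sub_coeff_mem_cupIdeal X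
      rw [hX.1, one_smul] at hc
      have hbot : cupIdeal R 1 1 = ⊥ := by
        rw [cupIdeal, Submodule.span_eq_bot]
        rintro _ ⟨D, hD, rfl⟩
        obtain ⟨l, h, -⟩ := hD.exists_innermost
        omega
      rw [hbot, Submodule.mem_bot, sub_eq_zero] at hc
      exact hc
    rw [this X hX, this Y hY]
  -- `X` is 1 modulo caps, and these vanish on `Y`; below, `Y` is 1 modulo cups, and these are
  -- killed by `X`.
  · have h1 : X * Y = Y := by
      have := mul_eq_zero_of_mem_capIdeal hn (sub_coeff_mem_capIdeal X)
        fun i h1 h2 => (hY.2 i h1 h2).1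
      rwa [hX.1, one_smul, sub_mul, one_mul, sub_eq_zero] at this
    have h2 : X * Y = X := by
      have := mul_eq_zero_of_mem_cupIdeal hn (sub_coeff_mem_cupIdeal Y)
        fun i h1 h2 => (hX.2 i h1 h2).2
      rwa [hY.1, one_smul, mul_sub, mul_one, sub_eq_zero] at this
    rw [← h2, h1]

/-! ### The words of the recursion as Jones-Wenzl projectors -/

section Projector
variable {k : Type*} [Field k]

theorem flipHom_jw (n j : ℕ) : flipHom k n (jw k (U k 0 n) j) = jw k (U k 0 n) j := by
  induction j with
  | zero =>
    change flipHom k n 1 = 1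
    rw [one_eq, flipHom_ofDiagram, Diagram.flip_identity]
  | succ j ih =>
    have hc := (relations_U k n).comm (2 * j) (2 * j + 1 + 1) (by omega)
    simp only [jw, e₁, e₂, e₃, map_sub, map_smul, flipHom_mul, flipHom_U, ih, mul_assoc,
      Nat.add_sub_cancel]
    rw [← mul_assoc (U k 0 n (2 * j + 1 + 1)) (U k 0 n (2 * j)), ← hc, mul_assoc]
    abel

/-- The point is the bound `2 * j + 1`, independent of `n`: the cups avoid the strands added on the
right, so they survive when those are closed. In the induction `e * U_i * Z` is split as `(e - 1) *
U_i * Z + U_i * Z`. -/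
theorem jw_sub_one_mem_cupIdeal (n j : ℕ) :
    jw k (U k 0 n) j - 1 ∈ cupIdeal k n (2 * j + 1) := by
  induction j with
  | zero => simp [jw]
  | succ j ih =>
    have ih' := cupIdeal_mono (show 2 * j + 1 ≤ 2 * (j + 1) + 1 by omega) ih
    have key : ∀ i (Z : TL k (0 : k) n), i < 2 * (j + 1) + 1 →
        jw k (U k 0 n) j * (U k 0 n i * Z) ∈ cupIdeal k n (2 * (j + 1) + 1) := by
      intro i Z hi
      have := add_mem (mul_mem_cupIdeal ih' (U k 0 n i * Z))
        (mul_mem_cupIdeal (U_mem_cupIdeal (R := k) (n := n) hi) Z)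
      rwa [sub_mul, one_mul, sub_add_cancel] at this
    have hrw : jw k (U k 0 n) (j + 1) - 1 = (jw k (U k 0 n) j - 1) -
        e₁ (U k 0 n) (2 * j + 1) (jw k (U k 0 n) j) - e₂ (U k 0 n) (2 * j + 1) (jw k (U k 0 n) j) -
        (ptr k j)⁻¹ • e₃ (U k 0 n) (2 * j + 1) (jw k (U k 0 n) j) := by
      rw [jw]; abel
    rw [hrw]
    simp only [e₁, e₂, e₃, mul_assoc]
    exact sub_mem (sub_mem (sub_mem ih' (key _ _ (by omega))) (key _ _ (by omega)))
      (Submodule.smul_mem _ _ (key _ _ (by omega)))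

theorem jw_sub_one_mem_capIdeal (n j : ℕ) :
    jw k (U k 0 n) j - 1 ∈ capIdeal k n (2 * j + 1) := by
  rw [capIdeal, Submodule.mem_comap, map_sub, flipHom_jw]
  have : flipHom k n 1 = 1 := by rw [one_eq, flipHom_ofDiagram, Diagram.flip_identity]
  rw [this]
  exact jw_sub_one_mem_cupIdeal n j

theorem isJonesWenzl_jw [CharZero k] (j : ℕ) :
    IsJonesWenzl (jw k (U k 0 (2 * j + 1)) j) := by
  have h := isProj (k := k) (relations_U k (2 * j + 1)) j (by omega)
  refine ⟨?_, fun i _ hi => ⟨h.left i (by omega), h.right i (by omega)⟩⟩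
  have := coeff_identity_of_mem_cupIdeal (jw_sub_one_mem_cupIdeal (k := k) (2 * j + 1) j)
  rw [← coeffHom_apply, map_sub, coeffHom_apply, coeffHom_apply, one_eq, coeff_ofDiagram_self,
    sub_eq_zero] at this
  exact this

theorem JW_eq [CharZero k] (j : ℕ) : JW k 0 (2 * j + 1) = jw k (U k 0 (2 * j + 1)) j := by
  have hex : ∃ X : TL k 0 (2 * j + 1), IsJonesWenzl X := ⟨_, isJonesWenzl_jw j⟩
  rw [JW, dif_pos hex]
  exact IsJonesWenzl.unique (by omega) hex.choose_spec (isJonesWenzl_jw j)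

theorem jw_mem_genAlg (n j : ℕ) : jw k (U k 0 n) j ∈ genAlg k n := by
  induction j with
  | zero => exact one_mem _
  | succ j ih =>
    have hU := U_mem_genAlg (R := k) (n := n)
    exact sub_mem (sub_mem (sub_mem ih
      (mul_mem (mul_mem ih (mul_mem (hU _) (hU _))) ih))
      (mul_mem (mul_mem ih (mul_mem (hU _) (hU _))) ih))
      (Subalgebra.smul_mem _ (mul_mem (mul_mem ih
        (mul_mem (mul_mem (hU _) (mul_mem (hU _) (hU _))) (hU _))) ih) _)

/-- Makes E_0 the same word in a larger Temperley-Lieb algebra, so that the abstract recursion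
applies inside one ring. -/
theorem strand_jw {n j : ℕ} (h : 2 * j < n) :
    strand (jw k (U k 0 n) j) = jw k (U k 0 (n + 1)) j := by
  induction j with
  | zero => exact strand_one
  | succ j ih =>
    have hU := U_mem_genAlg (R := k) (n := n)
    have hj := jw_mem_genAlg (k := k) n j
    simp only [jw, e₁, e₂, e₃, map_sub, map_smul, mul_assoc, strand_mul hj, strand_mul (hU _)]
    rw [ih (by omega), strand_U (by omega), strand_U (by omega), strand_U (by omega)]

theorem E₀_eq [CharZero k] (j : ℕ) : E₀ k 0 (2 * j + 1) = jw k (U k 0 (2 * j + 3)) j := by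
  rw [E₀, JW_eq, strand_jw (by omega), strand_jw (by omega)]

end Projector

end Projectors

/-! ### Partial traces and the numbers p_1, p_2 -/

section Traces

variable {R : Type*} [CommRing R] {n : ℕ}

/-- The edges of the picture of `D` with its last strand closed. -/
def closeRel (D : Diagram (n + 1)) (v w : Pt (n + 1)) : Prop :=
  w = D.partner v ∨ (v = Sum.inl (Fin.last n) ∧ w = Sum.inr (Fin.last n))

theorem partialTrace_ofDiagram (D : Diagram (n + 1)) :
    partialTrace (ofDiagram D : TL R (0 : R) (n + 1)) =
      evalGraph 0 (SimpleGraph.fromRel (closeRel D)) Pt.castSucc := by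
  rw [partialTrace, ofDiagram]
  exact (Finsupp.linearCombination_single R (1 : R) D).trans (one_smul _ _)

theorem castSucc_injective : Function.Injective (Pt.castSucc : Pt n → Pt (n + 1)) :=
  Sum.map_injective.2 ⟨Fin.castSucc_injective n, Fin.castSucc_injective n⟩

/-- Planarity of the closed picture is not needed: if no diagram is seen, the value is 0, which lies
in every ideal considered. -/
theorem partialTrace_cases (D : Diagram (n + 1)) :
    (∃ F : Diagram n, Sees (closeRel D) Pt.castSucc F.partner ∧
      partialTrace (ofDiagram D : TL R (0 : R) (n + 1)) = ofDiagram F) ∨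
    partialTrace (ofDiagram D : TL R (0 : R) (n + 1)) = 0 := by
  rw [partialTrace_ofDiagram]
  by_cases h : ∃ F : Diagram n, Sees (closeRel D) Pt.castSucc F.partner
  · obtain ⟨F, hF⟩ := h
    exact Or.inl ⟨F, hF, evalGraph_of_sees hF⟩
  · exact Or.inr (evalGraph_eq_zero fun F hF => h ⟨F, hF⟩)

theorem Sees.partner_of_closeRel {D : Diagram (n + 1)} {F : Diagram n}
    (h : Sees (closeRel D) Pt.castSucc F.partner) {x y : Pt n}
    (hxy : D.partner (Pt.castSucc x) = Pt.castSucc y) : F.partner x = y := by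
  refine h.partner_eq ?_ (EqvGen.rel _ _ (Or.inl hxy.symm))
  rintro rfl
  exact D.partner_ne _ hxy

/-- As `m ≤ n`, the cup does not involve the strand that is closed. -/
theorem partialTrace_mem_cupIdeal {m : ℕ} (hm : m ≤ n) {X : TL R (0 : R) (n + 1)}
    (hX : X ∈ cupIdeal R (n + 1) m) : partialTrace X ∈ cupIdeal R n m := by
  induction hX using Submodule.span_induction with
  | zero => rw [map_zero]; exact zero_mem _
  | add X X' _ _ h h' => rw [map_add]; exact add_mem h h'
  | smul c X _ h => rw [map_smul]; exact Submodule.smul_mem _ _ h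
  | mem X hX =>
    obtain ⟨D, ⟨i, j, hi, hj, hij⟩, rfl⟩ := hX
    rcases partialTrace_cases (R := R) D with ⟨F, hF, h⟩ | h <;> rw [h]
    · exact ofDiagram_mem_cupIdeal ⟨⟨i, by omega⟩, ⟨j, by omega⟩, hi, hj,
        hF.partner_of_closeRel hij⟩
    · exact zero_mem _

theorem partialTrace_mem_capIdeal {m : ℕ} (hm : m ≤ n) {X : TL R (0 : R) (n + 1)}
    (hX : X ∈ capIdeal R (n + 1) m) : partialTrace X ∈ capIdeal R n m := by
  rw [← flipHom_flipHom X]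
  rw [capIdeal, Submodule.mem_comap] at hX
  generalize flipHom R (n + 1) X = X at hX ⊢
  induction hX using Submodule.span_induction with
  | zero => rw [map_zero, map_zero]; exact zero_mem _
  | add X X' _ _ h h' => rw [map_add, map_add]; exact add_mem h h'
  | smul c X _ h => rw [map_smul, map_smul]; exact Submodule.smul_mem _ _ h
  | mem X hX =>
    obtain ⟨D, ⟨i, j, hi, hj, hij⟩, rfl⟩ := hX
    rw [flipHom_ofDiagram]
    rcases partialTrace_cases (R := R) D.flip with ⟨F, hF, h⟩ | h <;> rw [h]
    · rw [capIdeal, Submodule.mem_comap, flipHom_ofDiagram]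
      have h1 : D.flip.partner (Pt.castSucc (Sum.inl ⟨i, by omega⟩)) =
          Pt.castSucc (Sum.inl ⟨j, by omega⟩) := by
        change (D.partner (Sum.inr i)).swap = _
        rw [hij]; rfl
      refine ofDiagram_mem_cupIdeal ⟨⟨i, by omega⟩, ⟨j, by omega⟩, hi, hj, ?_⟩
      change (F.partner (Sum.inl ⟨i, by omega⟩)).swap = _
      rw [hF.partner_of_closeRel h1]; rfl
    · exact zero_mem _

theorem partialTrace_one : partialTrace (1 : TL R (0 : R) (n + 1)) = 0 := by
  rw [one_eq, partialTrace_ofDiagram]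
  refine evalGraph_eq_zero_of_not_loopFree fun hl => ?_
  let P : Pt (n + 1) → Prop := fun v => v = Sum.inl (Fin.last n) ∨ v = Sum.inr (Fin.last n)
  obtain ⟨x, hx⟩ := hl (Sum.inl (Fin.last n))
  have := eqvGen_le (s := fun v w => (P v ↔ P w)) ⟨fun _ => Iff.rfl, Iff.symm, Iff.trans⟩ ?_ hx
  · have h3 : P (Pt.castSucc x) := this.1 (Or.inl rfl)
    rcases x with x | x <;> simp [P, (Fin.castSucc_lt_last x).ne] at h3
  · rintro v w (rfl | ⟨rfl, rfl⟩)
    · rcases v with v | v <;> simp [P, Diagram.identity]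
    · simp [P]

/-- The partial trace of `D`, if the last strand of `D` ends at the points joined by `F`. -/
theorem partialTrace_eq {D : Diagram (n + 1)} {F : Diagram n} (x : Pt n)
    (hl : D.partner (Sum.inl (Fin.last n)) = Pt.castSucc x)
    (hr : D.partner (Sum.inr (Fin.last n)) = Pt.castSucc (F.partner x))
    (ho : ∀ z, z ≠ x → z ≠ F.partner x → D.partner (Pt.castSucc z) = Pt.castSucc (F.partner z)) :
    partialTrace (ofDiagram D : TL R (0 : R) (n + 1)) = ofDiagram F := by
  rw [partialTrace_ofDiagram]
  refine evalGraph_of_sees ?_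
  have hl' := (D.partner_eq_iff _ _).1 hl
  have hr' := (D.partner_eq_iff _ _).1 hr
  let σ : Pt (n + 1) → Pt n := Sum.elim
    (Fin.lastCases (motive := fun _ => Pt n) x Sum.inl)
    (Fin.lastCases (motive := fun _ => Pt n) (F.partner x) Sum.inr)
  have σl : σ (Sum.inl (Fin.last n)) = x := by simp [σ]
  have σr : σ (Sum.inr (Fin.last n)) = F.partner x := by simp [σ]
  have σc : ∀ z, σ (Pt.castSucc z) = z := by rintro (z | z) <;> simp [σ]
  have el : EqvGen (closeRel D) (Sum.inl (Fin.last n)) (Pt.castSucc x) :=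
    EqvGen.rel _ _ (Or.inl hl.symm)
  have er : EqvGen (closeRel D) (Sum.inr (Fin.last n)) (Pt.castSucc (F.partner x)) :=
    EqvGen.rel _ _ (Or.inl hr.symm)
  have elr : EqvGen (closeRel D) (Sum.inl (Fin.last n)) (Sum.inr (Fin.last n)) :=
    EqvGen.rel _ _ (Or.inr ⟨rfl, rfl⟩)
  have ex : EqvGen (closeRel D) (Pt.castSucc x) (Pt.castSucc (F.partner x)) :=
    EqvGen.trans _ _ _ (EqvGen.symm _ _ el) (EqvGen.trans _ _ _ elr er)
  refine Sees.of_retract σ F.partner_partner ?_ ?_ σc ?_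
  · intro v
    rcases Pt.cases_castSucc v with ⟨z, rfl⟩ | rfl | rfl
    · rw [σc]; exact EqvGen.refl _
    · rw [σl]; exact el
    · rw [σr]; exact er
  · rintro v w (rfl | ⟨rfl, rfl⟩)
    · rcases Pt.cases_castSucc v with ⟨z, rfl⟩ | rfl | rfl
      · by_cases h1 : z = x
        · rw [h1, hl', σl, σc]; exact Or.inl rfl
        by_cases h2 : z = F.partner x
        · rw [h2, hr', σr, σc]; exact Or.inl rfl
        rw [ho z h1 h2, σc, σc]; exact Or.inr rfl
      · rw [hl, σl, σc]; exact Or.inl rfl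
      · rw [hr, σr, σc]; exact Or.inl rfl
    · rw [σl, σr]; exact Or.inr rfl
  · intro z
    by_cases h1 : z = x
    · rw [h1]; exact ex
    by_cases h2 : z = F.partner x
    · rw [h2, F.partner_partner]; exact EqvGen.symm _ _ ex
    exact EqvGen.rel _ _ (Or.inl (ho z h1 h2).symm)

theorem partialTrace_U (m : ℕ) : partialTrace (U R 0 (m + 2) (m + 1)) = 1 := by
  rw [U_succ (by omega : m + 1 < m + 2), one_eq]
  refine partialTrace_eq (Sum.inl ⟨m, by omega⟩) (cupCap_inl_right _ _) (cupCap_inr_right _ _) ?_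
  rintro (⟨z, hz⟩ | ⟨z, hz⟩) h1 h2
  · refine cupCap_inl_of_ne _ _ _ ?_ ?_
    · intro h; simp only [Fin.val_castSucc] at h; subst h; exact h1 rfl
    · simp; omega
  · refine cupCap_inr_of_ne _ _ _ ?_ ?_
    · intro h; simp only [Fin.val_castSucc] at h; subst h; exact h2 rfl
    · simp; omega

/-! ### Partial traces of the words in E_1, E_2, E_3 -/

section Words
variable (m : ℕ)

theorem partialTrace_U_mul_U :
    partialTrace (U R 0 (m + 3) (m + 1) * U R 0 (m + 3) (m + 2)) = U R 0 (m + 2) (m + 1) := by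
  rw [U_succ (by omega : m + 1 < m + 3), U_succ (by omega : m + 1 + 1 < m + 3),
    U_succ (by omega : m + 1 < m + 2)]
  have d1 := cupCap_inr_of_ne (n := m + 3) (m + 1) (by omega) ⟨m, by omega⟩ (by simp)
    (by simp; omega)
  have d2 := cupCap_inr_left (n := m + 3) (m + 1) (by omega)
  obtain ⟨G, hG, h⟩ := exists_cupCap_mul R m (by omega : m + 1 < m + 3)
    (Diagram.cupCap (m + 1) (by omega)) (by rw [d1]; simp)
  rw [h]
  have ho := hG.other
  have hj := hG.join
  rw [d1, d2] at ho hj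
  refine partialTrace_eq (Sum.inl ⟨m + 1, by omega⟩) ?_ ?_ ?_
  · refine (ho (Sum.inl ⟨m + 2, by omega⟩) ?_ ?_ ?_ ?_).trans (cupCap_inl_right _ _) <;> simp
  · rw [cupCap_inl_right]
    exact (G.partner_eq_iff _ _).1 hj
  · rw [cupCap_inl_right]
    rintro (⟨z, hz⟩ | ⟨z, hz⟩) h1 h2
    · simp only [ne_eq, Sum.inl.injEq, Fin.mk.injEq] at h1 h2
      rw [cupCap_inl_of_ne _ _ _ h2 h1]
      refine (ho (Sum.inl ⟨z, by omega⟩) ?_ ?_ ?_ ?_).trans (cupCap_inl_of_ne _ _ _ ?_ ?_) <;>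
        simp <;> omega
    · by_cases k1 : z = m
      · subst k1
        rw [cupCap_inr_left]
        exact hG.top
      by_cases k2 : z = m + 1
      · subst k2
        rw [cupCap_inr_right]
        exact hG.symm.top
      rw [cupCap_inr_of_ne _ _ _ k1 k2]
      refine (ho (Sum.inr ⟨z, by omega⟩) ?_ ?_ ?_ ?_).trans (cupCap_inr_of_ne _ _ _ ?_ ?_) <;>
        simp <;> omega

/-- The diagram `U_{m+2} U_{m+1}`. -/
theorem exists_U_succ_mul_U : ∃ G : Diagram (m + 3),
    U R 0 (m + 3) (m + 2) * U R 0 (m + 3) (m + 1) = ofDiagram G ∧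
    G.partner (Sum.inr ⟨m + 1, by omega⟩) = Sum.inr ⟨m + 2, by omega⟩ ∧
    G.partner (Sum.inl ⟨m + 2, by omega⟩) = Sum.inr ⟨m, by omega⟩ ∧
    G.partner (Sum.inl ⟨m, by omega⟩) = Sum.inl ⟨m + 1, by omega⟩ ∧
    ∀ z (hz : z < m), G.partner (Sum.inl ⟨z, by omega⟩) = Sum.inr ⟨z, by omega⟩ := by
  rw [U_succ (by omega : m + 1 < m + 3), U_succ (by omega : m + 1 + 1 < m + 3)]
  have d1 := cupCap_inr_right (n := m + 3) m (by omega)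
  have d2 := cupCap_inr_of_ne (n := m + 3) m (by omega) ⟨m + 2, by omega⟩ (by simp) (by simp)
  obtain ⟨G, hG, h⟩ := exists_cupCap_mul R (m + 1) (by omega : m + 1 + 1 < m + 3)
    (Diagram.cupCap m (by omega)) (by rw [d1]; simp; omega)
  have ho := hG.other
  have hj := hG.join
  rw [d1, d2] at ho hj
  refine ⟨G, h, hG.top, (G.partner_eq_iff _ _).1 hj, ?_, fun z hz => ?_⟩
  · refine (ho _ ?_ ?_ ?_ ?_).trans (cupCap_inl_left _ _) <;> simp
  · refine (ho _ ?_ ?_ ?_ ?_).trans (cupCap_inl_of_ne _ _ _ ?_ ?_) <;> simp <;> omega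

theorem partialTrace_U_succ_mul_U :
    partialTrace (U R 0 (m + 3) (m + 2) * U R 0 (m + 3) (m + 1)) = U R 0 (m + 2) (m + 1) := by
  obtain ⟨G, h, g1, g2, g3, g4⟩ := exists_U_succ_mul_U (R := R) m
  rw [h, U_succ (by omega : m + 1 < m + 2)]
  refine partialTrace_eq (Sum.inr ⟨m, by omega⟩) g2 ?_ ?_
  · rw [cupCap_inr_left]
    exact (G.partner_eq_iff _ _).1 g1
  · rw [cupCap_inr_left]
    rintro (⟨z, hz⟩ | ⟨z, hz⟩) h1 h2
    · rcases (by omega : z < m ∨ z = m ∨ z = m + 1) with hz | rfl | rfl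
      · rw [cupCap_inl_of_ne _ _ _ (by simp; omega) (by simp; omega)]
        exact g4 z hz
      · rw [cupCap_inl_left]
        exact g3
      · rw [cupCap_inl_right]
        exact (G.partner_eq_iff _ _).1 g3
    · simp only [ne_eq, Sum.inr.injEq, Fin.mk.injEq] at h1 h2
      rw [cupCap_inr_of_ne _ _ _ h1 h2]
      exact (G.partner_eq_iff _ _).1 (g4 z (by omega))

theorem partialTrace_U_mul_U_mul_U_mul_U :
    partialTrace (U R 0 (m + 4) (m + 2) * (U R 0 (m + 4) (m + 1) *
      (U R 0 (m + 4) (m + 3) * U R 0 (m + 4) (m + 2)))) = U R 0 (m + 3) (m + 2) := by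
  obtain ⟨D, hD, g1, g2, g3, g4⟩ := exists_U_succ_mul_U (R := R) (m + 1)
  have g2' := (D.partner_eq_iff _ _).1 g2
  have g5 := (D.partner_eq_iff _ _).1 (g4 m (by omega))
  replace hD : U R 0 (m + 4) (m + 3) * U R 0 (m + 4) (m + 2) = ofDiagram D := hD
  rw [hD, U_succ (by omega : m + 1 < m + 4), U_succ (by omega : m + 1 + 1 < m + 4),
    U_succ (by omega : m + 1 + 1 < m + 3)]
  obtain ⟨H, hH, h⟩ := exists_cupCap_mul R m (by omega : m + 1 < m + 4) D
    (by rw [g5]; simp)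
  have ho := hH.other
  have hj := hH.join
  rw [g5, g2'] at ho hj
  have k1 : H.partner (Sum.inr ⟨m + 2, by omega⟩) = Sum.inr ⟨m + 3, by omega⟩ := by
    refine (ho _ ?_ ?_ ?_ ?_).trans g1 <;> simp
  obtain ⟨G, hG, h'⟩ := exists_cupCap_mul R (m + 1) (by omega : m + 1 + 1 < m + 4) H
    (by rw [hH.symm.top]; simp; omega)
  have ho' := hG.other
  have hj' := hG.join
  rw [hH.symm.top, k1] at ho' hj'
  rw [h, h']
  refine partialTrace_eq (Sum.inl ⟨m, by omega⟩) ?_ ?_ ?_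
  · refine (ho' (Sum.inl ⟨m + 3, by omega⟩) ?_ ?_ ?_ ?_).trans ((H.partner_eq_iff _ _).1 hj) <;>
      simp
  · rw [cupCap_inl_of_ne _ _ _ (by simp) (by simp; omega)]
    exact (G.partner_eq_iff _ _).1 hj'
  · rw [cupCap_inl_of_ne _ _ _ (by simp) (by simp; omega)]
    have g3' := (D.partner_eq_iff _ _).1 g3
    rintro (⟨z, hz⟩ | ⟨z, hz⟩) h1 h2
    · simp only [ne_eq, Sum.inl.injEq, Fin.mk.injEq] at h1
      refine (ho' (Sum.inl ⟨z, by omega⟩) (by simp) (by simp) (by simp) (by simp)).trans ?_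
      refine (ho _ (by simp) (by simp) (by simpa using h1) (by simp; omega)).trans ?_
      rcases (by omega : z < m ∨ z = m + 1 ∨ z = m + 2) with hz | rfl | rfl
      · rw [cupCap_inl_of_ne _ _ _ (by simp; omega) (by simp; omega)]
        exact g4 z (by omega)
      · rw [cupCap_inl_left]
        exact g3
      · rw [cupCap_inl_right]
        exact g3'
    · simp only [ne_eq, Sum.inr.injEq, Fin.mk.injEq] at h2
      rcases (by omega : z < m ∨ z = m + 1 ∨ z = m + 2) with hz | rfl | rfl
      · rw [cupCap_inr_of_ne _ _ _ (by simp; omega) (by simp; omega)]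
        refine (ho' (Sum.inr ⟨z, by omega⟩) ?_ ?_ ?_ ?_).trans
          ((ho _ ?_ ?_ ?_ ?_).trans ((D.partner_eq_iff _ _).1 (g4 z (by omega)))) <;>
          simp <;> omega
      · rw [cupCap_inr_left]
        exact hG.top
      · rw [cupCap_inr_right]
        exact hG.symm.top

end Words

variable {k : Type*} [Field k]

/-- Sandwiching by the projector does not change an element up to diagrams with cups or caps. -/
theorem jw_mul_mul_jw_sub_mem (n j : ℕ) (X : TL k 0 n) :
    jw k (U k 0 n) j * X * jw k (U k 0 n) j - X ∈
      cupIdeal k n (2 * j + 1) ⊔ capIdeal k n (2 * j + 1) := by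
  set e := jw k (U k 0 n) j
  have h : e * X * e - X = (e - 1) * (X * e) + X * (e - 1) := by noncomm_ring
  rw [h]
  exact Submodule.add_mem_sup (mul_mem_cupIdeal (jw_sub_one_mem_cupIdeal n j) _)
    (mul_mem_capIdeal _ (jw_sub_one_mem_capIdeal n j))

/-- In the recursion every term but 1 has a cup or a cap away from the last strand: E_1 and E_3
begin with an innermost generator `U (2 * j + 1)` after `e`, and E_2 ends with it before `e`. Such
terms do not contribute, and closing 1 gives a loop. -/
theorem p₁_eq_zero [CharZero k] (j : ℕ) : p₁ k 0 (2 * j + 1) = 0 := by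
  rw [p₁, JW_eq]
  rcases j with _ | j
  · change coeff (partialTrace (1 : TL k 0 1)) (Diagram.identity 0) = 0
    rw [partialTrace_one, ← coeffHom_apply, map_zero]
  set n := 2 * (j + 1) + 1
  set e := jw k (U k 0 n) j
  have hcup : ∀ X ∈ cupIdeal k n (2 * (j + 1)),
      coeff (partialTrace X) (Diagram.identity (2 * (j + 1))) = 0 := fun X hX =>
    coeff_identity_of_mem_cupIdeal (partialTrace_mem_cupIdeal le_rfl hX)
  have hcap : ∀ X ∈ capIdeal k n (2 * (j + 1)),
      coeff (partialTrace X) (Diagram.identity (2 * (j + 1))) = 0 := fun X hX =>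
    coeff_identity_of_mem_capIdeal (partialTrace_mem_capIdeal le_rfl hX)
  have hz := cupIdeal_mono (R := k) (n := n) (show 2 * j + 1 ≤ 2 * (j + 1) by omega)
    (jw_sub_one_mem_cupIdeal n j)
  have hz' : e - 1 ∈ capIdeal k n (2 * (j + 1)) :=
    Submodule.comap_mono (cupIdeal_mono (show 2 * j + 1 ≤ 2 * (j + 1) by omega))
      (jw_sub_one_mem_capIdeal n j)
  have key : ∀ Z : TL k 0 n,
      e * (U k 0 n (2 * j + 1) * Z) ∈ cupIdeal k n (2 * (j + 1)) := by
    intro Z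
    have := add_mem (mul_mem_cupIdeal hz (U k 0 n (2 * j + 1) * Z))
      (mul_mem_cupIdeal (U_mem_cupIdeal (R := k) (n := n)
        (show 2 * j + 1 < 2 * (j + 1) by omega)) Z)
    rwa [sub_mul, one_mul, sub_add_cancel] at this
  have key' : ∀ Z : TL k 0 n,
      Z * (U k 0 n (2 * j + 1)) * e ∈ capIdeal k n (2 * (j + 1)) := by
    intro Z
    have := add_mem (mul_mem_capIdeal (Z * U k 0 n (2 * j + 1)) hz')
      (mul_mem_capIdeal Z (U_mem_capIdeal (R := k) (n := n)
        (show 2 * j + 1 < 2 * (j + 1) by omega)))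
    rwa [mul_sub, mul_one, sub_add_cancel] at this
  have hrw : jw k (U k 0 n) (j + 1) = (e - 1) + 1 - e₁ (U k 0 n) (2 * j + 1) e -
      e₂ (U k 0 n) (2 * j + 1) e - (ptr k j)⁻¹ • e₃ (U k 0 n) (2 * j + 1) e := by
    rw [jw]; abel
  have h1 : e₁ (U k 0 n) (2 * j + 1) e ∈ cupIdeal k n (2 * (j + 1)) := by
    rw [e₁, mul_assoc, mul_assoc]; exact key _
  have h2 : e₂ (U k 0 n) (2 * j + 1) e ∈ capIdeal k n (2 * (j + 1)) := by
    rw [e₂, ← mul_assoc]; exact key' _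
  have h3 : e₃ (U k 0 n) (2 * j + 1) e ∈ cupIdeal k n (2 * (j + 1)) := by
    rw [e₃, mul_assoc, mul_assoc, mul_assoc]; exact key _
  rw [← coeffHom_apply]
  simp only [← coeffHom_apply] at hcup hcap
  rw [hrw, map_sub, map_sub, map_sub, map_sub, map_sub, map_sub, map_add, map_add, map_smul,
    map_smul, hcup _ hz, hcup _ h1, hcap _ h2, hcup _ h3, partialTrace_one]
  simp

/-- The functional `f` ignores cups and caps among the strands that stay open, so the outer copies
of `e` may be dropped. The summand `e` gives 0, E_1 and E_2 give 1 each, and the scaled E_3 gives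
`(ptr k j)⁻¹`; with their signs this is the recursion `ptr_succ`. -/
theorem p₂_eq [CharZero k] (j : ℕ) : p₂ k 0 (2 * j + 3) = ptr k (j + 1) := by
  rw [show 2 * j + 3 = 2 * (j + 1) + 1 by ring]
  change coeff (partialTrace (partialTrace (JW k 0 (2 * (j + 1) + 1)))) (Diagram.identity (2 * j + 1))
    = _
  rw [JW_eq]
  let f : TL k 0 (2 * j + 3) →ₗ[k] k :=
    coeffHom k (Diagram.identity (2 * j + 1)) ∘ₗ partialTrace ∘ₗ partialTrace
  change f (jw k (U k 0 (2 * j + 3)) (j + 1)) = _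
  have hcup : ∀ X ∈ cupIdeal k (2 * j + 3) (2 * j + 1), f X = 0 := fun X hX =>
    coeff_identity_of_mem_cupIdeal
      (partialTrace_mem_cupIdeal le_rfl (partialTrace_mem_cupIdeal (by omega) hX))
  have hcap : ∀ X ∈ capIdeal k (2 * j + 3) (2 * j + 1), f X = 0 := fun X hX =>
    coeff_identity_of_mem_capIdeal
      (partialTrace_mem_capIdeal le_rfl (partialTrace_mem_capIdeal (by omega) hX))
  set e := jw k (U k 0 (2 * j + 3)) j with he
  have hs : ∀ X, f (e * X * e) = f X := by
    intro X
    obtain ⟨Y, hY, Z, hZ, hYZ⟩ := Submodule.mem_sup.1 (jw_mul_mul_jw_sub_mem (k := k) _ j X)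
    rw [← sub_eq_zero, ← map_sub, ← hYZ, map_add, hcup Y hY, hcap Z hZ, add_zero]
  have h0 : f e = 0 := by
    have h1 : f 1 = 0 := by simp [f, partialTrace_one]
    have := hcup _ (jw_sub_one_mem_cupIdeal (k := k) (2 * j + 3) j)
    rwa [map_sub, h1, sub_zero] at this
  have hU : f (U k 0 (2 * j + 3) (2 * j + 1) * U k 0 (2 * j + 3) (2 * j + 2)) = 1 := by
    change coeff (partialTrace (partialTrace _)) _ = 1
    rw [partialTrace_U_mul_U, partialTrace_U, one_eq, coeff_ofDiagram_self]
  have hU' : f (U k 0 (2 * j + 3) (2 * j + 2) * U k 0 (2 * j + 3) (2 * j + 1)) = 1 := by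
    change coeff (partialTrace (partialTrace _)) _ = 1
    rw [partialTrace_U_succ_mul_U, partialTrace_U, one_eq, coeff_ofDiagram_self]
  have hU3 : (ptr k j)⁻¹ • f (U k 0 (2 * j + 3) (2 * j + 1) * (U k 0 (2 * j + 3) (2 * j) *
      U k 0 (2 * j + 3) (2 * j + 2)) * U k 0 (2 * j + 3) (2 * j + 1)) = (ptr k j)⁻¹ := by
    rcases j with _ | j
    · simp [ptr_zero]
    · rw [mul_assoc, mul_assoc]
      change _ • coeff (partialTrace (partialTrace _)) _ = _
      have := partialTrace_U_mul_U_mul_U_mul_U (R := k) (2 * j + 1)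
      refine (congrArg (fun X => (ptr k (j + 1))⁻¹ • coeff (partialTrace X)
        (Diagram.identity (2 * j + 3))) this).trans ?_
      rw [partialTrace_U (2 * j + 2), one_eq, coeff_ofDiagram_self, smul_eq_mul, mul_one]
  have hJ : jw k (U k 0 (2 * j + 3)) (j + 1) = e - e * (U k 0 (2 * j + 3) (2 * j + 1) *
      U k 0 (2 * j + 3) (2 * j + 2)) * e - e * (U k 0 (2 * j + 3) (2 * j + 2) *
      U k 0 (2 * j + 3) (2 * j + 1)) * e - (ptr k j)⁻¹ • (e * (U k 0 (2 * j + 3) (2 * j + 1) *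
      (U k 0 (2 * j + 3) (2 * j) * U k 0 (2 * j + 3) (2 * j + 2)) *
      U k 0 (2 * j + 3) (2 * j + 1)) * e) := rfl
  rw [hJ, map_sub, map_sub, map_sub, map_smul, hs, hs, hs, hU3, hU, hU', h0, ptr_succ]
  ring

end Traces

/-! ### The degree as a sum of weights of strands -/

section Degrees

variable {n : ℕ} {A : Type*} [AddCommGroup A]

/-- A function on `ℕ` that depends on the parity only. -/
def parityWt (α β : A) (i : ℕ) : A := if i % 2 = 0 then α else β

/-- The weight of the strand from `x` to `y`, counted at the left endpoint of a cap or a cup. -/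
def arcWt (α β : A) : Pt n → Pt n → A
  | Sum.inl i, Sum.inl j => if i.val < j.val then parityWt α β i else 0
  | Sum.inr i, Sum.inr j => if i.val < j.val then -parityWt α β (i + 1) else 0
  | _, _ => 0

/-- The total weight of a diagram. -/
def diagWt (α β : A) (D : Diagram n) : A := ∑ x, arcWt α β x (D.partner x)

/-- All strands of `D` join points at places of different parity. -/
def IsBipartite (D : Diagram n) : Prop := ∀ x, (pos x + pos (D.partner x)) % 2 = 1

theorem sum_eq_of_ne_four {ι : Type*} [Fintype ι] [DecidableEq ι] {f g : ι → A} {p q x y : ι}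
    (hpq : p ≠ q) (hpx : p ≠ x) (hpy : p ≠ y) (hqx : q ≠ x) (hqy : q ≠ y) (hxy : x ≠ y)
    (h : ∀ z, z ≠ p → z ≠ q → z ≠ x → z ≠ y → f z = g z) :
    ∑ z, f z - ∑ z, g z = (f p + f q + f x + f y) - (g p + g q + g x + g y) := by
  rw [← Finset.sum_sub_distrib, ← Finset.sum_subset (Finset.subset_univ {p, q, x, y})]
  · rw [Finset.sum_insert (by simp [hpq, hpx, hpy]), Finset.sum_insert (by simp [hqx, hqy]),
      Finset.sum_insert (by simp [hxy]), Finset.sum_singleton]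
    abel
  · intro z _ hz
    simp only [Finset.mem_insert, Finset.mem_singleton, not_or] at hz
    rw [h z hz.1 hz.2.1 hz.2.2.1 hz.2.2.2, sub_self]

/-- The joined points have opposite parity, hence so do their partners. Parity is carried along the
words in the generators, so it need not be proved for all diagrams. -/
theorem CupStep.isBipartite {i : ℕ} (hi : i + 1 < n) {D F : Diagram n}
    (h : CupStep ⟨i, by omega⟩ ⟨i + 1, hi⟩ D F) (hD : IsBipartite D) : IsBipartite F := by
  have hpq : (pos (Sum.inr ⟨i, by omega⟩ : Pt n) + pos (Sum.inr ⟨i + 1, hi⟩ : Pt n)) % 2 = 1 := by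
    simp only [pos]; omega
  have hp := hD (Sum.inr ⟨i, by omega⟩)
  have hq := hD (Sum.inr ⟨i + 1, hi⟩)
  intro z
  by_cases h1 : z = Sum.inr ⟨i, by omega⟩
  · rw [h1, h.top]; exact hpq
  by_cases h2 : z = Sum.inr ⟨i + 1, hi⟩
  · rw [h2, h.symm.top]; omega
  by_cases h3 : z = D.partner (Sum.inr ⟨i, by omega⟩)
  · rw [h3, h.join]; omega
  by_cases h4 : z = D.partner (Sum.inr ⟨i + 1, hi⟩)
  · rw [h4, h.symm.join]; omega
  rw [h.other z h1 h2 h3 h4]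
  exact hD z

/-- Two chords of a circle that do not cross and start at consecutive points. -/
theorem consecutive_not_cross {p q x y : ℕ} (hpq : p = q + 1) (hxy : x ≠ y) (hxp : x ≠ p)
    (hyq : y ≠ q) (hxq : x ≠ q) (hyp : y ≠ p) (h : ¬ (q < p ∧ p < y ∧ y < x))
    (h' : ¬ (x < q ∧ q < p ∧ p < y)) (h'' : ¬ (y < x ∧ x < q ∧ q < p)) :
    (p < x ∧ x < y) ∨ (y < q ∧ p < x) ∨ (x < y ∧ y < q) := by
  omega

theorem CupStep.diagWt {i : ℕ} (hi : i + 1 < n) (α β : A) {D F : Diagram n}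
    (h : CupStep ⟨i, by omega⟩ ⟨i + 1, hi⟩ D F) (hD : IsBipartite D)
    (hne : D.partner (Sum.inr ⟨i, by omega⟩) ≠ Sum.inr ⟨i + 1, hi⟩) :
    diagWt α β F = diagWt α β D + (parityWt α β i - parityWt α β (i + 1)) := by
  have hne' : D.partner (Sum.inr ⟨i + 1, hi⟩) ≠ Sum.inr ⟨i, by omega⟩ :=
    fun h => hne ((D.partner_eq_iff _ _).1 h)
  have hpq : (Sum.inr ⟨i, by omega⟩ : Pt n) ≠ Sum.inr ⟨i + 1, hi⟩ := by simp
  have hxy : D.partner (Sum.inr ⟨i, by omega⟩) ≠ D.partner (Sum.inr ⟨i + 1, hi⟩) :=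
    fun h => hpq (D.partner_injective h)
  rw [← sub_eq_iff_eq_add']
  refine (sum_eq_of_ne_four hpq (D.partner_ne _).symm hne'.symm hne.symm (D.partner_ne _).symm hxy
    fun z h1 h2 h3 h4 => by rw [h.other z h1 h2 h3 h4]).trans ?_
  rw [h.top, h.symm.top, h.join, h.symm.join, D.partner_partner, D.partner_partner]
  have bp := hD (Sum.inr ⟨i, by omega⟩)
  have bq := hD (Sum.inr ⟨i + 1, hi⟩)
  have c2 := D.crossingless (Sum.inr ⟨i + 1, hi⟩) (Sum.inr ⟨i, by omega⟩)
  have c3 := D.crossingless (D.partner (Sum.inr ⟨i, by omega⟩)) (Sum.inr ⟨i + 1, hi⟩)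
  have c7 := D.crossingless (D.partner (Sum.inr ⟨i + 1, hi⟩)) (D.partner (Sum.inr ⟨i, by omega⟩))
  have n1 := pos_injective.ne hxy
  have n2 := pos_injective.ne (D.partner_ne (Sum.inr ⟨i, by omega⟩))
  have n3 := pos_injective.ne (D.partner_ne (Sum.inr ⟨i + 1, hi⟩))
  have n4 := pos_injective.ne hne
  have n5 := pos_injective.ne hne'
  simp only [D.partner_partner] at c3 c7
  generalize D.partner (Sum.inr ⟨i, by omega⟩) = x at *
  generalize D.partner (Sum.inr ⟨i + 1, hi⟩) = y at *
  have hP : pos (Sum.inr ⟨i, by omega⟩ : Pt n) = pos (Sum.inr ⟨i + 1, hi⟩ : Pt n) + 1 := by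
    simp only [pos]; omega
  -- Around the strip the four endpoints come in the cyclic order `i + 1`, `i`, `x`, `y`. This and
  -- the parities of `x` and `y` fix the weights of the two old strands and of the fused one.
  have key := consecutive_not_cross hP n1 n2 n3 n4 n5 c2 c3 c7
  clear h hD c2 c3 c7 n1 n2 n3 n4 n5 hP hne hne' hpq hxy
  have wt : ∀ a b, a % 2 = b % 2 → parityWt α β a = parityWt α β b := fun a b hab => by
    rw [parityWt, parityWt, hab]
  have o1 : i < i + 1 := by omega
  have o2 : ¬ i + 1 < i := by omega
  rcases x with ⟨x, hx⟩ | ⟨x, hx⟩ <;> rcases y with ⟨y, hy⟩ | ⟨y, hy⟩ <;>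
    simp only [pos] at bp bq key
  · have h3 : x % 2 = i % 2 := by clear key bq; omega
    have h1 : x < y := by clear bp bq; omega
    have h2 : ¬ y < x := h1.le.not_gt
    simp only [arcWt, o1, o2, h1, h2, if_true, if_false, wt x i h3]
    abel
  · have h1 : i + 1 < y := by clear bp bq; omega
    have h2 : ¬ y < i + 1 := h1.le.not_gt
    have h3 : (i + 1 + 1) % 2 = i % 2 := by clear key bp bq; omega
    simp only [arcWt, o1, o2, h1, h2, if_true, if_false, wt (i + 1 + 1) i h3]
    abel
  · have h1 : x < i := by clear bp bq; omega
    have h2 : ¬ i < x := h1.le.not_gt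
    have h3 : (x + 1) % 2 = i % 2 := by clear key bq; omega
    simp only [arcWt, o1, o2, h1, h2, if_true, if_false, wt (x + 1) i h3]
    abel
  · have h1 : (y < x ∧ x < i) ∨ (i + 1 < y ∧ y < x) ∨ (x < i ∧ i + 1 < y) := by
      clear bp bq; omega
    have h2 : (x + 1) % 2 = i % 2 := by clear key bq h1; omega
    have h3 : (y + 1) % 2 = (i + 1) % 2 := by clear key bp h1; omega
    have h4 : (i + 1 + 1) % 2 = i % 2 := by clear key bp bq h1; omega
    clear bp bq key
    rcases h1 with ⟨h5, h6⟩ | ⟨h5, h6⟩ | ⟨h5, h6⟩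
    · simp only [arcWt, o1, o2, h5, h6, show ¬ x < y by omega, show ¬ i < x by omega,
        show y < i + 1 by omega, show ¬ i + 1 < y by omega, if_true, if_false, wt _ _ h2, wt _ _ h3]
      abel
    · simp only [arcWt, o1, o2, h5, h6, show ¬ x < y by omega, show i < x by omega,
        show ¬ y < i + 1 by omega, show ¬ x < i by omega, if_true, if_false, wt _ _ h3, wt _ _ h4]
      abel
    · simp only [arcWt, o1, o2, h5, h6, show x < y by omega, show ¬ i < x by omega,
        show ¬ y < i + 1 by omega, show ¬ y < x by omega, if_true, if_false, wt _ _ h2, wt _ _ h4]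
      abel

/-! ### Weights under multiplication by generators and projectors -/

section Homogeneous
variable {R : Type*} [CommRing R]

/-- The span of the diagrams of weight `d`. -/
def homSpan (R : Type*) [CommRing R] (n : ℕ) (α β : A) (d : A) : Submodule R (TL R (0 : R) n) :=
  Submodule.span R (ofDiagram '' {D | IsBipartite D ∧ diagWt α β D = d})

theorem U_mul_mem_homSpan (α β d : A) {Y : TL R (0 : R) n} (hY : Y ∈ homSpan R n α β d) (i : ℕ) :
    U R 0 n (i + 1) * Y ∈ homSpan R n α β (d + (parityWt α β i - parityWt α β (i + 1))) := by
  by_cases hi : i + 1 < n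
  · rw [U_succ hi]
    induction hY using Submodule.span_induction with
    | zero => rw [mul_zero]; exact zero_mem _
    | add X X' _ _ h h' => rw [mul_add]; exact add_mem h h'
    | smul c X _ h => rw [mul_smul_comm]; exact Submodule.smul_mem _ _ h
    | mem X hX =>
      obtain ⟨D, ⟨hD, hd⟩, rfl⟩ := hX
      by_cases hne : D.partner (Sum.inr ⟨i, by omega⟩) = Sum.inr ⟨i + 1, hi⟩
      · rw [cupCap_mul_of_eq R i hi D hne]
        exact zero_mem _
      · obtain ⟨F, hF, h⟩ := exists_cupCap_mul R i hi D hne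
        rw [h]
        exact Submodule.subset_span ⟨F, ⟨hF.isBipartite hi hD, by
          rw [hF.diagWt hi α β hD hne, hd]⟩, rfl⟩
  · rw [U_eq_zero (by omega), zero_mul]
    exact zero_mem _

/-- Generators are numbered from 1 but weights from 0, so an odd generator has its left endpoint at
an even place. Even generators shift the weight by the opposite amount. -/
theorem U_odd_mul_mem (α β d : A) {Y : TL R (0 : R) n} (hY : Y ∈ homSpan R n α β d) (j : ℕ) :
    U R 0 n (2 * j + 1) * Y ∈ homSpan R n α β (d + (α - β)) := by
  have := U_mul_mem_homSpan α β d hY (2 * j)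
  rwa [parityWt, parityWt, if_pos (by omega), if_neg (by omega)] at this

theorem U_even_mul_mem (α β d : A) {Y : TL R (0 : R) n}
    (hY : Y ∈ homSpan R n α β (d + (α - β))) (j : ℕ) :
    U R 0 n (2 * j) * Y ∈ homSpan R n α β d := by
  rcases j with _ | j
  · rw [U_zero, zero_mul]; exact zero_mem _
  · have := U_mul_mem_homSpan α β _ hY (2 * j + 1)
    rwa [parityWt, parityWt, if_neg (by omega), if_pos (by omega), add_assoc,
      sub_add_sub_cancel, sub_self, add_zero] at this

theorem U_even_mul_mem' (α β d : A) {Y : TL R (0 : R) n}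
    (hY : Y ∈ homSpan R n α β d) (j : ℕ) :
    U R 0 n (2 * j) * Y ∈ homSpan R n α β (d - (α - β)) :=
  U_even_mul_mem α β _ (by rwa [sub_add_cancel]) j

/-- Between the copies of the previous projector, E_1 and E_2 have one odd and one even generator
and E_3 has two of each, so the shifts cancel. -/
theorem jw_mul_mem_homSpan {k : Type*} [Field k] (n j : ℕ) (α β d : A) {Y : TL k (0 : k) n}
    (hY : Y ∈ homSpan k n α β d) : jw k (U k 0 n) j * Y ∈ homSpan k n α β d := by
  induction j generalizing d Y with
  | zero => rwa [jw, one_mul]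
  | succ j ih =>
    have h0 := ih d hY
    simp only [jw, e₁, e₂, e₃, sub_mul, smul_mul_assoc, mul_assoc, Nat.add_sub_cancel]
    refine sub_mem (sub_mem (sub_mem h0 (ih d ?_)) (ih d ?_)) (Submodule.smul_mem _ _ (ih d ?_))
    · have := U_odd_mul_mem α β _ (U_even_mul_mem' α β d h0 (j + 1)) j
      rwa [sub_add_cancel] at this
    · exact U_even_mul_mem α β d (U_odd_mul_mem α β d h0 j) (j + 1)
    · have := U_odd_mul_mem α β _ (U_even_mul_mem' α β d (U_even_mul_mem α β d
        (U_odd_mul_mem α β d h0 j) (j + 1)) j) j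
      rwa [sub_add_cancel] at this

theorem one_mem_homSpan (α β : A) : (1 : TL R (0 : R) n) ∈ homSpan R n α β 0 := by
  refine Submodule.subset_span ⟨Diagram.identity n, ⟨?_, ?_⟩, rfl⟩
  · rintro (⟨x, hx⟩ | ⟨x, hx⟩) <;> simp only [Diagram.identity, Sum.swap_inl, Sum.swap_inr, pos] <;>
      omega
  · refine Finset.sum_eq_zero ?_
    rintro (x | x) _ <;> rfl

theorem diagWt_eq_of_mem_homSpan {α β d : A} {X : TL R (0 : R) n} (hX : X ∈ homSpan R n α β d)
    {D : Diagram n} (hD : coeff X D ≠ 0) : diagWt α β D = d := by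
  by_contra hne
  refine hD ?_
  rw [← coeffHom_apply]
  clear hD
  induction hX using Submodule.span_induction with
  | zero => exact map_zero _
  | add X X' _ _ h h' => rw [map_add, h, h', add_zero]
  | smul c X _ h => rw [map_smul, h, smul_zero]
  | mem X hX =>
    obtain ⟨E, ⟨-, hE⟩, rfl⟩ := hX
    refine coeff_ofDiagram_of_ne ?_
    rintro rfl
    exact hne hE

end Homogeneous

open Classical in
theorem ncard_smul_eq_sum (P : Fin n → Prop) (c : A) :
    Set.ncard {i | P i} • c = ∑ i, if P i then c else 0 := by
  rw [← Finset.sum_filter, Finset.sum_const, Set.ncard_eq_toFinset_card', Set.toFinset_ofPred]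

/-- Counting from 0 exchanges the parities, so `gt - fs`, the degree of an odd cap, becomes the
weight at even places. A cup has minus the degree of a cap of the other parity, whence the `i + 1`
in `arcWt`. -/
theorem degree_eq_diagWt (fs gs ft gt : A) (D : Diagram n) :
    degree fs gs ft gt D = diagWt (gt - fs) (gs - ft) D := by
  classical
  rw [degree, numCaps, numCaps, numCups, numCups, ncard_smul_eq_sum, ncard_smul_eq_sum,
    ncard_smul_eq_sum, ncard_smul_eq_sum, diagWt, Fintype.sum_sum_type, add_assoc,
    ← Finset.sum_add_distrib, ← Finset.sum_add_distrib]
  congr 1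
  · refine Finset.sum_congr rfl fun i _ => ?_
    rcases h : D.partner (Sum.inl i) with j | j
    · simp only [Set.mem_ofPred_eq, Sum.inl.injEq, arcWt, parityWt, Fin.lt_def, Nat.even_iff,
        Nat.odd_iff, exists_eq_right']
      split_ifs <;> first | omega | simp
    · simp [arcWt]
  · refine Finset.sum_congr rfl fun i _ => ?_
    rcases h : D.partner (Sum.inr i) with j | j
    · simp [arcWt]
    · simp only [Set.mem_ofPred_eq, Sum.inr.injEq, arcWt, parityWt, Fin.lt_def, Nat.even_iff,
        Nat.odd_iff, exists_eq_right']
      split_ifs <;> first | omega | simp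

theorem isHomogeneous_JW {k : Type*} [Field k] [CharZero k] (j : ℕ) (fs gs ft gt : A) :
    IsHomogeneous fs gs ft gt (JW k 0 (2 * j + 1)) 0 := by
  intro D hD
  rw [JW_eq] at hD
  rw [degree_eq_diagWt]
  refine diagWt_eq_of_mem_homSpan ?_ hD
  have := jw_mul_mem_homSpan (k := k) (2 * j + 1) j (gt - fs) (gs - ft) 0 (one_mem_homSpan _ _)
  rwa [mul_one] at this

theorem numCaps_even_eq {k : Type*} [Field k] [CharZero k] (j : ℕ) {D : Diagram (2 * j + 1)}
    (hD : coeff (JW k 0 (2 * j + 1)) D ≠ 0) :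
    numCaps {i | Even i} D = numCups {i | Odd i} D := by
  -- With these values an even cap has degree 1, an odd cup -1, and the other arcs 0.
  have h := isHomogeneous_JW (k := k) j (0 : ℤ) 1 0 0 D hD
  simp only [degree] at h
  simp at h
  omega

end Degrees

/-! ### Translation to E_0, E_1, E_2, E_3 -/

section Decomposition

variable {k : Type*} [Field k]

theorem isJonesWenzl_JW [CharZero k] (j : ℕ) : IsJonesWenzl (JW k 0 (2 * j + 1)) := by
  rw [JW_eq]
  exact isJonesWenzl_jw j

theorem E₁_eq [CharZero k] (j : ℕ) : E₁ k 0 (2 * j + 1) =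
    e₁ (U k 0 (2 * j + 3)) (2 * j + 1) (jw k (U k 0 (2 * j + 3)) j) := by
  rw [E₁, E₀_eq]; rfl

theorem E₂_eq [CharZero k] (j : ℕ) : E₂ k 0 (2 * j + 1) =
    e₂ (U k 0 (2 * j + 3)) (2 * j + 1) (jw k (U k 0 (2 * j + 3)) j) := by
  rw [E₂, E₀_eq]; rfl

theorem E₃_eq [CharZero k] (j : ℕ) : E₃ k 0 (2 * j + 1) =
    e₃ (U k 0 (2 * j + 3)) (2 * j + 1) (jw k (U k 0 (2 * j + 3)) j) := by
  rw [E₃, E₀_eq]; rfl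

/-- Includes `j = 0`, where the coefficient of E_3 is 0. -/
theorem JW_add_two [CharZero k] (j : ℕ) : JW k 0 (2 * j + 3) =
    E₀ k 0 (2 * j + 1) - E₁ k 0 (2 * j + 1) - E₂ k 0 (2 * j + 1) -
      (ptr k j)⁻¹ • E₃ k 0 (2 * j + 1) := by
  rw [E₁_eq, E₂_eq, E₃_eq, E₀_eq]
  exact JW_eq (j + 1)

theorem isIdempotentElem_E₀ [CharZero k] (j : ℕ) : IsIdempotentElem (E₀ k 0 (2 * j + 1)) := by
  rw [E₀_eq]
  exact (isProj (relations_U k (2 * j + 3)) j (by omega)).idem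

theorem orthogonal_E [CharZero k] (j : ℕ) :
    let a := E₁ k 0 (2 * j + 1)
    let b := E₂ k 0 (2 * j + 1)
    let c := (ptr k j)⁻¹ • E₃ k 0 (2 * j + 1)
    let J := JW k 0 (2 * j + 3)
    (a * a = a ∧ b * b = b ∧ c * c = c ∧ J * J = J) ∧ (a * b = 0 ∧ b * a = 0) ∧
      (a * c = 0 ∧ c * a = 0) ∧ (b * c = 0 ∧ c * b = 0) ∧ (J * a = 0 ∧ a * J = 0) ∧
      (J * b = 0 ∧ b * J = 0) ∧ (J * c = 0 ∧ c * J = 0) := by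
  rw [E₁_eq, E₂_eq, E₃_eq, show JW k 0 (2 * j + 3) = _ from JW_eq (j + 1)]
  exact orthogonal (relations_U k (2 * j + 3)) j (by omega)

end Decomposition

end TemperleyLieb

end

/-! ### The theorem and its corollary -/

theorem mainTheorem11 (k : Type*) [Field k] [CharZero k] :
    -- the projectors exist and are unique for odd `n`, and `p_1^{(n)} = 0`
    (∀ n : ℕ, Odd n →
      (IsJonesWenzl (JW k 0 n) ∧ ∀ X : TL k 0 n, IsJonesWenzl X → X = JW k 0 n) ∧
      p₁ k 0 n = 0) ∧
    -- invertibility, recursive formula and closed formula for `p_2^{(n)}`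
    (∀ n : ℕ, Odd n → 3 ≤ n → IsUnit (p₂ k 0 n)) ∧
    p₂ k 0 3 = -2 ∧
    (∀ n : ℕ, Odd n → 3 ≤ n → p₂ k 0 (n + 2) = -2 - 1 / p₂ k 0 n) ∧
    (∀ j : ℕ, 1 ≤ j → p₂ k 0 (2 * j + 1) = -((j : k) + 1) / (j : k)) ∧
    -- the recursive formula for the projectors
    JW k 0 3 = E₀ k 0 1 - E₁ k 0 1 - E₂ k 0 1 ∧
    (∀ n : ℕ, Odd n → 3 ≤ n →
      JW k 0 (n + 2) = E₀ k 0 n - E₁ k 0 n - E₂ k 0 n - (1 / p₂ k 0 n) • E₃ k 0 n) ∧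
    -- the orthogonal decomposition of the idempotent `E_0^{(n)}`, for `n = 1` and for `n ≥ 3`
    (∀ e : Fin 3 → TL k 0 3, e = ![JW k 0 3, E₁ k 0 1, E₂ k 0 1] →
      IsIdempotentElem (E₀ k 0 1) ∧ (∀ i, IsIdempotentElem (e i)) ∧
      (∀ i j, i ≠ j → e i * e j = 0) ∧ E₀ k 0 1 = ∑ i, e i) ∧
    (∀ n : ℕ, Odd n → 3 ≤ n → ∀ e : Fin 4 → TL k 0 (n + 2),
      e = ![JW k 0 (n + 2), E₁ k 0 n, E₂ k 0 n, (1 / p₂ k 0 n) • E₃ k 0 n] →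
      IsIdempotentElem (E₀ k 0 n) ∧ (∀ i, IsIdempotentElem (e i)) ∧
      (∀ i j, i ≠ j → e i * e j = 0) ∧ E₀ k 0 n = ∑ i, e i) ∧
    -- homogeneity of `JW_n` for odd `n`
    (∀ n : ℕ, Odd n →
      (∀ (A : Type*) [AddCommGroup A] (fs gs ft gt : A),
        IsHomogeneous fs gs ft gt (JW k 0 n) 0) ∧
      ∀ D : Diagram n, coeff (JW k 0 n) D ≠ 0 →
        numCaps {i | Even i} D = numCups {i | Odd i} D) := by
  have hp (i : ℕ) : p₂ k 0 (2 * (i + 1) + 1) = ptr k (i + 1) := p₂_eq i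
  have hrec : JW k 0 3 = E₀ k 0 1 - E₁ k 0 1 - E₂ k 0 1 := by
    have h := JW_add_two (k := k) 0
    rw [ptr_zero, inv_zero, zero_smul, sub_zero] at h
    exact h
  refine ⟨?_, ?_, ?_, ?_, ?_, hrec, ?_, ?_, ?_, ?_⟩
  · rintro _ ⟨j, rfl⟩
    exact ⟨⟨isJonesWenzl_JW j, fun X hX => hX.unique (by omega) (isJonesWenzl_JW j)⟩, p₁_eq_zero j⟩
  · rintro _ ⟨_ | j, rfl⟩ hn
    · omega
    · rw [hp]
      exact (ptr_ne_zero (by omega)).isUnit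
  · refine (hp 0).trans ?_
    rw [ptr_succ, ptr_zero, inv_zero, sub_zero]
  · rintro _ ⟨_ | j, rfl⟩ hn
    · omega
    · rw [hp, one_div, ← ptr_succ]
      exact hp (j + 1)
  · rintro (_ | j) hj
    · omega
    · rw [hp, ptr]
  · rintro _ ⟨_ | j, rfl⟩ hn
    · omega
    · rw [hp, one_div]
      exact JW_add_two (j + 1)
  · rintro e rfl
    obtain ⟨⟨ha, hb, -, hj⟩, ⟨hab, hba⟩, -, -, ⟨hja, haj⟩, ⟨hjb, hbj⟩, -⟩ := orthogonal_E (k := k) 0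
    refine ⟨isIdempotentElem_E₀ 0, ?_, ?_, ?_⟩
    · intro i
      fin_cases i
      exacts [hj, ha, hb]
    · intro i l hil
      fin_cases i <;> fin_cases l <;> first | exact absurd rfl hil | skip
      exacts [hja, hjb, haj, hab, hbj, hba]
    · rw [Fin.sum_univ_three]
      change _ = JW k 0 3 + E₁ k 0 1 + E₂ k 0 1
      rw [hrec]
      abel
  · rintro _ ⟨_ | j, rfl⟩ hn e rfl
    · omega
    obtain ⟨⟨ha, hb, hc, hj⟩, ⟨hab, hba⟩, ⟨hac, hca⟩, ⟨hbc, hcb⟩, ⟨hja, haj⟩, ⟨hjb, hbj⟩,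
      ⟨hjc, hcj⟩⟩ := orthogonal_E (k := k) (j + 1)
    rw [hp, one_div]
    refine ⟨isIdempotentElem_E₀ (j + 1), ?_, ?_, ?_⟩
    · intro i
      fin_cases i
      exacts [hj, ha, hb, hc]
    · intro i l hil
      fin_cases i <;> fin_cases l <;> first | exact absurd rfl hil | skip
      exacts [hja, hjb, hjc, haj, hab, hac, hbj, hba, hbc, hcj, hca, hcb]
    · rw [Fin.sum_univ_four]
      change _ = JW k 0 (2 * (j + 1) + 3) + E₁ k 0 _ + E₂ k 0 _ + _ • E₃ k 0 _
      rw [JW_add_two]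
      abel
  · rintro _ ⟨j, rfl⟩
    exact ⟨fun A _ fs gs ft gt => isHomogeneous_JW j fs gs ft gt, fun D hD => numCaps_even_eq j hD⟩
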